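/- Let $k>1$, let $M_k$ be the algebra of complex $k\times k$ matrices with matrix units $e_{ij}$, and let $A=M_k\otimes M_k\otimes\cdots$ be the UHF algebra of type $k^\infty$; $M_k^{\otimes n}\subset A$ denotes the subalgebra generated by the first $n$ tensor factors. Put $\omega=e^{2\pi i/k}$, $v=1\oplus\omega\oplus\cdots\oplus\omega^{k-1}\in M_k$. For a state $f$ of $A$ let $(\pi_f,H_f,\Omega_f)$ be its GNS representation, and call a unital $*$-endomorphism $\gamma$ of $A$ asymptotically inner if $\gamma(x)=\lim_{t\to1}u_txu_t^*$ for all $x\in A$, for some norm-continuous path $(u_t)_{t\in[0,1)}$ of unitaries of $A$ with $u_0=1$. A prime denotes the commutant. Then the following hold. (1) There is an automorphism $\sigma=\bigotimes_{n}\mathrm{Ad}\,v$ of $A$ (acting as $\mathrm{Ad}\,v$ on each tensor factor), and $\sigma^k=\mathrm{id}$. Let $A^\sigma=\{x\in A:\sigma(x)=x\}$. (2) The product state $\varphi=\varphi_0\otimes\varphi_0\otimes\cdots$, $\varphi_0(x)=x_{11}$, is a $\sigma$-invariant pure state of $A$. The product state $\chi=\varphi_1\otimes\varphi_1\otimes\cdots$,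 $\varphi_1(x)=k^{-1}\sum_{i,j}x_{ij}$, is a pure state, and the GNS representations of $\chi,\chi\sigma,\dots,\chi\sigma^{k-1}$ are mutually disjoint. With $\xi=k^{-1/2}\sum_{j=1}^k\pi_\varphi(e_{j1}^{(1)})\Omega_\varphi$, where $e^{(1)}_{ij}$ are the matrix units of the first factor, $\psi(x)=\langle\xi,\pi_\varphi(x)\xi\rangle$ is a pure state of $A$ that is not $\sigma$-invariant, but $\sigma$ is implemented by a unitary in $\pi_\psi$. (3) There is an asymptotically inner unital $*$-endomorphism $\gamma$ of $A$ with $\gamma(A)=A^\sigma$ and $\gamma(M_k^{\otimes n})\subset M_k^{\otimes(n+1)}$ for all $n$, such that moreover $\chi\gamma=\chi$ and there is a unitary $W$ on $H_\chi$ with $W\pi_\chi(x)W^*=\pi_\chi(\gamma(x))$ for all $x\in A$. (4) Let $\gamma$ be any unital $*$-endomorphism of $A$ with $\gamma(A)=A^\sigma$. There is a unitary $U$ on $H_\varphi$ with $U\pi_\varphi(x)\Omega_\varphi=\pi_\varphi(\sigma(x))\Omega_\varphi$ and $U\pi_\varphi(x)U^*=\pi_\varphi(\sigma(x))$ for all $x\in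 A$, $U^k=1$, and $$\pi_\varphi\gamma(A)'=\{U\}''\cong\mathbb C^k .$$ Moreover $\varphi|_{\gamma(A)}$ is a pure state of $\gamma(A)$, $\pi_\chi\gamma(A)'=\mathbb C1$, and $A\cap\gamma(A)'=\mathbb C1$. (5) $A$ is isomorphic to the infinite tensor product $A\otimes A\otimes\cdots$. For every $\gamma$ as in (4) and every identification $A=A\otimes A\otimes\cdots$ there is a unital $*$-endomorphism $\gamma^\infty=\gamma\otimes\gamma\otimes\cdots$ of $A$, which is asymptotically inner if $\gamma$ is, and the product states $\varphi^\infty=\varphi\otimes\varphi\otimes\cdots$, $\psi^\infty=\psi\otimes\psi\otimes\cdots$ exist and are pure. The restriction of $\varphi^\infty$ to $\gamma^\infty(A)$ is pure, and $$\pi_{\varphi^\infty}\gamma^\infty(A)'\cong\ell^\infty(\mathbb N),\qquad \pi_{\psi^\infty}\gamma^\infty(A)'\cong L^\infty(G),$$ where $G=\prod_{n\in\mathbb N}\mathbb Z/k\mathbb Z$ with Haar measure; the latter algebra has no minimal projections. (All isomorphisms of operator algebras are $*$-isomorphisms.) -/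

import Mathlib

open scoped ComplexOrder ENNReal Topology
open MeasureTheory

noncomputable section

namespace UHFEndo

/-- A realization of the unital C*-algebra `A` as the infinite tensor power `B ⊗ B ⊗ ⋯`: a sequence
of mutually commuting unital copies of `B` which together generate `A` as a C*-algebra.
For simple nuclear `B`, in particular for `B = M_k` and for `B` a UHF algebra, and for `A ≠ 0`, this
determines `A` together with the embeddings up to a unique isomorphism, since all C*-norms on the
algebraic tensor product agree. -/
structure InfTensorPower (B : Type*) [Ring B] [StarRing B] [Algebra ℂ B]
    (A : Type*) [CStarAlgebra A] where
  /-- The embedding of the `n`-th tensor factor. -/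
  factor : ℕ → B →⋆ₐ[ℂ] A
  commute : ∀ m n, m ≠ n → ∀ x y, Commute (factor m x) (factor n y)
  dense : (StarAlgebra.adjoin ℂ (⋃ n, Set.range (factor n))).topologicalClosure = ⊤

/-- `A` is presented as the UHF algebra of type `k^∞`, i.e. as `M_k ⊗ M_k ⊗ ⋯`. -/
abbrev UHF (k : ℕ) (A : Type*) [CStarAlgebra A] :=
  InfTensorPower (Matrix (Fin k) (Fin k) ℂ) A

/-- The *-subalgebra `B^{⊗ n}` generated by the first `n` tensor factors. -/
def InfTensorPower.level {B : Type*} [Ring B] [StarRing B] [Algebra ℂ B]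
    {A : Type*} [CStarAlgebra A] (T : InfTensorPower B A) (n : ℕ) : StarSubalgebra ℂ A :=
  StarAlgebra.adjoin ℂ (⋃ i < n, Set.range (T.factor i))

/-- `f = f₀ ⊗ f₀ ⊗ ⋯`, i.e. `f (x₀ ⊗ ⋯ ⊗ xₙ₋₁ ⊗ 1 ⊗ ⋯) = f₀ x₀ ⋯ f₀ xₙ₋₁`. -/
def InfTensorPower.IsProduct {B : Type*} [Ring B] [StarRing B] [Algebra ℂ B]
    {A : Type*} [CStarAlgebra A] (T : InfTensorPower B A) (f : A → ℂ) (f₀ : B → ℂ) : Prop :=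
  ∀ (n : ℕ) (x : ℕ → B),
    f ((List.range n).map fun i => T.factor i (x i)).prod = ∏ i ∈ Finset.range n, f₀ (x i)

/-- The diagonal unitary `v = 1 ⊕ ω ⊕ ω² ⊕ ⋯ ⊕ ω^{k-1}` with `ω = e^{2πi/k}`. -/
def clock (k : ℕ) : Matrix (Fin k) (Fin k) ℂ :=
  Matrix.diagonal fun j => Complex.exp (2 * Real.pi * Complex.I / k) ^ (j : ℕ)

/-- The states of a unital *-algebra (used for unital C*-algebras, where a positive functional
`f` satisfies `‖f‖ = f 1`). -/
def states (A : Type*) [Ring A] [StarRing A] [Algebra ℂ A] : Set (A →ₗ[ℂ] ℂ) :=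
  {f | f 1 = 1 ∧ ∀ x, 0 ≤ f (star x * x)}

/-- A pure state: an extreme point of the convex set of states. -/
def IsPureState {A : Type*} [Ring A] [StarRing A] [Algebra ℂ A] (f : A →ₗ[ℂ] ℂ) : Prop :=
  f ∈ Set.extremePoints ℝ (states A)

/-- `γ` is asymptotically inner: `γ x = lim_{t → 1} u_t x u_t^*` for a continuous path of
unitaries `u_t`, `t ∈ [0, 1)`, starting at `1`. -/
def IsAsymptoticallyInner {A : Type*} [CStarAlgebra A] (γ : A →⋆ₐ[ℂ] A) : Prop :=
  ∃ u : ℝ → unitary A, ContinuousOn u (Set.Ico 0 1) ∧ u 0 = 1 ∧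
    ∀ x, Filter.Tendsto (fun t => (u t : A) * x * star (u t : A)) (𝓝[<] 1) (𝓝 (γ x))

section GNS

variable {A : Type*} [CStarAlgebra A] [PartialOrder A] [StarOrderedRing A]

/-- The cyclic vector `Ω_f` of the GNS representation. -/
def cyclicVector (f : A →ₚ[ℂ] ℂ) : f.GNS := ((f.toPreGNS 1 : f.PreGNS) : f.GNS)

/-- The commutant `π_f(γ(A))'` of the image of `γ` in the GNS representation of `f`. -/
def gnsCommutant (f : A →ₚ[ℂ] ℂ) (γ : A →⋆ₐ[ℂ] A) : StarSubalgebra ℂ (f.GNS →L[ℂ] f.GNS) :=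
  StarSubalgebra.centralizer ℂ (Set.range fun x => f.gnsStarAlgHom (γ x))

/-- The *-endomorphism `γ` is implemented by the unitary `U` in the GNS representation of `f`. -/
def Implements (f : A →ₚ[ℂ] ℂ) (U : unitary (f.GNS →L[ℂ] f.GNS)) (γ : A → A) : Prop :=
  ∀ x, (U : f.GNS →L[ℂ] f.GNS) * f.gnsStarAlgHom x * star (U : f.GNS →L[ℂ] f.GNS) =
    f.gnsStarAlgHom (γ x)

/-- The GNS representations of `f` and `g` are disjoint: no non-zero intertwiner. -/
def DisjointGNS (f g : A →ₚ[ℂ] ℂ) : Prop :=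
  ∀ T : f.GNS →L[ℂ] g.GNS,
    (∀ x, T ∘L f.gnsStarAlgHom x = g.gnsStarAlgHom x ∘L T) → T = 0

/-- The state `f ∘ α`. -/
def pullback (f : A →ₚ[ℂ] ℂ) (α : A →⋆ₐ[ℂ] A) : A →ₚ[ℂ] ℂ :=
  f.comp (PositiveLinearMap.ofClass α)

/-- The vector `k^{-1/2} ∑_j π_f(e_{j1}) Ω_f`, with `e_{ij}` the matrix units of the first
tensor factor. -/
def flatVector {k : ℕ} [NeZero k] (T : UHF k A) (f : A →ₚ[ℂ] ℂ) : f.GNS :=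
  ((Real.sqrt k : ℂ))⁻¹ •
    ∑ j : Fin k, f.gnsStarAlgHom (T.factor 0 (Matrix.single j 0 1)) (cyclicVector f)

end GNS

section VonNeumann

variable {H : Type*} [NormedAddCommGroup H] [InnerProductSpace ℂ H] [CompleteSpace H]

/-- The double commutant `{U}''`. -/
def doubleCommutant (U : H →L[ℂ] H) : StarSubalgebra ℂ (H →L[ℂ] H) :=
  StarSubalgebra.centralizer ℂ (StarSubalgebra.centralizer ℂ {U} : Set (H →L[ℂ] H))

/-- `M` is *-isomorphic to `L^∞(G, μ)` with pointwise operations. -/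
def IsoLInfty (M : StarSubalgebra ℂ (H →L[ℂ] H)) {G : Type*} [MeasurableSpace G]
    (μ : Measure G) : Prop :=
  ∃ Φ : Lp ℂ ∞ μ ≃ₗ[ℂ] M,
    (∀ f g : Lp ℂ ∞ μ, Φ (f • g : Lp ℂ ∞ μ) = Φ f * Φ g) ∧ ∀ f, Φ (star f) = star (Φ f)

/-- `M` has no minimal projections. -/
def IsNonAtomic (M : StarSubalgebra ℂ (H →L[ℂ] H)) : Prop :=
  ∀ E ∈ M, IsStarProjection E → E ≠ 0 →
    ∃ F ∈ M, IsStarProjection F ∧ F ≠ 0 ∧ F ≠ E ∧ F * E = F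

end VonNeumann

section Existence

open ContinuousLinearMap in
/-- Isometries on `ℓ²(ℕ)` satisfying the Cuntz relations. -/
theorem exists_cuntz (k : ℕ) [NeZero k] :
    ∃ s : Fin k → (lp (fun _ : ℕ => ℂ) 2 →L[ℂ] lp (fun _ : ℕ => ℂ) 2),
      (∀ a b, star (s a) * s b = if a = b then 1 else 0) ∧ ∑ a, s a * star (s a) = 1 := by
  classical
  let H := lp (fun _ : ℕ => ℂ) 2
  let b : HilbertBasis ℕ ℂ H := HilbertBasis.ofRepr (LinearIsometryEquiv.refl ℂ H)
  let e : ℕ ≃ ℕ × Fin k := Nat.divModEquiv k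
  have hv : ∀ a : Fin k, Orthonormal ℂ (fun n => b (e.symm (n, a))) := fun a =>
    b.orthonormal.comp _ (fun m n h => by simpa using h)
  let s : Fin k → (H →L[ℂ] H) := fun a =>
    (hv a).orthogonalFamily.linearIsometry.toContinuousLinearMap
  have hs : ∀ a n, s a (b n) = b (e.symm (n, a)) := by
    intro a n
    have h1 : b n = lp.single 2 n (1 : ℂ) := by
      rw [← b.repr_symm_single]
      rfl
    change (hv a).orthogonalFamily.linearIsometry (b n) = _
    rw [h1, OrthogonalFamily.linearIsometry_apply_single]
    simp
  have hext : ∀ T T' : H →L[ℂ] H, (∀ n, T (b n) = T' (b n)) → T = T' := by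
    intro T T' h
    refine ContinuousLinearMap.ext_on
      (Submodule.dense_iff_topologicalClosure_eq_top.mpr b.dense_span) ?_
    rintro _ ⟨n, rfl⟩
    exact h n
  have hext' : ∀ x y : H, (∀ n, inner ℂ (b n) x = inner ℂ (b n) y) → x = y := by
    intro x y h
    apply b.repr.injective
    ext n
    rw [b.repr_apply_apply, b.repr_apply_apply, h]
  have hb := orthonormal_iff_ite.mp b.orthonormal
  have hrel : ∀ a c, star (s a) * s c = if a = c then 1 else 0 := by
    intro a c
    apply hext
    intro n
    apply hext'
    intro m
    rw [star_eq_adjoint]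
    change inner ℂ (b m) (adjoint (s a) (s c (b n))) = _
    rw [adjoint_inner_right, hs, hs, hb]
    by_cases hac : a = c
    · subst hac
      simp [hb]
    · simp [hac]
  refine ⟨s, hrel, ?_⟩
  apply hext
  intro n
  obtain ⟨⟨m, c⟩, rfl⟩ := e.symm.surjective n
  rw [← hs c m]
  have : ∀ a, (s a * star (s a)) (s c (b m)) = if a = c then s c (b m) else 0 := by
    intro a
    have := congrArg (fun T => s a (T (b m))) (hrel a c)
    change s a (star (s a) (s c (b m))) = _
    change s a (star (s a) (s c (b m))) = _ at this
    rw [this]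
    split_ifs with h
    · subst h; simp
    · simp
  simp [this]

/-- A C*-algebra with isometries `s₁, …, s_k` satisfying the Cuntz relations contains a UHF algebra of
type `k^∞`. -/
theorem exists_uhf_of_cuntz (k : ℕ) {C : Type*} [CStarAlgebra C] [Nontrivial C]
    (s : Fin k → C) (h1 : ∀ a b, star (s a) * s b = if a = b then 1 else 0)
    (h2 : ∑ a, s a * star (s a) = 1) :
    ∃ S : StarSubalgebra ℂ C, ∃ _ : IsClosed (S : Set C), Nontrivial S ∧ Nonempty (UHF k S) := by
  classical
  have h1' : ∀ a b (y : C), star (s a) * (s b * y) = if a = b then y else 0 := by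
    intro a b y
    rw [← mul_assoc, h1]; split_ifs <;> simp
  let ρ : Matrix (Fin k) (Fin k) ℂ →⋆ₐ[ℂ] C :=
    { toFun := fun x => ∑ a, ∑ b, x a b • (s a * star (s b))
      map_one' := by
        simp [Matrix.one_apply, ite_smul, Finset.sum_ite_eq, h2]
      map_mul' := by
        intro x y
        simp only [Matrix.mul_apply, Finset.sum_mul, Finset.mul_sum, smul_mul_smul_comm, mul_assoc,
          h1', Finset.sum_smul, mul_ite, smul_ite, mul_zero, smul_zero, Finset.sum_ite_eq',
          Finset.mem_univ, if_true]
        rw [Finset.sum_comm]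
        conv_rhs => rw [Finset.sum_comm]
        exact Finset.sum_congr rfl fun _ _ => Finset.sum_comm
      map_zero' := by simp
      map_add' := by intro x y; simp [add_smul, Finset.sum_add_distrib]
      commutes' := by
        intro r
        simp [Matrix.algebraMap_matrix_apply, ite_smul, Algebra.algebraMap_eq_smul_one, ← h2,
          Finset.smul_sum]
      map_star' := by
        intro x
        simp only [star_sum, star_smul, star_mul, star_star, Matrix.star_apply]
        exact Finset.sum_comm }
  let Λ : C →⋆ₐ[ℂ] C :=
    { toFun := fun y => ∑ a, s a * (y * star (s a))
      map_one' := by simp [h2]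
      map_mul' := by
        intro x y
        simp [Finset.sum_mul, Finset.mul_sum, mul_assoc, h1']
      map_zero' := by simp
      map_add' := by intro x y; simp [add_mul, mul_add, Finset.sum_add_distrib]
      commutes' := by
        intro r
        simp [Algebra.algebraMap_eq_smul_one, ← Finset.smul_sum, h2]
      map_star' := by
        intro x
        simp [mul_assoc] }
  have hcomm : ∀ x y, Commute (ρ x) (Λ y) := by
    intro x y
    change (∑ a, ∑ b, x a b • (s a * star (s b))) * (∑ a, s a * (y * star (s a))) =
      (∑ a, s a * (y * star (s a))) * (∑ a, ∑ b, x a b • (s a * star (s b)))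
    simp [Finset.sum_mul, Finset.mul_sum, mul_assoc, h1']
    exact Finset.sum_comm
  let f : ℕ → Matrix (Fin k) (Fin k) ℂ →⋆ₐ[ℂ] C :=
    fun n => Nat.rec ρ (fun _ g => Λ.comp g) n
  have hf : ∀ m n, m < n → ∀ x y, Commute (f m x) (f n y) := by
    intro m
    induction m with
    | zero =>
      rintro (_ | n) h x y
      · omega
      · exact hcomm x (f n y)
    | succ m ih =>
      rintro (_ | n) h x y
      · omega
      · exact (ih n (by omega) x y).map Λ
  let S₀ := StarAlgebra.adjoin ℂ (⋃ n, Set.range (f n))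
  let S := S₀.topologicalClosure
  have hmem : ∀ n x, f n x ∈ S := fun n x =>
    S₀.le_topologicalClosure (StarAlgebra.subset_adjoin ℂ _ (Set.mem_iUnion.mpr ⟨n, x, rfl⟩))
  have hcl : IsClosed (S : Set C) := S₀.isClosed_topologicalClosure
  refine ⟨S, hcl, inferInstance, ⟨⟨fun n => (f n).codRestrict S (hmem n), ?_, ?_⟩⟩⟩
  · intro m n hmn x y
    refine Subtype.ext ?_
    rcases lt_or_gt_of_ne hmn with h | h
    · exact hf m n h x y
    · exact (hf n m h y x).symm
  · rw [eq_top_iff]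
    rintro ⟨y, hy⟩ -
    have key : ∀ z (hz : z ∈ S₀), (⟨z, S₀.le_topologicalClosure hz⟩ : S) ∈
        StarAlgebra.adjoin ℂ (⋃ n, Set.range ((f n).codRestrict S (hmem n))) := by
      intro z hz
      induction hz using StarAlgebra.adjoin_induction with
      | mem x h =>
        obtain ⟨n, x, rfl⟩ := Set.mem_iUnion.mp h
        exact StarAlgebra.subset_adjoin ℂ _ (Set.mem_iUnion.mpr ⟨n, x, rfl⟩)
      | algebraMap r => exact algebraMap_mem _ r
      | add x y hx hy h h' => exact add_mem h h'
      | mul x y hx hy h h' => exact mul_mem h h'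
      | star x hx h => exact star_mem h
    change _ ∈ closure _
    rw [closure_subtype]
    refine closure_mono ?_ hy
    intro z hz
    exact ⟨_, key z hz, rfl⟩

/-- The UHF algebra of type `k^∞` exists. -/
theorem exists_uhf (k : ℕ) [NeZero k] :
    ∃ (A : Type) (_ : CStarAlgebra A), Nontrivial A ∧ Nonempty (UHF k A) := by
  obtain ⟨s, h1, h2⟩ := exists_cuntz k
  have : Nontrivial (lp (fun _ : ℕ => ℂ) 2) :=
    ⟨⟨lp.single 2 0 1, 0, fun h => by simpa using congrArg (fun f => f 0) h⟩⟩
  obtain ⟨S, hS, hn, hT⟩ := exists_uhf_of_cuntz k s h1 h2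
  exact ⟨S, inferInstance, hn, hT⟩

end Existence

end UHFEndo
end

set_option linter.unusedSectionVars false

noncomputable section

namespace UHFEndo

open Filter

/-! The analysis of states rests on excision: projections `p n` of value `1` with `p n * x * p n - f
x • p n → 0`. Rank-one projections excise product states. Compressing by them constructs the state
(`exists_product_state`), shows it pure (`Excised.isPureState`) and its GNS representation
irreducible (`Excised.eq_smul_one`). In the GNS space the `p n` tend strongly to the projection onto
`Ω`, so an operator commuting with all late `X p_n X*` has `XΩ` as an eigenvector
(`Excised.exists_eq_smul`). A general `γ` enters only through its range `A^σ`, the elements of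
degree zero for the `ℤ/k`-grading given by `σ`.

For `φ`, the elements `e_{j0} p_n e_{0j}` have degree zero, so the vectors `e_{j0} Ω` are
eigenvectors of everything in the commutant. They generate mutually orthogonal, jointly total cyclic
subspaces for `A^σ`, so the commutant is diagonal, and `U` separates the blocks by the eigenvalues
`ω^j`. In the infinite tensor power the same vectors are indexed by finitely supported sequences,
which gives `ℓ^∞`.

For `χ`, the shifts `w_n` in the `n`-th factor are asymptotically central and fix `Ω`, so `w_n → 1`
strongly. An element `z` of degree `j` is then the strong limit of the degree-zero elements `z
w_n^{-j}`: the commutant of `A^σ` is that of `A`, which is trivial. In the representation of `χσ^i`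
the limit of `w_n` is `ω^i`, whence disjointness.

The concrete endomorphism is `lim_N Ad (c_0 ⋯ c_{N-1})` with the controlled shifts `c_i = ∑_j e_{jj}
⊗ w^{-j}`. It sends `v_n` to `v_0 ⋯ v_n` and `w_n` to `w_n w_{n+1}^{-1}`. Its range together with
powers of `w_0` spans a dense subspace, and averaging over `σ` shows that the range is all of `A^σ`
(`IsCtrlEndo.range_eq`). Each `c_i` has finite order, hence a logarithm in its bicommutant, which
yields the path of unitaries. Each `c_i` also fixes `Ω_χ`, which yields the implementation in `π_χ`.

For `ψ^∞`, the vector `Ω` is cyclic for `γ^∞(A)`. Compression by the tails `1 ⊗ e_{00} ⊗ e_{00} ⊗ ⋯`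
makes degree-zero elements asymptotically diagonal, so the commutant maps `Ω` into the closed span
of the diagonal vectors (`IsFlatVectorTensor.commutant_apply_mem`). A diagonal projection on `n`
coordinates has value `k^{-n}`, so this span is `L²(G)`. Operators of the commutant become
multiplications by bounded functions there, and all bounded functions occur because different
diagonal blocks remain orthogonal under `γ^∞(A)`. -/

theorem continuous_starAlgHom {A C : Type*} [CStarAlgebra A] [CStarAlgebra C] (f : A →⋆ₐ[ℂ] C) :
    Continuous f :=
  AddMonoidHomClass.continuous_of_bound f 1 fun x => by
    simpa using NonUnitalStarAlgHom.norm_apply_le f x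

/-! ### Elementary tensors and density arguments -/

section TensorBasics

variable {B : Type*} [Ring B] [StarRing B] [Algebra ℂ B] {A : Type*} [CStarAlgebra A]

namespace InfTensorPower

variable (S : InfTensorPower B A)

/-- The elementary tensor `x₀ ⊗ ⋯ ⊗ xₙ₋₁ ⊗ 1 ⊗ ⋯`. -/
def tprod (n : ℕ) (x : ℕ → B) : A := ((List.range n).map fun i => S.factor i (x i)).prod

@[simp] theorem tprod_zero (x : ℕ → B) : S.tprod 0 x = 1 := by simp [tprod]

theorem tprod_succ (n : ℕ) (x : ℕ → B) :
    S.tprod (n + 1) x = S.tprod n x * S.factor n (x n) := by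
  simp [tprod, List.range_succ]

theorem tprod_congr {n : ℕ} {x y : ℕ → B} (h : ∀ i < n, x i = y i) :
    S.tprod n x = S.tprod n y := by
  induction n with
  | zero => simp
  | succ n ih => rw [tprod_succ, tprod_succ, ih fun i hi => h i (by omega), h n (by omega)]

/-- An element commuting with the factors involved commutes with an elementary tensor. -/
theorem commute_tprod_of {n : ℕ} {x : ℕ → B} {a : A} (h : ∀ i < n, Commute a (S.factor i (x i))) :
    Commute a (S.tprod n x) := by
  induction n with
  | zero => simp
  | succ n ih =>
    rw [tprod_succ]
    exact (ih fun i hi => h i (by omega)).mul_right (h n (by omega))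

theorem tprod_commute_factor {n m : ℕ} (h : n ≤ m) (x : ℕ → B) (y : B) :
    Commute (S.tprod n x) (S.factor m y) :=
  (S.commute_tprod_of fun i hi => S.commute m i (by omega) _ _).symm

theorem tprod_one (n : ℕ) : S.tprod n 1 = 1 := by
  induction n with
  | zero => simp
  | succ n ih => rw [tprod_succ, ih]; simp

theorem tprod_mul (n : ℕ) (x y : ℕ → B) :
    S.tprod n x * S.tprod n y = S.tprod n (x * y) := by
  induction n with
  | zero => simp
  | succ n ih =>
    rw [tprod_succ, tprod_succ, tprod_succ, ← ih, Pi.mul_apply, map_mul]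
    have := (S.tprod_commute_factor (le_refl n) y (x n)).eq
    simp only [mul_assoc]
    rw [← mul_assoc (S.factor n (x n)), ← this]
    simp only [mul_assoc]

theorem star_tprod (n : ℕ) (x : ℕ → B) : star (S.tprod n x) = S.tprod n (star x) := by
  induction n with
  | zero => simp
  | succ n ih =>
    rw [tprod_succ, tprod_succ, star_mul, ih, (S.tprod_commute_factor le_rfl _ _).eq,
      Pi.star_apply, map_star]

theorem tprod_extend {n m : ℕ} (h : n ≤ m) (x : ℕ → B) :
    S.tprod m (fun i => if i < n then x i else 1) = S.tprod n x := by
  induction m, h using Nat.le_induction with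
  | base => exact S.tprod_congr fun i hi => if_pos hi
  | succ m h ih =>
    rw [tprod_succ, ih]
    rw [if_neg (by omega), map_one, mul_one]

theorem tprod_mulSingle {n i : ℕ} (h : i < n) (y : B) :
    S.tprod n (Pi.mulSingle i y) = S.factor i y := by
  induction n with
  | zero => omega
  | succ n ih =>
    rw [tprod_succ]
    rcases Nat.lt_succ_iff_lt_or_eq.mp h with h | rfl
    · rw [ih h, Pi.mulSingle_eq_of_ne (by omega)]; simp
    · rw [S.tprod_congr (y := 1) (fun j hj => Pi.mulSingle_eq_of_ne (by omega) _), tprod_one]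
      simp

/-- Elementary tensors are multilinear: if every entry lies in the span of `Y`, the tensor lies in
the span of the tensors with entries in `Y`. -/
theorem tprod_mem_span {Y : Set B} {n : ℕ} {x : ℕ → B}
    (h : ∀ i < n, x i ∈ Submodule.span ℂ Y) (hY : Y.Nonempty) :
    S.tprod n x ∈ Submodule.span ℂ {a | ∃ z : ℕ → B, (∀ i, z i ∈ Y) ∧ a = S.tprod n z} := by
  obtain ⟨y₀, hy₀⟩ := hY
  induction n with
  | zero => exact Submodule.subset_span ⟨fun _ => y₀, fun _ => hy₀, by simp⟩
  | succ n ih =>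
    rw [tprod_succ]
    have h1 := ih fun i hi => h i (by omega)
    have h2 : S.factor n (x n) ∈ Submodule.span ℂ (S.factor n '' Y) := by
      have := Submodule.mem_map_of_mem (f := (S.factor n).toAlgHom.toLinearMap) (h n (by omega))
      rw [Submodule.map_span] at this
      exact this
    have := Submodule.mul_mem_mul h1 h2
    rw [Submodule.span_mul_span] at this
    refine Submodule.span_mono ?_ this
    rintro _ ⟨_, ⟨z, hz, rfl⟩, _, ⟨y, hy, rfl⟩, rfl⟩
    -- Entries beyond position `n` do not matter but must lie in `Y`, so they are filled with `y`.
    refine ⟨fun i => if i < n then z i else y, fun i => by dsimp only; split_ifs <;> simp [*], ?_⟩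
    rw [tprod_succ]
    simp only [lt_irrefl, if_false]
    rw [S.tprod_congr (x := fun i => if i < n then z i else y) (y := z) fun i hi => if_pos hi]

/-- Padding with `1` brings two elementary tensors to a common length, and their product is then
taken entrywise. So the span of elementary tensors is already a *-algebra. -/
theorem adjoin_le_span : ∀ x ∈ StarAlgebra.adjoin ℂ (⋃ n, Set.range (S.factor n)),
    x ∈ Submodule.span ℂ {a | ∃ n z, a = S.tprod n z} := by
  intro x hx
  induction hx using StarAlgebra.adjoin_induction with
  | mem x h =>
    obtain ⟨i, y, rfl⟩ := Set.mem_iUnion.mp h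
    exact Submodule.subset_span ⟨i + 1, _, (S.tprod_mulSingle (Nat.lt_succ_self i) y).symm⟩
  | algebraMap r =>
    rw [Algebra.algebraMap_eq_smul_one]
    exact Submodule.smul_mem _ _ (Submodule.subset_span ⟨0, 1, by simp⟩)
  | add x y _ _ h h' => exact add_mem h h'
  | mul x y _ _ h h' =>
    have := Submodule.mul_mem_mul h h'
    rw [Submodule.span_mul_span] at this
    refine Submodule.span_mono ?_ this
    rintro _ ⟨_, ⟨n, z, rfl⟩, _, ⟨m, y, rfl⟩, rfl⟩
    refine ⟨max n m, (fun i => if i < n then z i else 1) * (fun i => if i < m then y i else 1), ?_⟩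
    rw [← tprod_mul, S.tprod_extend (le_max_left n m), S.tprod_extend (le_max_right n m)]
  | star x hx h =>
    clear hx
    induction h using Submodule.span_induction with
    | mem x h =>
      obtain ⟨n, z, rfl⟩ := h
      exact Submodule.subset_span ⟨n, _, S.star_tprod n z⟩
    | zero => simp
    | add x y _ _ h h' => rw [star_add]; exact add_mem h h'
    | smul c x _ h => rw [star_smul]; exact Submodule.smul_mem _ _ h

theorem mem_closure_adjoin (x : A) :
    x ∈ closure (StarAlgebra.adjoin ℂ (⋃ n, Set.range (S.factor n)) : Set A) := by
  have : x ∈ (StarAlgebra.adjoin ℂ (⋃ n, Set.range (S.factor n))).topologicalClosure := by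
    rw [S.dense]; trivial
  exact this

/-- A closed linear property holds everywhere if it holds for elementary tensors. -/
theorem tprod_induction {P : A → Prop} (closed : IsClosed {x | P x})
    (tprod : ∀ n x, P (S.tprod n x)) (add : ∀ x y, P x → P y → P (x + y))
    (smul : ∀ (c : ℂ) x, P x → P (c • x)) (x : A) : P x := by
  refine closed.closure_subset_iff.mpr ?_ (S.mem_closure_adjoin x)
  intro y hy
  refine Submodule.span_induction (p := fun y _ => P y) ?_ ?_ ?_ ?_ (S.adjoin_le_span y hy)
  · rintro _ ⟨n, z, rfl⟩; exact tprod n z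
  · simpa using smul 0 _ (tprod 0 1)
  · intro x y _ _; exact add x y
  · intro c x _; exact smul c x

/-- A closed property compatible with the algebra operations holds everywhere if it holds on each
tensor factor. -/
theorem factor_induction {P : A → Prop} (closed : IsClosed {x | P x})
    (factor : ∀ n x, P (S.factor n x)) (scalar : ∀ c : ℂ, P (algebraMap ℂ A c))
    (add : ∀ x y, P x → P y → P (x + y)) (mul : ∀ x y, P x → P y → P (x * y)) (x : A) : P x := by
  refine S.tprod_induction closed (fun n x => ?_) add (fun c x hx => ?_) x
  · induction n with
    | zero => simpa using scalar 1
    | succ n ih => rw [tprod_succ]; exact mul _ _ ih (factor _ _)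
  · rw [Algebra.smul_def]; exact mul _ _ (scalar c) hx

theorem starAlgHom_ext {C : Type*} [CStarAlgebra C] {f g : A →⋆ₐ[ℂ] C}
    (h : ∀ n x, f (S.factor n x) = g (S.factor n x)) : f = g := by
  ext x
  refine S.factor_induction (P := fun x => f x = g x) ?_ h ?_ ?_ ?_ x
  · exact isClosed_eq (continuous_starAlgHom f) (continuous_starAlgHom g)
  · intro c; rw [AlgHomClass.commutes, AlgHomClass.commutes]
  · intro x y hx hy; rw [map_add, map_add, hx, hy]
  · intro x y hx hy; rw [map_mul, map_mul, hx, hy]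

theorem map_tprod {C : Type*} [Ring C] [StarRing C] [Algebra ℂ C] (f : A →⋆ₐ[ℂ] C) (n : ℕ)
    (x : ℕ → B) : f (S.tprod n x) = ((List.range n).map fun i => f (S.factor i (x i))).prod := by
  simp [tprod, map_list_prod, List.map_map, Function.comp_def]

/-- A closed star subalgebra containing all tensor factors is everything. -/
theorem mem_of_isClosed {R : StarSubalgebra ℂ A} (hR : IsClosed (R : Set A))
    (h : ∀ n x, S.factor n x ∈ R) (x : A) : x ∈ R :=
  S.factor_induction (P := (· ∈ R)) hR h (fun _ => algebraMap_mem _ _) (fun _ _ => add_mem)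
    (fun _ _ => mul_mem) x

theorem commute_map {C : Type*} [CStarAlgebra C] (f : A →⋆ₐ[ℂ] C) {c : C}
    (h : ∀ n x, Commute c (f (S.factor n x))) (x : A) : Commute c (f x) := by
  have := continuous_starAlgHom f
  refine S.factor_induction (P := fun x => Commute c (f x)) ?_ h ?_ ?_ ?_ x
  · exact isClosed_eq (by fun_prop) (by fun_prop)
  · intro r; rw [AlgHomClass.commutes]; exact Algebra.commute_algebraMap_right r c
  · intro x y hx hy; rw [map_add]; exact hx.add_right hy
  · intro x y hx hy; rw [map_mul]; exact hx.mul_right hy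

end InfTensorPower

end TensorBasics

/-! ### Matrix units and finite tensor stages -/

section MatrixUnits

/-- A system of matrix units determines a unital *-homomorphism of a matrix algebra. -/
def matrixUnitsHom {C : Type*} [Ring C] [StarRing C] [Algebra ℂ C] [StarModule ℂ C]
    {X : Type*} [Fintype X] [DecidableEq X] (u : X → X → C)
    (hmul : ∀ p q r s, u p q * u r s = if q = r then u p s else 0)
    (hstar : ∀ p q, star (u p q) = u q p) (hone : ∑ p, u p p = 1) :
    Matrix X X ℂ →⋆ₐ[ℂ] C where
  toFun m := ∑ p, ∑ q, m p q • u p q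
  map_one' := by simp [Matrix.one_apply, ite_smul, hone]
  map_mul' x y := by
    have h : ∀ p q, u p q * ∑ r, ∑ s, y r s • u r s = ∑ s, y q s • u p s := by
      intro p q
      simp only [Finset.mul_sum, mul_smul_comm, hmul, smul_ite, smul_zero]
      rw [Finset.sum_comm]
      simp
    rw [Finset.sum_mul]
    refine Finset.sum_congr rfl fun p _ => ?_
    simp only [Finset.sum_mul, smul_mul_assoc, h, Matrix.mul_apply, Finset.sum_smul,
      Finset.smul_sum, smul_smul]
    exact Finset.sum_comm
  map_zero' := by simp
  map_add' x y := by simp [add_smul, Finset.sum_add_distrib]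
  commutes' r := by
    simp [Matrix.algebraMap_matrix_apply, ite_smul, Algebra.algebraMap_eq_smul_one, ← hone,
      Finset.smul_sum]
  map_star' x := by
    simp only [star_sum, star_smul, hstar, Matrix.star_apply]
    exact Finset.sum_comm

theorem map_matrix_eq_sum {C : Type*} [Ring C] [Algebra ℂ C] {X : Type*} [Fintype X]
    [DecidableEq X] {F : Type*} [FunLike F (Matrix X X ℂ) C] [AlgHomClass F ℂ (Matrix X X ℂ) C]
    (f : F) (m : Matrix X X ℂ) :
    f m = ∑ p, ∑ q, m p q • f (Matrix.single p q 1) := by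
  conv_lhs => rw [Matrix.matrix_eq_sum_single m]
  simp only [map_sum]
  refine Finset.sum_congr rfl fun p _ => Finset.sum_congr rfl fun q _ => ?_
  rw [← map_smul, Matrix.smul_single]
  simp

theorem sum_map_single {C : Type*} [Ring C] [Algebra ℂ C] {X : Type*} [Fintype X]
    [DecidableEq X] {F : Type*} [FunLike F (Matrix X X ℂ) C] [AlgHomClass F ℂ (Matrix X X ℂ) C]
    (f : F) : ∑ p, f (Matrix.single p p 1) = 1 := by
  rw [← map_one f, map_matrix_eq_sum f 1]
  simp [Matrix.one_apply, ite_smul]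

/-- Two commuting matrix subalgebras are contained in a single matrix subalgebra. -/
theorem exists_matrixHom_of_commute {C : Type*} [Ring C] [StarRing C] [Algebra ℂ C]
    [StarModule ℂ C] {X Y : Type*} [Fintype X] [DecidableEq X] [Fintype Y] [DecidableEq Y]
    (E : Matrix X X ℂ →⋆ₐ[ℂ] C) (g : Matrix Y Y ℂ →⋆ₐ[ℂ] C) (h : ∀ x y, Commute (E x) (g y)) :
    ∃ E' : Matrix (X × Y) (X × Y) ℂ →⋆ₐ[ℂ] C, (∀ x, ∃ z, E' z = E x) ∧ (∀ y, ∃ z, E' z = g y) ∧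
      ∀ c, (∀ x, Commute c (E x)) → (∀ y, Commute c (g y)) → ∀ z, Commute c (E' z) := by
  let u : X × Y → X × Y → C := fun p q => E (Matrix.single p.1 q.1 1) * g (Matrix.single p.2 q.2 1)
  have hmul : ∀ p q r s, u p q * u r s = if q = r then u p s else 0 := by
    rintro ⟨p, p'⟩ ⟨q, q'⟩ ⟨r, r'⟩ ⟨s, s'⟩
    have h1 : u (p, p') (q, q') * u (r, r') (s, s') =
        E (Matrix.single p q 1 * Matrix.single r s 1) *
          g (Matrix.single p' q' 1 * Matrix.single r' s' 1) := by
      simp only [u, map_mul, mul_assoc]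
      rw [← mul_assoc (g _) (E _), ← (h _ _).eq, mul_assoc]
    rw [h1]
    by_cases h1 : q = r
    · by_cases h2 : q' = r'
      · subst h1 h2; simp [u]
      · simp [h1, h2]
    · simp [h1]
  have hstar : ∀ p q, star (u p q) = u q p := by
    intro p q
    simp only [u, star_mul, ← map_star, Matrix.star_eq_conjTranspose, Matrix.conjTranspose_single,
      star_one]
    exact ((h _ _).eq).symm
  have hone : ∑ p, u p p = 1 := by
    simp only [u, Fintype.sum_prod_type, ← Finset.mul_sum, ← Finset.sum_mul, sum_map_single,
      one_mul]
  refine ⟨matrixUnitsHom u hmul hstar hone, fun x => ?_, fun y => ?_, fun c hE hg z => ?_⟩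
  -- This is the Kronecker product `x ⊗ 1`; the second factor is embedded likewise as `1 ⊗ y`.
  · refine ⟨fun p q => x p.1 q.1 * if p.2 = q.2 then 1 else 0, ?_⟩
    rw [map_matrix_eq_sum E x]
    change ∑ p, ∑ q, _ • u p q = _
    simp only [Fintype.sum_prod_type, u, mul_ite, mul_one, mul_zero, ite_smul, zero_smul,
      Finset.sum_ite_eq, Finset.mem_univ, if_true]
    refine Finset.sum_congr rfl fun p _ => ?_
    rw [Finset.sum_comm]
    refine Finset.sum_congr rfl fun q _ => ?_
    rw [← Finset.smul_sum, ← Finset.mul_sum, sum_map_single g, mul_one]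
  · refine ⟨fun p q => y p.2 q.2 * if p.1 = q.1 then 1 else 0, ?_⟩
    rw [map_matrix_eq_sum g y]
    change ∑ p, ∑ q, _ • u p q = _
    simp only [Fintype.sum_prod_type, u, mul_ite, mul_one, mul_zero, ite_smul, zero_smul]
    rw [Finset.sum_comm]
    refine Finset.sum_congr rfl fun p _ => ?_
    have : ∀ a : X, ∑ b : X, ∑ q : Y, (if a = b then y p q •
        (E (Matrix.single a b 1) * g (Matrix.single p q 1)) else 0) =
        ∑ q : Y, y p q • (E (Matrix.single a a 1) * g (Matrix.single p q 1)) := by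
      intro a
      rw [Finset.sum_comm]
      simp
    simp only [this]
    rw [Finset.sum_comm]
    refine Finset.sum_congr rfl fun q _ => ?_
    rw [← Finset.smul_sum, ← Finset.sum_mul, sum_map_single E, one_mul]
  · exact Commute.sum_right _ _ _ fun p _ => Commute.sum_right _ _ _ fun q _ =>
      ((hE _).mul_right (hg _)).smul_right _

/-- Finitely many commuting copies of `M_k` are contained in a single matrix subalgebra. -/
theorem exists_matrixHom_of_family {C : Type*} [Ring C] [StarRing C] [Algebra ℂ C]
    [StarModule ℂ C] {k : ℕ} [NeZero k] (g : ℕ → Matrix (Fin k) (Fin k) ℂ →⋆ₐ[ℂ] C)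
    (hg : ∀ m n, m ≠ n → ∀ x y, Commute (g m x) (g n y)) (n : ℕ) :
    ∃ (X : Type) (_ : Fintype X) (_ : DecidableEq X) (_ : Nonempty X)
      (E : Matrix X X ℂ →⋆ₐ[ℂ] C), ∀ i < n, ∀ x, ∃ z, E z = g i x := by
  -- To adjoin the next factor, the induction must also carry that the matrix algebra built so far
  -- commutes with all later factors.
  suffices ∃ (X : Type) (_ : Fintype X) (_ : DecidableEq X) (_ : Nonempty X)
      (E : Matrix X X ℂ →⋆ₐ[ℂ] C), (∀ i < n, ∀ x, ∃ z, E z = g i x) ∧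
        ∀ j ≥ n, ∀ z y, Commute (E z) (g j y) by
    obtain ⟨X, h1, h2, h3, E, h4, -⟩ := this
    exact ⟨X, h1, h2, h3, E, h4⟩
  induction n with
  | zero =>
    refine ⟨Unit, inferInstance, inferInstance, inferInstance,
      matrixUnitsHom (fun _ _ => 1) (by simp) (by simp) (by simp), by simp, ?_⟩
    intro j _ z y
    change Commute (∑ p, ∑ q, z p q • (1 : C)) _
    exact Commute.sum_left _ _ _ fun _ _ => Commute.sum_left _ _ _ fun _ _ =>
      (Commute.one_left _).smul_left _
  | succ n ih =>
    obtain ⟨X, _, _, _, E, h1, h2⟩ := ih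
    obtain ⟨E', h3, h4, h5⟩ := exists_matrixHom_of_commute E (g n) (h2 n le_rfl)
    refine ⟨X × Fin k, inferInstance, inferInstance, inferInstance, E', ?_, ?_⟩
    · intro i hi x
      rcases Nat.lt_succ_iff_lt_or_eq.mp hi with hi | rfl
      · obtain ⟨z, hz⟩ := h1 i hi x
        rw [← hz]
        exact h3 z
      · exact h4 x
    · intro j hj z y
      exact (h5 _ (fun x => (h2 j (by omega) x y).symm)
        (fun x => (hg n j (by omega) x y).symm) z).symm

/-- Elements of the *-algebra generated by commuting copies of `M_k` lie in a matrix subalgebra. -/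
theorem exists_matrixHom_of_mem_adjoin {C : Type*} [Ring C] [StarRing C] [Algebra ℂ C]
    [StarModule ℂ C] {k : ℕ} [NeZero k] (g : ℕ → Matrix (Fin k) (Fin k) ℂ →⋆ₐ[ℂ] C)
    (hg : ∀ m n, m ≠ n → ∀ x y, Commute (g m x) (g n y)) {c : C}
    (hc : c ∈ StarAlgebra.adjoin ℂ (⋃ n, Set.range (g n))) :
    ∃ (X : Type) (_ : Fintype X) (_ : DecidableEq X) (_ : Nonempty X)
      (E : Matrix X X ℂ →⋆ₐ[ℂ] C), c ∈ E.range := by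
  -- Only finitely many copies occur in `c`. Quantifying over all *-subalgebras `R` allows `R` to be
  -- the range of the matrix embedding.
  have : ∃ n, ∀ m ≥ n, ∀ R : StarSubalgebra ℂ C, (∀ i < m, ∀ x, g i x ∈ R) → c ∈ R := by
    induction hc using StarAlgebra.adjoin_induction with
    | mem x h =>
      obtain ⟨i, y, rfl⟩ := Set.mem_iUnion.mp h
      exact ⟨i + 1, fun m hm R hR => hR i (by omega) y⟩
    | algebraMap r => exact ⟨0, fun m hm R hR => algebraMap_mem _ _⟩
    | add x y _ _ h h' =>
      obtain ⟨n, hn⟩ := h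
      obtain ⟨n', hn'⟩ := h'
      exact ⟨max n n', fun m hm R hR => add_mem (hn m (le_trans (le_max_left _ _) hm) R hR)
        (hn' m (le_trans (le_max_right _ _) hm) R hR)⟩
    | mul x y _ _ h h' =>
      obtain ⟨n, hn⟩ := h
      obtain ⟨n', hn'⟩ := h'
      exact ⟨max n n', fun m hm R hR => mul_mem (hn m (le_trans (le_max_left _ _) hm) R hR)
        (hn' m (le_trans (le_max_right _ _) hm) R hR)⟩
    | star x _ h =>
      obtain ⟨n, hn⟩ := h
      exact ⟨n, fun m hm R hR => star_mem (hn m hm R hR)⟩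
  obtain ⟨n, hn⟩ := this
  obtain ⟨X, h1, h2, h3, E, hE⟩ := exists_matrixHom_of_family g hg n
  exact ⟨X, h1, h2, h3, E, hn n le_rfl _ fun i hi x => hE i hi x⟩

open scoped Matrix.Norms.L2Operator in
/-- A *-homomorphism of a matrix algebra into a non-zero C*-algebra dominates every other one. -/
theorem norm_matrixHom_le {C D : Type*} [CStarAlgebra C] [CStarAlgebra D] [Nontrivial C]
    {X : Type*} [Fintype X] [DecidableEq X] [Nonempty X] (E : Matrix X X ℂ →⋆ₐ[ℂ] C)
    (E' : Matrix X X ℂ →⋆ₐ[ℂ] D) (m : Matrix X X ℂ) : ‖E' m‖ ≤ ‖E m‖ := by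
  -- Matrix algebras are simple, so `E` is isometric for the operator norm, while `E'` is at any
  -- rate contractive.
  have : Function.Injective E := RingHom.injective (E : Matrix X X ℂ →+* C)
  rw [NonUnitalStarAlgHom.norm_map E this]
  exact NonUnitalStarAlgHom.norm_apply_le E' m

end MatrixUnits

/-! ### Simplicity, the universal property, and infinite tensor powers of `A` -/

section Universal

variable {k : ℕ} [NeZero k] {A : Type*} [CStarAlgebra A] [Nontrivial A]

/-- A UHF algebra is simple: every unital *-homomorphism is isometric. -/
theorem InfTensorPower.norm_map_eq (T : UHF k A) {C : Type*} [CStarAlgebra C] [Nontrivial C] (f : A →⋆ₐ[ℂ] C)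
    (x : A) : ‖f x‖ = ‖x‖ := by
  refine (isClosed_eq (continuous_starAlgHom f).norm continuous_norm).closure_subset_iff.mpr ?_
    (T.mem_closure_adjoin x)
  intro y hy
  obtain ⟨X, _, _, _, E, m, rfl⟩ := exists_matrixHom_of_mem_adjoin T.factor T.commute hy
  -- On a matrix stage, `E` and `f ∘ E` both map into non-zero C*-algebras, so each dominates the
  -- other.
  exact le_antisymm (norm_matrixHom_le E (f.comp E) m) (norm_matrixHom_le (f.comp E) E m)

theorem InfTensorPower.injective_map (T : UHF k A) {C : Type*} [CStarAlgebra C] [Nontrivial C]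
    (f : A →⋆ₐ[ℂ] C) : Function.Injective f :=
  (AddMonoidHomClass.isometry_of_norm f (T.norm_map_eq f)).injective

theorem InfTensorPower.isClosed_range (T : UHF k A) {C : Type*} [CStarAlgebra C] [Nontrivial C]
    (f : A →⋆ₐ[ℂ] C) : IsClosed (Set.range f) :=
  (AddMonoidHomClass.isometry_of_norm f (T.norm_map_eq f)).isClosedEmbedding.isClosed_range

/-- The universal property of a UHF algebra. -/
theorem InfTensorPower.exists_hom (T : UHF k A) {C : Type*} [CStarAlgebra C]
    (g : ℕ → Matrix (Fin k) (Fin k) ℂ →⋆ₐ[ℂ] C)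
    (hg : ∀ m n, m ≠ n → ∀ x y, Commute (g m x) (g n y)) :
    ∃ Φ : A →⋆ₐ[ℂ] C, ∀ n x, Φ (T.factor n x) = g n x := by
  -- `Φ` is obtained from its graph, the *-algebra generated in `A × C` by the pairs of generators.
  -- There the second coordinate is dominated by the first, again by comparison on matrix stages.
  let G : ℕ → Matrix (Fin k) (Fin k) ℂ →⋆ₐ[ℂ] A × C := fun n => (T.factor n).prod (g n)
  have hG : ∀ m n, m ≠ n → ∀ x y, Commute (G m x) (G n y) := fun m n h x y =>
    Prod.ext (T.commute m n h x y) (hg m n h x y)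
  let D := StarAlgebra.adjoin ℂ (⋃ n, Set.range (G n))
  have hnorm : ∀ z ∈ D, ‖z.2‖ ≤ ‖z.1‖ := by
    intro z hz
    obtain ⟨X, _, _, _, E, m, rfl⟩ := exists_matrixHom_of_mem_adjoin G hG hz
    exact norm_matrixHom_le ((StarAlgHom.fst ℂ A C).comp E) ((StarAlgHom.snd ℂ A C).comp E) m
  let a : D →ₗ[ℂ] A := (LinearMap.fst ℂ A C).comp D.subtype.toAlgHom.toLinearMap
  let b : D →ₗ[ℂ] C := (LinearMap.snd ℂ A C).comp D.subtype.toAlgHom.toLinearMap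
  have hdense : DenseRange a := by
    intro x
    refine closure_mono ?_ (T.mem_closure_adjoin x)
    intro y hy
    have hle : StarAlgebra.adjoin ℂ (⋃ n, Set.range (T.factor n)) ≤
        D.map (StarAlgHom.fst ℂ A C) := by
      rw [StarAlgebra.adjoin_le_iff]
      intro y h
      obtain ⟨i, y, rfl⟩ := Set.mem_iUnion.mp h
      exact ⟨G i y, StarAlgebra.subset_adjoin ℂ _ (Set.mem_iUnion.mpr ⟨i, y, rfl⟩), rfl⟩
    obtain ⟨z, hz, hz'⟩ := hle hy
    exact ⟨⟨z, hz⟩, hz'⟩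
  let F := b.extendOfNorm a
  have hF : ∀ z : D, F (z : A × C).1 = (z : A × C).2 := fun z =>
    LinearMap.extendOfNorm_eq hdense ⟨1, fun z => by rw [one_mul]; exact hnorm z z.2⟩ z
  have hFg : ∀ n x, F (T.factor n x) = g n x := fun n x =>
    hF ⟨G n x, StarAlgebra.subset_adjoin ℂ _ (Set.mem_iUnion.mpr ⟨n, x, rfl⟩)⟩
  have hF1 : F 1 = 1 := hF ⟨1, one_mem _⟩
  refine ⟨{ toFun := F, map_one' := hF1, map_mul' := ?_, map_zero' := map_zero F,
            map_add' := map_add F, commutes' := ?_, map_star' := ?_ }, hFg⟩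
  · intro x y
    induction x, y using hdense.induction_on₂ with
    | hp => exact isClosed_eq (by fun_prop) (by fun_prop)
    | h x y => 
      have := hF (x * y)
      have h1 := hF x
      have h2 := hF y
      simp only [MulMemClass.coe_mul, Prod.fst_mul, Prod.snd_mul] at this
      rw [← h1, ← h2] at this
      exact this
  · intro r
    rw [Algebra.algebraMap_eq_smul_one, Algebra.algebraMap_eq_smul_one]
    exact (map_smul F r 1).trans (by rw [hF1])
  · intro x
    induction x using hdense.induction_on with
    | hp => exact isClosed_eq (by fun_prop) (by fun_prop)
    | ih x =>
      have := hF (star x)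
      have h1 := hF x
      simp only [StarMemClass.coe_star, Prod.fst_star, Prod.snd_star] at this
      rw [← h1] at this
      exact this

/-- `M_k ⊗ M_k ⊗ ⋯` from an iterated infinite tensor product. -/
def InfTensorPower.flatten (T : UHF k A) (S : InfTensorPower A A) : UHF k A where
  factor n := (S.factor n.unpair.1).comp (T.factor n.unpair.2)
  commute m n h x y := by
    by_cases h1 : m.unpair.1 = n.unpair.1
    · have h2 : m.unpair.2 ≠ n.unpair.2 := fun h2 => h (by
        rw [← Nat.pair_unpair m, ← Nat.pair_unpair n, h1, h2])
      simp only [StarAlgHom.comp_apply, h1]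
      exact (T.commute _ _ h2 x y).map (S.factor _)
    · exact S.commute _ _ h1 _ _
  dense := by
    rw [eq_top_iff]
    intro x _
    refine S.mem_of_isClosed (StarSubalgebra.isClosed_topologicalClosure _) (fun n y => ?_) x
    rw [← StarSubalgebra.mem_comap]
    refine T.mem_of_isClosed ?_ (fun m z => ?_) y
    · exact (StarSubalgebra.isClosed_topologicalClosure _).preimage (continuous_starAlgHom _)
    · refine StarSubalgebra.le_topologicalClosure _ (StarAlgebra.subset_adjoin ℂ _ ?_)
      exact Set.mem_iUnion.mpr ⟨Nat.pair n m, z, by simp⟩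

/-- The pairing bijection `ℕ × ℕ ≃ ℕ` splits the factors of `A` into infinitely many infinite rows,
each generating a copy of `A`. -/
theorem InfTensorPower.nonempty_self (T : UHF k A) : Nonempty (InfTensorPower A A) := by
  have h : ∀ n, ∃ Φ : A →⋆ₐ[ℂ] A, ∀ m x, Φ (T.factor m x) = T.factor (Nat.pair n m) x := fun n =>
    T.exists_hom (fun m => T.factor (Nat.pair n m)) fun m m' h x y =>
      T.commute _ _ (fun h' => h (Nat.pair_eq_pair.mp h').2) x y
  choose Φ hΦ using h
  refine ⟨⟨Φ, fun m n hmn x y => ?_, ?_⟩⟩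
  · refine T.commute_map (Φ n) (fun j b => Commute.symm ?_) y
    refine T.commute_map (Φ m) (fun i a => Commute.symm ?_) x
    rw [hΦ, hΦ]
    exact T.commute _ _ (fun h' => hmn (Nat.pair_eq_pair.mp h').1) _ _
  · rw [eq_top_iff]
    intro x _
    refine T.mem_of_isClosed (StarSubalgebra.isClosed_topologicalClosure _) (fun n y => ?_) x
    refine StarSubalgebra.le_topologicalClosure _ (StarAlgebra.subset_adjoin ℂ _ ?_)
    refine Set.mem_iUnion.mpr ⟨n.unpair.1, T.factor n.unpair.2 y, ?_⟩
    rw [hΦ, Nat.pair_unpair]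

/-- The infinite tensor power of an endomorphism. -/
theorem InfTensorPower.exists_tensorHom (T : UHF k A) (S : InfTensorPower A A) (γ : A →⋆ₐ[ℂ] A) :
    ∃ γS : A →⋆ₐ[ℂ] A, ∀ n x, γS (S.factor n x) = S.factor n (γ x) := by
  -- The universal property is available for matrix factors, so the map is constructed on the
  -- flattened presentation and only then recognised as `γ` on each copy of `A`.
  obtain ⟨Φ, hΦ⟩ := (T.flatten S).exists_hom
    (fun n => (S.factor n.unpair.1).comp (γ.comp (T.factor n.unpair.2))) (by
      intro m n h x y
      by_cases h1 : m.unpair.1 = n.unpair.1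
      · have h2 : m.unpair.2 ≠ n.unpair.2 := fun h2 => h (by
          rw [← Nat.pair_unpair m, ← Nat.pair_unpair n, h1, h2])
        simp only [StarAlgHom.comp_apply, h1]
        exact ((T.commute _ _ h2 x y).map γ).map (S.factor _)
      · exact S.commute _ _ h1 _ _)
  refine ⟨Φ, fun n x => ?_⟩
  have : Φ.comp (S.factor n) = (S.factor n).comp γ := T.starAlgHom_ext fun m y => by
    simpa [InfTensorPower.flatten] using hΦ (Nat.pair n m) y
  exact DFunLike.congr_fun this x

end Universal

/-- A three-epsilon argument, with a Lipschitz constant independent of the index. It allows limits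
to be checked on elementary tensors only. -/
theorem isClosed_setOf_tendsto_of_lipschitz {ι E F : Type*} [PseudoMetricSpace E]
    [PseudoMetricSpace F] {l : Filter ι} {T : ι → E → F} {L : E → F} {K : NNReal}
    (hT : ∀ i, LipschitzWith K (T i)) (hL : Continuous L) :
    IsClosed {x | Tendsto (fun i => T i x) l (𝓝 (L x))} := by
  refine isClosed_of_closure_subset fun x hx => ?_
  change Tendsto _ _ _
  rw [Metric.tendsto_nhds]
  intro ε hε
  have h1 : ∀ᶠ y in 𝓝 x, dist (L y) (L x) < ε / 3 :=
    hL.continuousAt.eventually (Metric.ball_mem_nhds _ (by positivity))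
  have h2 : ∀ᶠ y in 𝓝 x, K * dist y x < ε / 3 := by
    have : Tendsto (fun y => (K : ℝ) * dist y x) (𝓝 x) (𝓝 (K * dist x x)) :=
      (by fun_prop : Continuous fun y => (K : ℝ) * dist y x).tendsto x
    rw [dist_self, mul_zero] at this
    exact this.eventually_lt_const (by positivity)
  obtain ⟨y, hy3, hy1, hy2⟩ := ((mem_closure_iff_frequently.mp hx).and_eventually
    (h1.and h2)).exists
  filter_upwards [(Metric.tendsto_nhds.mp hy3) (ε / 3) (by positivity)] with i hi
  have h3 := (hT i).dist_le_mul x y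
  rw [dist_comm x y] at h3
  calc dist (T i x) (L x) ≤ dist (T i x) (T i y) + dist (T i y) (L y) + dist (L y) (L x) :=
        dist_triangle4 _ _ _ _
    _ < ε := by linarith

/-- Pointwise convergence of uniformly bounded operators may be checked on a dense set. -/
theorem tendsto_of_denseRange {ι J E F : Type*} [NormedAddCommGroup E] [NormedSpace ℂ E]
    [NormedAddCommGroup F] [NormedSpace ℂ F] {l : Filter ι} {T : ι → E →L[ℂ] F} {L : E →L[ℂ] F}
    {K : NNReal} (hT : ∀ i, ‖T i‖ ≤ K) {e : J → E} (he : DenseRange e)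
    (h : ∀ j, Tendsto (fun i => T i (e j)) l (𝓝 (L (e j)))) (x : E) :
    Tendsto (fun i => T i x) l (𝓝 (L x)) := by
  have := isClosed_setOf_tendsto_of_lipschitz (l := l) (T := fun i x => T i x) (L := L) (K := K)
    (fun i => (T i).lipschitz.weaken (by exact_mod_cast hT i)) L.continuous
  exact this.closure_subset_iff.mpr (by rintro _ ⟨j, rfl⟩; exact h j) (he x)

/-! ### The GNS representation -/

section GNSLemmas

variable {A : Type*} [CStarAlgebra A] [PartialOrder A] [StarOrderedRing A] (f : A →ₚ[ℂ] ℂ)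

theorem gns_apply_cyclicVector (x : A) :
    f.gnsStarAlgHom x (cyclicVector f) = ((f.toPreGNS x : f.PreGNS) : f.GNS) := by
  change f.gnsNonUnitalStarAlgHom x _ = _
  rw [cyclicVector, PositiveLinearMap.gnsNonUnitalStarAlgHom_apply_coe]
  simp

theorem denseRange_gns : DenseRange fun x => f.gnsStarAlgHom x (cyclicVector f) := by
  have : (fun x => f.gnsStarAlgHom x (cyclicVector f)) =
      (fun y : f.PreGNS => (y : f.GNS)) ∘ f.toPreGNS := by
    ext x; exact gns_apply_cyclicVector f x
  rw [this]
  exact UniformSpace.Completion.denseRange_coe.comp f.toPreGNS.surjective.denseRange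
    (UniformSpace.Completion.continuous_coe _)

theorem inner_gns_gns (x y : A) :
    inner ℂ (f.gnsStarAlgHom x (cyclicVector f)) (f.gnsStarAlgHom y (cyclicVector f)) =
      f (star x * y) := by
  rw [gns_apply_cyclicVector, gns_apply_cyclicVector, UniformSpace.Completion.inner_coe,
    PositiveLinearMap.preGNS_inner_def]
  simp

theorem gns_mul_apply (x y : A) (ζ : f.GNS) :
    f.gnsStarAlgHom (x * y) ζ = f.gnsStarAlgHom x (f.gnsStarAlgHom y ζ) := by
  rw [map_mul]; rfl

theorem gns_one_apply (ζ : f.GNS) : f.gnsStarAlgHom 1 ζ = ζ := by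
  rw [map_one]; rfl

theorem inner_cyclicVector_gns (x : A) :
    inner ℂ (cyclicVector f) (f.gnsStarAlgHom x (cyclicVector f)) = f x := by
  have := inner_gns_gns f 1 x
  rwa [gns_one_apply, star_one, one_mul] at this

theorem inner_gns_left (x : A) (ζ ζ' : f.GNS) :
    inner ℂ (f.gnsStarAlgHom x ζ) ζ' = inner ℂ ζ (f.gnsStarAlgHom (star x) ζ') := by
  rw [map_star, ContinuousLinearMap.star_eq_adjoint, ContinuousLinearMap.adjoint_inner_right]

theorem norm_gns_apply_le (x : A) (ζ : f.GNS) : ‖f.gnsStarAlgHom x ζ‖ ≤ ‖x‖ * ‖ζ‖ :=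
  ((f.gnsStarAlgHom x).le_opNorm ζ).trans
    (mul_le_mul_of_nonneg_right (NonUnitalStarAlgHom.norm_apply_le _ x) (norm_nonneg _))

variable {f}

theorem gns_ext {E : Type*} [NormedAddCommGroup E] [NormedSpace ℂ E] {R R' : f.GNS →L[ℂ] E}
    (h : ∀ x, R (f.gnsStarAlgHom x (cyclicVector f)) = R' (f.gnsStarAlgHom x (cyclicVector f))) :
    R = R' :=
  DFunLike.coe_injective ((denseRange_gns f).equalizer R.continuous R'.continuous (funext h))

theorem norm_cyclicVector (h : f 1 = 1) : ‖cyclicVector f‖ = 1 := by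
  have := inner_cyclicVector_gns f 1
  rw [gns_one_apply, h, inner_self_eq_norm_sq_to_K] at this
  have h2 : ‖cyclicVector f‖ ^ 2 = 1 := Complex.ofReal_injective (by push_cast; exact this)
  nlinarith [norm_nonneg (cyclicVector f)]

theorem norm_map_le (h : f 1 = 1) (x : A) : ‖f x‖ ≤ ‖x‖ := by
  rw [← inner_cyclicVector_gns]
  refine (norm_inner_le_norm _ _).trans ?_
  have := norm_gns_apply_le f x (cyclicVector f)
  rw [norm_cyclicVector h] at *
  linarith

theorem continuous_of_map_one (h : f 1 = 1) : Continuous f :=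
  AddMonoidHomClass.continuous_of_bound f 1 fun x => by simpa using norm_map_le h x

/-- A contraction on which the state takes the value `1` fixes the cyclic vector. -/
theorem gns_fix (h : f 1 = 1) {u : A} (hu : ‖u‖ ≤ 1) (hfu : f u = 1) :
    f.gnsStarAlgHom u (cyclicVector f) = cyclicVector f := by
  have h1 := norm_gns_apply_le f u (cyclicVector f)
  rw [norm_cyclicVector h, mul_one] at h1
  have h2 := inner_cyclicVector_gns f u
  rw [hfu] at h2
  -- The identity reads `‖Ω - uΩ‖² = 1 - 2 + ‖uΩ‖²`, which is at most `0` for a contraction `u`.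
  have h3 := norm_sub_sq (𝕜 := ℂ) (cyclicVector f) (f.gnsStarAlgHom u (cyclicVector f))
  rw [h2, norm_cyclicVector h] at h3
  simp only [RCLike.one_re] at h3
  have h4 : ‖cyclicVector f - f.gnsStarAlgHom u (cyclicVector f)‖ = 0 := by
    have h0 := norm_nonneg (f.gnsStarAlgHom u (cyclicVector f))
    have : ‖cyclicVector f - f.gnsStarAlgHom u (cyclicVector f)‖ ^ 2 ≤ 0 := by nlinarith
    exact pow_eq_zero_iff (two_ne_zero) |>.mp (le_antisymm this (sq_nonneg _))
  exact (sub_eq_zero.mp (norm_eq_zero.mp h4)).symm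

/-- Uniqueness of the GNS representation. -/
theorem exists_gns_equiv {H : Type*} [NormedAddCommGroup H] [InnerProductSpace ℂ H]
    [CompleteSpace H] (ρ : A →⋆ₐ[ℂ] (H →L[ℂ] H)) (ξ : H) (hf : ∀ x, f x = inner ℂ ξ (ρ x ξ))
    (hξ : DenseRange fun x => ρ x ξ) :
    ∃ V : f.GNS ≃ₗᵢ[ℂ] H, (∀ x, V (f.gnsStarAlgHom x (cyclicVector f)) = ρ x ξ) ∧
      ∀ x ζ, V (f.gnsStarAlgHom x ζ) = ρ x (V ζ) := by
  let e₁ : A →ₗ[ℂ] f.GNS :=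
    (ContinuousLinearMap.apply ℂ f.GNS (cyclicVector f)).toLinearMap ∘ₗ
      f.gnsStarAlgHom.toAlgHom.toLinearMap
  let e₂ : A →ₗ[ℂ] H := (ContinuousLinearMap.apply ℂ H ξ).toLinearMap ∘ₗ ρ.toAlgHom.toLinearMap
  have hn : ∀ x, ‖e₂ ((LinearEquiv.refl ℂ A) x)‖ = ‖e₁ x‖ := by
    intro x
    have h1 : inner ℂ (ρ x ξ) (ρ x ξ) = f (star x * x) := by
      rw [hf, map_mul, map_star, ContinuousLinearMap.star_eq_adjoint]
      exact (ContinuousLinearMap.adjoint_inner_right _ _ _).symm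
    have h2 := inner_gns_gns f x x
    rw [← h1, inner_self_eq_norm_sq_to_K, inner_self_eq_norm_sq_to_K] at h2
    have h3 : ‖f.gnsStarAlgHom x (cyclicVector f)‖ ^ 2 = ‖ρ x ξ‖ ^ 2 := by exact_mod_cast h2
    exact ((sq_eq_sq₀ (norm_nonneg _) (norm_nonneg _)).mp h3).symm
  let V := (LinearEquiv.refl ℂ A).extendOfIsometry e₁ e₂ (denseRange_gns f) hξ hn
  have hV : ∀ x, V (f.gnsStarAlgHom x (cyclicVector f)) = ρ x ξ := fun x =>
    LinearEquiv.extendOfIsometry_eq (LinearEquiv.refl ℂ A) e₁ e₂ (denseRange_gns f) hξ hn x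
  refine ⟨V, hV, fun x ζ => ?_⟩
  induction ζ using (denseRange_gns f).induction_on with
  | hp => exact isClosed_eq (by fun_prop) (by fun_prop)
  | ih y => rw [← gns_mul_apply, hV, hV, map_mul]; rfl

/-- The pair `(π_f ∘ γ, ξ)` is another cyclic representation inducing `f` on the same space.
Uniqueness of the GNS representation supplies a unitary even when `γ` is not surjective. -/
theorem exists_implements (γ : A →⋆ₐ[ℂ] A) (ξ : f.GNS)
    (hf : ∀ x, f x = inner ℂ ξ (f.gnsStarAlgHom (γ x) ξ))
    (hξ : DenseRange fun x => f.gnsStarAlgHom (γ x) ξ) :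
    ∃ U : unitary (f.GNS →L[ℂ] f.GNS), Implements f U γ ∧
      ∀ x, (U : f.GNS →L[ℂ] f.GNS) (f.gnsStarAlgHom x (cyclicVector f)) =
        f.gnsStarAlgHom (γ x) ξ := by
  obtain ⟨V, hV, hV'⟩ := exists_gns_equiv (f.gnsStarAlgHom.comp γ) ξ hf hξ
  let U := Unitary.linearIsometryEquiv.symm V
  have hU : ∀ ζ, (U : f.GNS →L[ℂ] f.GNS) ζ = V ζ := fun ζ => rfl
  refine ⟨U, fun x => ?_, fun x => ?_⟩
  · have : (U : f.GNS →L[ℂ] f.GNS) * f.gnsStarAlgHom x =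
        f.gnsStarAlgHom (γ x) * (U : f.GNS →L[ℂ] f.GNS) := by
      ext ζ
      exact hV' x ζ
    rw [this, mul_assoc, Unitary.mul_star_self_of_mem U.2, mul_one]
  · exact hV x

end GNSLemmas

/-! ### Full projections and excision of states -/

section Excision

variable {A : Type*} [CStarAlgebra A]

theorem IsStarProjection.norm_eq_one_of_ne_zero {p : A} (h : IsStarProjection p) (h0 : p ≠ 0) :
    ‖p‖ = 1 := by
  have h1 := CStarRing.norm_star_mul_self (x := p)
  rw [h.isSelfAdjoint.star_eq, h.isIdempotentElem.eq] at h1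
  have h2 : ‖p‖ ≠ 0 := norm_ne_zero_iff.mpr h0
  field_simp at h1
  exact h1.symm

/-- `z` generates the whole algebra as a two-sided ideal. -/
def IsFull {B : Type*} [Ring B] [Algebra ℂ B] (z : B) : Prop :=
  (1 : B) ∈ Submodule.span ℂ {y | ∃ a b, y = a * z * b}

theorem IsFull.ne_zero {B : Type*} [Ring B] [Algebra ℂ B] [Nontrivial B] {z : B} (h : IsFull z) :
    z ≠ 0 := by
  rintro rfl
  have : Submodule.span ℂ {y : B | ∃ a b, y = a * 0 * b} ≤ ⊥ := by
    rw [Submodule.span_le]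
    rintro _ ⟨a, b, rfl⟩
    simp
  exact one_ne_zero ((Submodule.mem_bot ℂ).mp (this h))

theorem IsFull.of_mul {B : Type*} [Ring B] [Algebra ℂ B] {z z' : B} (h : IsFull z) {a b : B}
    (hz : z = a * z' * b) : IsFull z' := by
  refine Submodule.span_mono ?_ h
  rintro _ ⟨c, d, rfl⟩
  exact ⟨c * a, b * d, by rw [hz]; simp only [mul_assoc]⟩

/-- In the last factor `1` is a combination of elements `a p b`, and these commute with the
preceding tensor `Q`; hence `Q` lies in the ideal generated by `Q ⊗ p`. Unlike non-vanishing,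
fullness thus passes to tensor products by pure algebra. -/
theorem IsFull.tprod {B : Type*} [Ring B] [StarRing B] [Algebra ℂ B] (S : InfTensorPower B A)
    {p : B} (h : IsFull p) (n : ℕ) : IsFull (S.tprod n fun _ => p) := by
  induction n with
  | zero => exact Submodule.subset_span ⟨1, 1, by simp⟩
  | succ n ih =>
    rw [S.tprod_succ]
    set Q := S.tprod n fun _ => p
    set J := Submodule.span ℂ {y : A | ∃ a b, y = a * (Q * S.factor n p) * b}
    have hJ : ∀ a b, ∀ y ∈ J, a * y * b ∈ J := by
      intro a b y hy
      induction hy using Submodule.span_induction with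
      | mem y h =>
        obtain ⟨c, d, rfl⟩ := h
        exact Submodule.subset_span ⟨a * c, d * b, by simp only [mul_assoc]⟩
      | zero => simp
      | add x y _ _ h h' => rw [mul_add, add_mul]; exact add_mem h h'
      | smul c x _ h => rw [mul_smul_comm, smul_mul_assoc]; exact Submodule.smul_mem _ _ h
    have hQ : Q ∈ J := by
      have : Submodule.span ℂ {y | ∃ a b, y = a * p * b} ≤
          J.comap (LinearMap.mulLeft ℂ Q ∘ₗ (S.factor n).toAlgHom.toLinearMap) := by
        rw [Submodule.span_le]
        rintro _ ⟨a, b, rfl⟩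
        refine Submodule.subset_span ⟨S.factor n a, S.factor n b, ?_⟩
        change Q * S.factor n (a * p * b) = _
        rw [map_mul, map_mul]
        simp only [← mul_assoc]
        rw [(S.tprod_commute_factor le_rfl _ a).eq]
      have h1 := this h
      change Q * S.factor n 1 ∈ J at h1
      simpa using h1
    have : Submodule.span ℂ {y | ∃ a b, y = a * Q * b} ≤ J := by
      rw [Submodule.span_le]
      rintro _ ⟨a, b, rfl⟩
      exact hJ a b Q hQ
    exact this ih

/-- A decreasing sequence of full projections. -/
structure IsProjSeq {B : Type*} [Ring B] [StarRing B] [Algebra ℂ B] (p : ℕ → B) : Prop where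
  proj : ∀ n, IsStarProjection (p n)
  anti : ∀ m n, m ≤ n → p n * p m = p n
  full : ∀ n, IsFull (p n)

/-- The number of factors and the projection in each factor grow together, so a single sequence
serves to compress every elementary tensor. -/
theorem IsProjSeq.tprod {B : Type*} [Ring B] [StarRing B] [Algebra ℂ B] (S : InfTensorPower B A)
    {p : ℕ → B} (h : IsProjSeq p) : IsProjSeq fun n => S.tprod n fun _ => p n where
  proj n := by
    constructor
    · rw [IsIdempotentElem, S.tprod_mul]
      exact S.tprod_congr fun i _ => (h.proj n).isIdempotentElem
    · rw [isSelfAdjoint_iff, S.star_tprod]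
      exact S.tprod_congr fun i _ => (h.proj n).isSelfAdjoint
  anti m n hmn := by
    rw [← S.tprod_extend hmn, S.tprod_mul]
    refine S.tprod_congr fun i _ => ?_
    simp only [Pi.mul_apply]
    split_ifs
    · exact h.anti m n hmn
    · rw [mul_one]
  full n := (h.full n).tprod S n

variable [PartialOrder A] [StarOrderedRing A]

/-- The state `f` is excised by the projections `p n`. -/
structure Excised (f : A →ₚ[ℂ] ℂ) (p : ℕ → A) : Prop where
  map_one : f 1 = 1
  proj : ∀ n, IsStarProjection (p n)
  map : ∀ n, f (p n) = 1
  tendsto : ∀ x, Tendsto (fun n => p n * x * p n - f x • p n) atTop (𝓝 0)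

/-- A state as a positive linear map. -/
theorem exists_positive_of_mem_states {g : A →ₗ[ℂ] ℂ} (hg : g ∈ states A) :
    ∃ f : A →ₚ[ℂ] ℂ, ∀ x, f x = g x :=
  ⟨PositiveLinearMap.mk₀ g fun x hx => by
    obtain ⟨y, rfl⟩ := CStarAlgebra.nonneg_iff_eq_star_mul_self.mp hx
    exact hg.2 y, fun _ => rfl⟩

theorem mem_states {f : A →ₚ[ℂ] ℂ} (h : f 1 = 1) : f.toLinearMap ∈ states A :=
  ⟨h, fun x => f.map_nonneg (star_mul_self_nonneg x)⟩

namespace Excised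

variable {f : A →ₚ[ℂ] ℂ} {p : ℕ → A}

theorem gns_apply (h : Excised f p) (n : ℕ) :
    f.gnsStarAlgHom (p n) (cyclicVector f) = cyclicVector f :=
  gns_fix h.map_one (IsStarProjection.norm_le _ (h.proj n)) (h.map n)

/-- The projections fix the cyclic vector of `g`, so `g x = g (p n * x * p n)`, and this tends to `f
x` by excision. -/
theorem eq_of_map_eq_one (h : Excised f p) {g : A →ₚ[ℂ] ℂ} (hg : g 1 = 1)
    (hgp : ∀ n, g (p n) = 1) (x : A) : g x = f x := by
  have h1 : ∀ n, g x - f x = g (p n * x * p n - f x • p n) := by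
    intro n
    have h2 := gns_fix hg (IsStarProjection.norm_le _ (h.proj n)) (hgp n)
    rw [map_sub, map_smul, hgp, smul_eq_mul, mul_one]
    congr 1
    rw [← inner_cyclicVector_gns g x, ← inner_cyclicVector_gns g (p n * x * p n), gns_mul_apply,
      gns_mul_apply, h2, ← (h.proj n).isSelfAdjoint.star_eq, ← inner_gns_left, h2]
  have h2 : Tendsto (fun _ : ℕ => g x - f x) atTop (𝓝 (g 0)) := by
    refine Tendsto.congr (fun n => (h1 n).symm) ?_
    exact ((continuous_of_map_one hg).tendsto 0).comp (h.tendsto x)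
  rw [map_zero] at h2
  exact sub_eq_zero.mp (tendsto_nhds_unique tendsto_const_nhds h2)

/-- An excised state is pure. -/
theorem isPureState (h : Excised f p) : IsPureState f.toLinearMap := by
  refine mem_extremePoints.mpr ⟨mem_states h.map_one, ?_⟩
  suffices key : ∀ g₁ ∈ states A, ∀ g₂ ∈ states A, f.toLinearMap ∈ openSegment ℝ g₁ g₂ →
      g₁ = f.toLinearMap by
    intro g₁ h₁ g₂ h₂ hs
    exact ⟨key g₁ h₁ g₂ h₂ hs, key g₂ h₂ g₁ h₁ (by rwa [openSegment_symm])⟩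
  rintro g₁ h₁ g₂ h₂ ⟨a, b, ha, hb, hab, hs⟩
  obtain ⟨f₁, hf₁⟩ := exists_positive_of_mem_states h₁
  obtain ⟨f₂, hf₂⟩ := exists_positive_of_mem_states h₂
  have h11 : f₁ 1 = 1 := by rw [hf₁, h₁.1]
  have h21 : f₂ 1 = 1 := by rw [hf₂, h₂.1]
  have hbound : ∀ (g : A →ₚ[ℂ] ℂ), g 1 = 1 → ∀ n, (g (p n)).re ≤ 1 ∧ (g (p n)).im = 0 := by
    intro g hg n
    refine ⟨?_, ?_⟩
    · exact (Complex.re_le_norm _).trans ((norm_map_le hg _).trans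
        (IsStarProjection.norm_le _ (h.proj n)))
    · have h0 : 0 ≤ g (p n) := by
        refine g.map_nonneg ?_
        rw [← (h.proj n).isIdempotentElem.eq]
        nth_rw 1 [← (h.proj n).isSelfAdjoint.star_eq]
        exact star_mul_self_nonneg _
      exact ((Complex.le_def.mp h0).2).symm
  -- A proper convex combination of two numbers at most `1` equals `1` only if both do.
  have : ∀ n, f₁ (p n) = 1 := by
    intro n
    have h3 := congrArg Complex.re (LinearMap.congr_fun hs (p n))
    have h4 : f.toLinearMap (p n) = 1 := h.map n
    rw [h4] at h3
    simp only [LinearMap.add_apply, LinearMap.smul_apply, Complex.add_re, Complex.real_smul,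
      Complex.re_ofReal_mul, ← hf₁, ← hf₂, Complex.one_re] at h3
    have h5 := hbound f₁ h11 n
    have h6 := hbound f₂ h21 n
    refine Complex.ext ?_ h5.2
    rw [Complex.one_re]
    nlinarith
  ext x
  rw [← hf₁]
  exact h.eq_of_map_eq_one h11 this x

/-- In the GNS representation the excising projections converge to the projection onto the cyclic
vector. -/
theorem tendsto_gns (h : Excised f p) (ζ : f.GNS) :
    Tendsto (fun n => f.gnsStarAlgHom (p n) ζ) atTop
      (𝓝 (inner ℂ (cyclicVector f) ζ • cyclicVector f)) := by
  let L : f.GNS →L[ℂ] f.GNS :=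
    (innerSL ℂ (cyclicVector f)).smulRight (cyclicVector f)
  refine tendsto_of_denseRange (L := L) (K := 1) (fun n => ?_) (denseRange_gns f) (fun x => ?_) ζ
  · exact (NonUnitalStarAlgHom.norm_apply_le _ _).trans (IsStarProjection.norm_le _ (h.proj n))
  · change Tendsto _ _ (𝓝 (inner ℂ (cyclicVector f) _ • cyclicVector f))
    rw [inner_cyclicVector_gns, ← tendsto_sub_nhds_zero_iff]
    have h1 : ∀ n, f.gnsStarAlgHom (p n) (f.gnsStarAlgHom x (cyclicVector f)) -
        f x • cyclicVector f =
        f.gnsStarAlgHom (p n * x * p n - f x • p n) (cyclicVector f) := by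
      intro n
      rw [map_sub, map_smul, sub_apply, smul_apply,
        gns_mul_apply, gns_mul_apply, h.gns_apply]
    simp_rw [h1]
    refine squeeze_zero_norm (fun n => norm_gns_apply_le f _ _) ?_
    have := (h.tendsto x).norm.mul_const ‖cyclicVector f‖
    simpa using this

/-- An operator commuting with the projections `X p_n X*` maps `X Ω` to a multiple of itself. -/
theorem exists_eq_smul (h : Excised f p) (X : A)
    (hX : f.gnsStarAlgHom (star X * X) (cyclicVector f) = cyclicVector f)
    (T : f.GNS →L[ℂ] f.GNS)
    (hT : ∀ᶠ n in atTop, Commute T (f.gnsStarAlgHom (X * p n * star X))) :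
    ∃ c : ℂ, T (f.gnsStarAlgHom X (cyclicVector f)) =
      c • f.gnsStarAlgHom X (cyclicVector f) := by
  set ζ := f.gnsStarAlgHom X (cyclicVector f) with hζ
  -- The elements `X p_n X*` fix `XΩ` and tend strongly to the rank-one operator onto it. Since `T`
  -- commutes with them, `T XΩ` is its own image under this limit, with eigenvalue `⟨XΩ, T XΩ⟩`.
  refine ⟨inner ℂ (cyclicVector f) (f.gnsStarAlgHom (star X) (T ζ)), ?_⟩
  have h1 : ∀ n, f.gnsStarAlgHom (X * p n * star X) ζ = ζ := by
    intro n
    rw [hζ, gns_mul_apply, gns_mul_apply, ← gns_mul_apply f (star X), hX, h.gns_apply]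
  have h2 := (f.gnsStarAlgHom X).continuous.tendsto _ |>.comp
    (h.tendsto_gns (f.gnsStarAlgHom (star X) (T ζ)))
  rw [map_smul, ← hζ] at h2
  refine tendsto_nhds_unique (tendsto_const_nhds.congr' ?_) h2
  filter_upwards [hT] with n hn
  have h3 := congrArg (fun R : f.GNS →L[ℂ] f.GNS => R ζ) hn.eq
  change T (f.gnsStarAlgHom (X * p n * star X) ζ) = f.gnsStarAlgHom (X * p n * star X) (T ζ) at h3
  rw [h1, gns_mul_apply, gns_mul_apply] at h3
  exact h3

/-- The GNS representation of an excised state is irreducible. -/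
theorem eq_smul_one (h : Excised f p) (T : f.GNS →L[ℂ] f.GNS)
    (hT : ∀ x, Commute T (f.gnsStarAlgHom x)) : ∃ c : ℂ, T = c • 1 := by
  obtain ⟨c, hc⟩ := h.exists_eq_smul 1 (by rw [star_one, one_mul, gns_one_apply]) T
    (Eventually.of_forall fun n => hT _)
  rw [gns_one_apply] at hc
  refine ⟨c, ?_⟩
  refine gns_ext fun x => ?_
  have h3 := congrArg (fun R : f.GNS →L[ℂ] f.GNS => R (cyclicVector f)) (hT x).eq
  change T (f.gnsStarAlgHom x _) = f.gnsStarAlgHom x (T _) at h3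
  rw [h3, hc, map_smul]
  rfl

end Excised

end Excision

/-! ### Existence and purity of product states -/

section ProductStates

variable {A : Type*} [CStarAlgebra A]

/-- Compressions by a decreasing sequence of full projections which are asymptotically scalar on a
total set define a bounded functional. -/
theorem exists_limit_functional [Nontrivial A] {Q : ℕ → A} (hQ : IsProjSeq Q)
    (h : ∀ x : A, x ∈ closure (Submodule.span ℂ {y | ∃ c : ℂ,
      Tendsto (fun n => Q n * y * Q n - c • Q n) atTop (𝓝 0)} : Set A)) :
    ∃ F : A →L[ℂ] ℂ, ∀ x, Tendsto (fun n => Q n * x * Q n - F x • Q n) atTop (𝓝 0) := by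
  have hnorm : ∀ n, ‖Q n‖ = 1 := fun n =>
    IsStarProjection.norm_eq_one_of_ne_zero (hQ.proj n) (hQ.full n).ne_zero
  -- `Γ` is the graph of the limit functional. It is closed because the compressions are
  -- equi-Lipschitz, and `|c| ≤ ‖y‖` holds on it because the `Q n` have norm one.
  let Γ : Submodule ℂ (A × ℂ) :=
    { carrier := {z | Tendsto (fun n => Q n * z.1 * Q n - z.2 • Q n) atTop (𝓝 0)}
      add_mem' := by
        intro z z' h h'
        have := Tendsto.add h h'
        rw [add_zero] at this
        refine this.congr fun n => ?_
        simp only [Prod.fst_add, Prod.snd_add, mul_add, add_mul, add_smul]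
        abel
      zero_mem' := by simp
      smul_mem' := by
        intro c z h
        have := Tendsto.const_smul h c
        rw [smul_zero] at this
        refine this.congr fun n => ?_
        simp [smul_sub, smul_smul] }
  have hΓ : IsClosed (Γ : Set (A × ℂ)) := by
    refine isClosed_setOf_tendsto_of_lipschitz (T := fun n (z : A × ℂ) =>
      Q n * z.1 * Q n - z.2 • Q n) (L := fun _ => 0) (K := 2) (fun n => ?_) continuous_const
    refine LipschitzWith.of_dist_le_mul fun z z' => ?_
    rw [dist_eq_norm, dist_eq_norm]
    have h1 : Q n * z.1 * Q n - z.2 • Q n - (Q n * z'.1 * Q n - z'.2 • Q n) =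
        Q n * (z - z').1 * Q n - (z - z').2 • Q n := by
      simp only [Prod.fst_sub, Prod.snd_sub, mul_sub, sub_mul, sub_smul]
      abel
    rw [h1]
    have h2 : ‖Q n * (z - z').1 * Q n‖ ≤ ‖z - z'‖ := by
      have h3 := norm_mul_le (Q n * (z - z').1) (Q n)
      have h4 := norm_mul_le (Q n) (z - z').1
      rw [hnorm] at h3 h4
      have h5 := norm_fst_le (z - z')
      linarith
    have h3 : ‖(z - z').2 • Q n‖ ≤ ‖z - z'‖ := by
      rw [norm_smul, hnorm, mul_one]
      exact norm_snd_le _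
    have := norm_sub_le (Q n * (z - z').1 * Q n) ((z - z').2 • Q n)
    push_cast
    linarith
  have hbound : ∀ z ∈ Γ, ‖z.2‖ ≤ ‖z.1‖ := by
    intro z hz
    refine le_of_forall_pos_le_add fun ε hε => ?_
    have hz' : Tendsto (fun n => Q n * z.1 * Q n - z.2 • Q n) atTop (𝓝 0) := hz
    obtain ⟨n, hn⟩ := ((Metric.tendsto_nhds.mp hz') ε hε).exists
    rw [dist_zero_right] at hn
    have h1 : ‖z.2 • Q n‖ = ‖z.2‖ := by rw [norm_smul, hnorm, mul_one]
    have h2 : ‖Q n * z.1 * Q n‖ ≤ ‖z.1‖ := by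
      have h3 := norm_mul_le (Q n * z.1) (Q n)
      have h4 := norm_mul_le (Q n) z.1
      rw [hnorm] at h3 h4
      linarith
    have h3 := norm_sub_norm_le (z.2 • Q n) (Q n * z.1 * Q n)
    rw [norm_sub_rev] at h3
    linarith
  let e : Γ →ₗ[ℂ] A := LinearMap.fst ℂ A ℂ ∘ₗ Γ.subtype
  let s : Γ →ₗ[ℂ] ℂ := LinearMap.snd ℂ A ℂ ∘ₗ Γ.subtype
  have hdense : DenseRange e := by
    intro x
    refine closure_mono ?_ (h x)
    have : Submodule.span ℂ {y | ∃ c : ℂ,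
      Tendsto (fun n => Q n * y * Q n - c • Q n) atTop (𝓝 0)} ≤ LinearMap.range e := by
      rw [Submodule.span_le]
      rintro y ⟨c, hc⟩
      exact ⟨⟨(y, c), hc⟩, rfl⟩
    exact this
  let F := s.extendOfNorm e
  have hF : ∀ z : Γ, F (e z) = s z := fun z =>
    LinearMap.extendOfNorm_eq hdense ⟨1, fun z => by rw [one_mul]; exact hbound z z.2⟩ z
  refine ⟨F, fun x => ?_⟩
  have hcl : IsClosed {x | (x, F x) ∈ Γ} := hΓ.preimage (by fun_prop)
  refine hcl.closure_subset_iff.mpr ?_ (hdense x)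
  rintro _ ⟨z, rfl⟩
  change (e z, F (e z)) ∈ Γ
  rw [hF]
  exact z.2

variable {B : Type*} [Ring B] [StarRing B] [Algebra ℂ B]

/-- The last factor is peeled off. For `n > m`, `Q n` absorbs `p n` in position `m`, so `x m` may be
replaced there by `p n * x m * p n`, which is `f₀ (x m) • p n` up to a null sequence. -/
theorem InfTensorPower.tendsto_compress_tprod (S : InfTensorPower B A) {p : ℕ → B}
    (hp : IsProjSeq p) {f₀ : B → ℂ}
    (h : ∀ i x, Tendsto (fun n => S.factor i (p n * x * p n - f₀ x • p n)) atTop (𝓝 0))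
    (m : ℕ) (x : ℕ → B) :
    Tendsto (fun n => S.tprod n (fun _ => p n) * S.tprod m x * S.tprod n (fun _ => p n) -
      (∏ i ∈ Finset.range m, f₀ (x i)) • S.tprod n (fun _ => p n)) atTop (𝓝 0) := by
  set Q : ℕ → A := fun n => S.tprod n fun _ => p n
  have hQ : IsProjSeq Q := hp.tprod S
  have hQ1 : ∀ n, ‖Q n‖ ≤ 1 := fun n => IsStarProjection.norm_le _ (hQ.proj n)
  have habs : ∀ m n, m < n → Q n * S.factor m (p n) = Q n := by
    intro m n hmn
    rw [← S.tprod_mulSingle hmn, S.tprod_mul]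
    refine S.tprod_congr fun i _ => ?_
    by_cases hi : i = m
    · subst hi; simpa using (hp.proj n).isIdempotentElem.eq
    · simp [Pi.mulSingle_eq_of_ne hi]
  have habs' : ∀ m n, m < n → S.factor m (p n) * Q n = Q n := by
    intro m n hmn
    have := congrArg star (habs m n hmn)
    rwa [star_mul, ← map_star, (hp.proj n).isSelfAdjoint.star_eq,
      (hQ.proj n).isSelfAdjoint.star_eq] at this
  induction m with
  | zero =>
    refine tendsto_const_nhds.congr fun n => ?_
    change 0 = Q n * S.tprod 0 x * Q n - _ • Q n
    simp [(hQ.proj n).isIdempotentElem.eq]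
  | succ m ih =>
    have h1 : Tendsto (fun n => Q n * S.tprod m x *
        S.factor m (p n * x m * p n - f₀ (x m) • p n) * Q n) atTop (𝓝 0) := by
      refine squeeze_zero_norm (a := fun n => ‖S.tprod m x‖ *
        ‖S.factor m (p n * x m * p n - f₀ (x m) • p n)‖) (fun n => ?_) ?_
      · set z := S.factor m (p n * x m * p n - f₀ (x m) • p n)
        calc _ ≤ ‖Q n * S.tprod m x * z‖ * ‖Q n‖ := norm_mul_le _ _
          _ ≤ ‖Q n * S.tprod m x * z‖ * 1 := by gcongr; exact hQ1 n
          _ ≤ ‖Q n * S.tprod m x‖ * ‖z‖ := by rw [mul_one]; exact norm_mul_le _ _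
          _ ≤ (‖Q n‖ * ‖S.tprod m x‖) * ‖z‖ := by gcongr; exact norm_mul_le _ _
          _ ≤ (1 * ‖S.tprod m x‖) * ‖z‖ := by gcongr; exact hQ1 n
          _ = _ := by rw [one_mul]
      · simpa using (h m (x m)).norm.const_mul ‖S.tprod m x‖
    have h2 := h1.add (ih.const_smul (f₀ (x m)))
    rw [smul_zero, add_zero] at h2
    refine h2.congr' ?_
    filter_upwards [eventually_gt_atTop m] with n hn
    have e1 : Q n * S.tprod m x * S.factor m (p n) = Q n * S.tprod m x := by
      rw [mul_assoc, (S.tprod_commute_factor le_rfl _ _).eq, ← mul_assoc, habs m n hn]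
    have e2 : Q n * S.tprod m x * S.factor m (p n * x m * p n) * Q n =
        Q n * S.tprod (m + 1) x * Q n := by
      rw [map_mul, map_mul, S.tprod_succ]
      simp only [← mul_assoc]
      rw [e1, mul_assoc _ (S.factor m (p n)), habs' m n hn]
    rw [map_sub, map_smul, mul_sub, sub_mul, e2, mul_smul_comm, smul_mul_assoc, e1,
      Finset.prod_range_succ, smul_sub, smul_smul, mul_comm (f₀ (x m))]
    abel

theorem InfTensorPower.IsProduct.map_tprod {S : InfTensorPower B A} {f : A → ℂ} {f₀ : B → ℂ}
    (h : S.IsProduct f f₀) (n : ℕ) (x : ℕ → B) :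
    f (S.tprod n x) = ∏ i ∈ Finset.range n, f₀ (x i) := h n x

theorem InfTensorPower.IsProduct.map_factor {S : InfTensorPower B A} {f : A → ℂ} {f₀ : B → ℂ}
    (h : S.IsProduct f f₀) (h1 : f₀ 1 = 1) (n : ℕ) (x : B) : f (S.factor n x) = f₀ x := by
  rw [← S.tprod_mulSingle (Nat.lt_succ_self n), h.map_tprod, Finset.prod_range_succ,
    Finset.prod_eq_one, one_mul, Pi.mulSingle_eq_same]
  intro i hi
  rw [Pi.mulSingle_eq_of_ne (Finset.mem_range.mp hi).ne, h1]

variable [PartialOrder A] [StarOrderedRing A]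

/-- The existence of product states, for functionals excised by projections. -/
theorem InfTensorPower.exists_product_state [Nontrivial A] (S : InfTensorPower B A) {p : ℕ → B}
    (hp : IsProjSeq p) {f₀ : B → ℂ}
    (h : ∀ i x, Tendsto (fun n => S.factor i (p n * x * p n - f₀ x • p n)) atTop (𝓝 0)) :
    ∃ f : A →ₚ[ℂ] ℂ, S.IsProduct f f₀ ∧ Excised f (fun n => S.tprod n fun _ => p n) := by
  set Q : ℕ → A := fun n => S.tprod n fun _ => p n with hQdef
  have hQ : IsProjSeq Q := hp.tprod S
  have hnorm : ∀ n, ‖Q n‖ = 1 := fun n =>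
    IsStarProjection.norm_eq_one_of_ne_zero (hQ.proj n) (hQ.full n).ne_zero
  have hlim := S.tendsto_compress_tprod hp h
  obtain ⟨F, hF⟩ := exists_limit_functional hQ (fun x => by
    refine S.tprod_induction (P := fun x => x ∈ closure (Submodule.span ℂ {y | ∃ c : ℂ,
      Tendsto (fun n => Q n * y * Q n - c • Q n) atTop (𝓝 0)} : Set A))
      ?_ ?_ ?_ ?_ x
    · rw [Set.ofPred_mem_eq]; exact isClosed_closure
    · intro m y
      exact subset_closure (Submodule.subset_span ⟨_, hlim m y⟩)
    · intro x y hx hy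
      exact (Submodule.topologicalClosure _).add_mem hx hy
    · intro c x hx
      exact (Submodule.topologicalClosure _).smul_mem c hx)
  have huniq : ∀ c : ℂ, Tendsto (fun n => c • Q n) atTop (𝓝 0) → c = 0 := by
    intro c hc
    have := hc.norm
    simp only [norm_smul, hnorm, mul_one, norm_zero] at this
    exact norm_eq_zero.mp (tendsto_nhds_unique tendsto_const_nhds this)
  have hval : ∀ x c, Tendsto (fun n => Q n * x * Q n - c • Q n) atTop (𝓝 0) → F x = c := by
    intro x c hc
    have := hc.sub (hF x)
    rw [sub_zero] at this
    refine sub_eq_zero.mp (huniq _ (this.congr fun n => ?_))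
    rw [sub_smul]
    abel
  have hpos : ∀ x, 0 ≤ x → 0 ≤ F x := by
    intro x hx
    have hreal : star (F x) = F x := by
      have h1 := (hF x).star
      rw [star_zero] at h1
      refine (hval x _ (h1.congr fun n => ?_)).symm
      rw [star_sub, star_smul, star_mul, star_mul, (hQ.proj n).isSelfAdjoint.star_eq,
        (IsSelfAdjoint.of_nonneg hx).star_eq, mul_assoc]
    obtain ⟨r, hr⟩ := Complex.conj_eq_iff_real.mp hreal
    rw [hr]
    rw [Complex.zero_le_real]
    by_contra! hneg
    -- If `F x = r < 0`, the difference is `Q n * x * Q n + (-r) • Q n ≥ (-r) • Q n`, whose norm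
    -- stays away from `0`.
    have h1 : ∀ n, -r ≤ ‖Q n * x * Q n - F x • Q n‖ := by
      intro n
      have hQ0 : 0 ≤ Q n := by
        rw [← (hQ.proj n).isIdempotentElem.eq]
        nth_rw 1 [← (hQ.proj n).isSelfAdjoint.star_eq]
        exact star_mul_self_nonneg _
      have h2 : (0 : A) ≤ (-r) • Q n := smul_nonneg (by linarith) hQ0
      have h3 : 0 ≤ Q n * x * Q n := by
        have := star_left_conjugate_nonneg hx (Q n)
        rwa [(hQ.proj n).isSelfAdjoint.star_eq] at this
      have h4 : Q n * x * Q n - F x • Q n = Q n * x * Q n + (-r) • Q n := by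
        rw [hr, neg_smul, Complex.coe_smul, sub_eq_add_neg]
      rw [h4]
      have h5 : ‖(-r) • Q n‖ ≤ ‖Q n * x * Q n + (-r) • Q n‖ :=
        CStarAlgebra.norm_le_norm_of_nonneg_of_le h2 (le_add_of_nonneg_left h3)
      rw [norm_smul, hnorm, mul_one, Real.norm_of_nonneg (by linarith)] at h5
      exact h5
    have h2 := ge_of_tendsto' (hF x).norm h1
    rw [norm_zero] at h2
    linarith
  let f : A →ₚ[ℂ] ℂ := PositiveLinearMap.mk₀ F.toLinearMap hpos
  have hfF : ∀ x, f x = F x := fun _ => rfl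
  have hprod : S.IsProduct f f₀ := fun n x => hval _ _ (hlim n x)
  refine ⟨f, hprod, ?_, hQ.proj, ?_, hF⟩
  · simpa using hprod 0 1
  · intro m
    refine hval _ _ (tendsto_const_nhds.congr' ?_)
    filter_upwards [eventually_ge_atTop m] with n hn
    rw [hQ.anti m n hn, (hQ.proj n).isIdempotentElem.eq, one_smul, sub_self]

/-- Product states of excised states. -/
theorem InfTensorPower.exists_product_of_excised [Nontrivial A] (S : InfTensorPower A A)
    {f : A →ₚ[ℂ] ℂ} {p : ℕ → A} (hp : IsProjSeq p) (hf : Excised f p) :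
    ∃ g : A →ₚ[ℂ] ℂ, S.IsProduct g f ∧ Excised g (fun n => S.tprod n fun _ => p n) := by
  refine S.exists_product_state hp fun i x => ?_
  have := ((continuous_starAlgHom (S.factor i)).tendsto 0).comp (hf.tendsto x)
  rwa [map_zero] at this

/-- Conjugating an excised state. -/
theorem Excised.conj {f g : A →ₚ[ℂ] ℂ} {p : ℕ → A} (h : Excised f p) {Y : A}
    (hY : ∀ n, star Y * Y * p n = p n) (hg : ∀ x, g x = f (star Y * x * Y)) :
    Excised g fun n => Y * p n * star Y := by
  have hpY : ∀ n, p n * (star Y * Y) = p n := by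
    intro n
    have := congrArg star (hY n)
    simpa [(h.proj n).isSelfAdjoint.star_eq, mul_assoc] using this
  have hpn : ∀ x n, f (p n * x * p n) = f x := by
    intro x n
    rw [← inner_cyclicVector_gns f x, ← inner_cyclicVector_gns f (p n * x * p n), gns_mul_apply,
      gns_mul_apply, h.gns_apply, ← (h.proj n).isSelfAdjoint.star_eq, ← inner_gns_left,
      h.gns_apply]
  refine ⟨?_, fun n => ⟨?_, ?_⟩, fun n => ?_, fun x => ?_⟩
  · rw [hg, mul_one, ← hpn _ 0, mul_assoc, hY, (h.proj 0).isIdempotentElem.eq, h.map]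
  · rw [IsIdempotentElem]
    calc Y * p n * star Y * (Y * p n * star Y) = Y * p n * (star Y * Y * p n) * star Y := by
          simp only [mul_assoc]
      _ = _ := by rw [hY, mul_assoc Y, (h.proj n).isIdempotentElem.eq]
  · rw [isSelfAdjoint_iff]
    simp [(h.proj n).isSelfAdjoint.star_eq, mul_assoc]
  · rw [hg]
    have : star Y * (Y * p n * star Y) * Y = p n := by
      calc _ = (star Y * Y * p n) * (star Y * Y) := by simp only [mul_assoc]
        _ = _ := by rw [hY, hpY]
    rw [this, h.map]
  · have h1 := (h.tendsto (star Y * x * Y)).const_mul Y |>.mul_const (star Y)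
    rw [mul_zero, zero_mul] at h1
    refine h1.congr fun n => ?_
    rw [hg]
    simp only [mul_sub, sub_mul, mul_assoc, mul_smul_comm, smul_mul_assoc]

/-- Convergence to zero can be read off after applying the isometry `γ`. Hence excising projections
in the range of `γ` pull back. -/
theorem Excised.comp_of_isometry {f : A →ₚ[ℂ] ℂ} {p : ℕ → A} (h : Excised f p)
    (γ : A →⋆ₐ[ℂ] A) (hγ : ∀ x, ‖γ x‖ = ‖x‖) {p' : ℕ → A} (hp : ∀ n, γ (p' n) = p n)
    {g : A →ₚ[ℂ] ℂ} (hg : ∀ x, g x = f (γ x)) : Excised g p' := by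
  have hinj : Function.Injective γ := (AddMonoidHomClass.isometry_of_norm γ hγ).injective
  refine ⟨by rw [hg, _root_.map_one, h.map_one], fun n => ⟨hinj ?_, hinj ?_⟩, fun n => ?_, fun x => ?_⟩
  · rw [map_mul, hp, (h.proj n).isIdempotentElem.eq]
  · rw [map_star, hp, (h.proj n).isSelfAdjoint.star_eq]
  · rw [hg, hp, h.map]
  · rw [tendsto_zero_iff_norm_tendsto_zero]
    refine (h.tendsto (γ x)).norm.congr' ?_ |>.trans (by rw [norm_zero])
    filter_upwards with n
    rw [← hγ (p' n * x * p' n - g x • p' n), map_sub, map_mul, map_mul, map_smul, hp, hg]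

/-- If a state is excised by projections in the range of an isometric endomorphism, its restriction
to the range is pure. -/
theorem Excised.isPureState_restrict {f : A →ₚ[ℂ] ℂ} {p : ℕ → A} (h : Excised f p)
    (γ : A →⋆ₐ[ℂ] A) (hγ : ∀ x, ‖γ x‖ = ‖x‖) (hp : ∀ n, p n ∈ Set.range γ) :
    IsPureState (f.toLinearMap ∘ₗ γ.range.subtype.toAlgHom.toLinearMap) := by
  choose p' hp' using hp
  have hpure := (h.comp_of_isometry γ hγ hp' (g := pullback f γ) (fun _ => rfl)).isPureState
  have hpure := mem_extremePoints.mp hpure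
  let r : A →ₗ[ℂ] γ.range := γ.rangeRestrict.toAlgHom.toLinearMap
  have hr : Function.Surjective r := γ.rangeRestrict_surjective
  -- Pulling back along the surjection `A → γ(A)` is affine and injective on states, so purity of `f
  -- ∘ γ` descends to the restriction of `f`.
  have hst : ∀ g ∈ states γ.range, g ∘ₗ r ∈ states A := by
    intro g hg
    refine ⟨?_, fun x => ?_⟩
    · have : r 1 = 1 := _root_.map_one γ.rangeRestrict
      rw [LinearMap.comp_apply, this, hg.1]
    · have : r (star x * x) = star (r x) * r x := by
        change γ.rangeRestrict _ = star (γ.rangeRestrict x) * γ.rangeRestrict x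
        rw [map_mul, map_star]
      rw [LinearMap.comp_apply, this]
      exact hg.2 _
  refine mem_extremePoints.mpr ⟨⟨?_, fun x => ?_⟩, fun g₁ h₁ g₂ h₂ hs => ?_⟩
  · exact h.map_one
  · exact f.map_nonneg (star_mul_self_nonneg (x : A))
  · obtain ⟨a, b, ha, hb, hab, hs⟩ := hs
    have := hpure.2 _ (hst g₁ h₁) _ (hst g₂ h₂) ⟨a, b, ha, hb, hab, by
      ext x
      exact LinearMap.congr_fun hs (r x)⟩
    constructor
    · ext y
      obtain ⟨x, rfl⟩ := hr y
      exact LinearMap.congr_fun this.1 x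
    · ext y
      obtain ⟨x, rfl⟩ := hr y
      exact LinearMap.congr_fun this.2 x

end ProductStates

/-! ### Clock and shift matrices -/

section ClockShift

variable (k : ℕ) [NeZero k]

/-- The primitive root of unity `e^{2πi/k}`. -/
def rootOfUnity : ℂ := Complex.exp (2 * Real.pi * Complex.I / k)

/-- The cyclic shift matrix. -/
def shift : Matrix (Fin k) (Fin k) ℂ := fun a b => if a = b + 1 then 1 else 0

theorem isPrimitiveRoot_rootOfUnity : IsPrimitiveRoot (rootOfUnity k) k :=
  Complex.isPrimitiveRoot_exp k (NeZero.ne k)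

theorem rootOfUnity_pow : rootOfUnity k ^ k = 1 := (isPrimitiveRoot_rootOfUnity k).pow_eq_one

theorem rootOfUnity_ne_zero (k : ℕ) : rootOfUnity k ≠ 0 := Complex.exp_ne_zero _

theorem norm_rootOfUnity : ‖rootOfUnity k‖ = 1 :=
  (isPrimitiveRoot_rootOfUnity k).norm'_eq_one (NeZero.ne k)

theorem star_rootOfUnity : star (rootOfUnity k) = (rootOfUnity k)⁻¹ := by
  rw [Complex.inv_def, Complex.normSq_eq_norm_sq, norm_rootOfUnity]; simp

theorem rootOfUnity_pow_val_add_one (a : Fin k) :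
    rootOfUnity k ^ ((a + 1 : Fin k) : ℕ) = rootOfUnity k ^ (a : ℕ) * rootOfUnity k := by
  rw [← pow_succ, Fin.val_add, Fin.val_one', Nat.add_mod_mod, ← pow_eq_pow_mod _ (rootOfUnity_pow k)]

theorem clock_eq (k : ℕ) : clock k = Matrix.diagonal fun j : Fin k => rootOfUnity k ^ (j : ℕ) := rfl

theorem star_clock : star (clock k) =
    Matrix.diagonal fun j : Fin k => (rootOfUnity k ^ (j : ℕ))⁻¹ := by
  rw [clock_eq, Matrix.star_eq_conjTranspose, Matrix.diagonal_conjTranspose]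
  congr 1
  ext j
  simp only [Pi.star_apply, star_pow, star_rootOfUnity, inv_pow]

theorem star_clock_mul : star (clock k) * clock k = 1 := by
  rw [star_clock, clock_eq, Matrix.diagonal_mul_diagonal, ← Matrix.diagonal_one]
  congr 1
  ext j
  exact inv_mul_cancel₀ (pow_ne_zero _ (rootOfUnity_ne_zero k))

theorem clock_mul_star : clock k * star (clock k) = 1 :=
  mul_eq_one_comm.mp (star_clock_mul k)

theorem clock_mem_unitary : clock k ∈ unitary (Matrix (Fin k) (Fin k) ℂ) :=
  ⟨star_clock_mul k, clock_mul_star k⟩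

theorem clock_pow : clock k ^ k = 1 := by
  rw [clock_eq, Matrix.diagonal_pow, ← Matrix.diagonal_one]
  congr 1
  ext j
  rw [Pi.pow_apply, ← pow_mul, mul_comm, pow_mul, rootOfUnity_pow, one_pow]

theorem clock_conj_single (a b : Fin k) (c : ℂ) :
    clock k * Matrix.single a b c * star (clock k) =
      (rootOfUnity k ^ (a : ℕ) * (rootOfUnity k ^ (b : ℕ))⁻¹) • Matrix.single a b c := by
  rw [star_clock, clock_eq]
  ext i j
  simp only [Matrix.mul_diagonal, Matrix.diagonal_mul, Matrix.smul_apply, Matrix.single_apply]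
  split_ifs with h
  · rw [h.1, h.2, smul_eq_mul]; ring
  · simp

theorem shift_mul_single (a b : Fin k) :
    shift k * Matrix.single a b 1 = Matrix.single (a + 1) b 1 := by
  ext i j
  simp only [Matrix.mul_apply, Matrix.single_apply, shift, ite_mul, one_mul, zero_mul]
  by_cases hi : i = a + 1
  · by_cases hj : b = j
    · subst hi hj; simp
    · simp [hj]
  · by_cases hj : b = j
    · subst hj
      simp only [and_true]
      rw [if_neg (Ne.symm hi), Finset.sum_eq_zero]
      intro x _
      split_ifs with h1 h2
      · exact absurd (h2 ▸ h1) hi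
      · rfl
      · rfl
    · simp [hj]

theorem star_shift_mul : star (shift k) * shift k = 1 := by
  ext a b
  rw [Matrix.mul_apply, Matrix.one_apply]
  simp [shift, Matrix.star_apply, eq_comm]

theorem shift_mul_star : shift k * star (shift k) = 1 := mul_eq_one_comm.mp (star_shift_mul k)

theorem clock_mul_shift : clock k * shift k = rootOfUnity k • (shift k * clock k) := by
  rw [clock_eq]
  ext a b
  rw [Matrix.diagonal_mul, Matrix.smul_apply, Matrix.mul_diagonal]
  simp only [shift]
  split_ifs with h
  · rw [h, rootOfUnity_pow_val_add_one, smul_eq_mul]; ring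
  · simp

theorem clock_conj_shift : clock k * shift k * star (clock k) = rootOfUnity k • shift k := by
  rw [clock_mul_shift, smul_mul_assoc, mul_assoc, clock_mul_star, mul_one]

/-- Orthogonality of the characters of `ℤ/k`; the Fourier inversions below rest on it. -/
theorem sum_rootOfUnity (a b : ℕ) (ha : a < k) (hb : b < k) :
    ∑ m ∈ Finset.range k, (rootOfUnity k ^ (a * m))⁻¹ * rootOfUnity k ^ (b * m) =
      if a = b then (k : ℂ) else 0 := by
  have hω := isPrimitiveRoot_rootOfUnity k
  have h0 := rootOfUnity_ne_zero k
  have h1 : ∀ m, (rootOfUnity k ^ (a * m))⁻¹ * rootOfUnity k ^ (b * m) =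
      ((rootOfUnity k ^ a)⁻¹ * rootOfUnity k ^ b) ^ m := by
    intro m; rw [mul_pow, inv_pow, pow_mul, pow_mul]
  simp only [h1]
  split_ifs with h
  · subst h
    rw [inv_mul_cancel₀ (pow_ne_zero _ h0)]
    simp
  · have hne : (rootOfUnity k ^ a)⁻¹ * rootOfUnity k ^ b ≠ 1 := by
      intro h2
      rw [inv_mul_eq_one₀ (pow_ne_zero _ h0)] at h2
      exact h (hω.pow_inj ha hb h2)
    rw [geom_sum_eq hne, mul_pow, inv_pow, ← pow_mul, ← pow_mul, mul_comm a, mul_comm b, pow_mul,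
      pow_mul, rootOfUnity_pow]
    simp

theorem single_self_eq (a : Fin k) : Matrix.single a a (1 : ℂ) =
    (k : ℂ)⁻¹ • ∑ m ∈ Finset.range k, (rootOfUnity k ^ ((a : ℕ) * m))⁻¹ • clock k ^ m := by
  have hk : (k : ℂ) ≠ 0 := Nat.cast_ne_zero.mpr (NeZero.ne k)
  have : ∀ m, clock k ^ m = Matrix.diagonal fun j : Fin k => rootOfUnity k ^ ((j : ℕ) * m) := by
    intro m
    rw [clock_eq, Matrix.diagonal_pow]
    congr 1
    ext j
    rw [Pi.pow_apply, pow_mul]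
  simp only [this]
  rw [← Matrix.diagonal_single]
  have h2 : ∑ m ∈ Finset.range k, (rootOfUnity k ^ ((a : ℕ) * m))⁻¹ •
      Matrix.diagonal (fun j : Fin k => rootOfUnity k ^ ((j : ℕ) * m)) =
      Matrix.diagonal fun j : Fin k => ∑ m ∈ Finset.range k, (rootOfUnity k ^ ((a : ℕ) * m))⁻¹ *
        rootOfUnity k ^ ((j : ℕ) * m) := by
    ext i j
    rw [Matrix.sum_apply]
    by_cases hij : i = j
    · subst hij; simp
    · simp [Matrix.diagonal_apply_ne _ hij]
  rw [h2, ← Matrix.diagonal_smul]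
  congr 1
  ext j
  rw [Pi.smul_apply, sum_rootOfUnity k _ _ a.2 j.2, Pi.single_apply]
  by_cases h : j = a
  · simp [h, hk]
  · rw [if_neg h, if_neg fun h' => h (Fin.ext h'.symm)]; simp

/-- The clock and shift matrices generate the matrix algebra. -/
theorem mem_of_clock_shift {R : Subalgebra ℂ (Matrix (Fin k) (Fin k) ℂ)} (hv : clock k ∈ R)
    (hw : shift k ∈ R) (x : Matrix (Fin k) (Fin k) ℂ) : x ∈ R := by
  have h1 : ∀ a, Matrix.single a a (1 : ℂ) ∈ R := fun a => by
    rw [single_self_eq]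
    exact R.smul_mem (sum_mem fun m _ => R.smul_mem (pow_mem hv m) _) _
  -- Once the diagonal units are available, powers of the shift move `e_{bb}` to every row of column
  -- `b`.
  have h2 : ∀ (m : ℕ) (hm : m < k) (b : Fin k),
      Matrix.single (b + ⟨m, hm⟩) b (1 : ℂ) ∈ R := by
    intro m
    induction m with
    | zero =>
      intro hm b
      have : (⟨0, hm⟩ : Fin k) = 0 := Fin.ext (by simp)
      simpa [this] using h1 b
    | succ m ih =>
      intro hm b
      have := mul_mem hw (ih (by omega) b)
      rw [shift_mul_single, add_assoc] at this
      convert this using 3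
      refine Fin.ext ?_
      rw [Fin.val_add, Fin.val_one', Nat.add_mod_mod, Nat.mod_eq_of_lt hm]
  have h3 : ∀ a b, Matrix.single a b (1 : ℂ) ∈ R := by
    intro a b
    have := h2 ((a - b : Fin k) : ℕ) (a - b).2 b
    rwa [Fin.eta, add_sub_cancel] at this
  rw [Matrix.matrix_eq_sum_single x]
  refine sum_mem fun a _ => sum_mem fun b _ => ?_
  rw [show Matrix.single a b (x a b) = x a b • Matrix.single a b (1 : ℂ) by
    rw [Matrix.smul_single, smul_eq_mul, mul_one]]
  exact R.smul_mem (h3 a b) _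

end ClockShift

/-! ### The automorphism `σ` and its spectral decomposition -/

section Gauge

variable {k : ℕ} [NeZero k] {A : Type*} [CStarAlgebra A]

/-- The automorphism `⊗ Ad v`. -/
theorem exists_gauge [Nontrivial A] (T : UHF k A) :
    ∃ σ : A ≃⋆ₐ[ℂ] A,
      (∀ n x, σ (T.factor n x) = T.factor n (clock k * x * star (clock k))) ∧ σ ^ k = 1 := by
  have key : ∀ u : unitary (Matrix (Fin k) (Fin k) ℂ), ∃ Φ : A →⋆ₐ[ℂ] A,
      ∀ n x, Φ (T.factor n x) = T.factor n ((u : Matrix (Fin k) (Fin k) ℂ) * x *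
        star (u : Matrix (Fin k) (Fin k) ℂ)) := by
    intro u
    exact T.exists_hom (fun n => (T.factor n).comp
      ((Unitary.conjStarAlgAut ℂ _ u : _ ≃⋆ₐ[ℂ] _) : _ →⋆ₐ[ℂ] _)) fun m n h x y =>
        T.commute m n h _ _
  let u : unitary (Matrix (Fin k) (Fin k) ℂ) := ⟨clock k, clock_mem_unitary k⟩
  obtain ⟨Φ, hΦ⟩ := key u
  obtain ⟨Ψ, hΨ⟩ := key (star u)
  have hu : (u : Matrix (Fin k) (Fin k) ℂ) = clock k := rfl
  have hsu : ((star u : unitary _) : Matrix (Fin k) (Fin k) ℂ) = star (clock k) := rfl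
  have h1 : Φ.comp Ψ = StarAlgHom.id ℂ A := T.starAlgHom_ext fun n x => by
    simp only [StarAlgHom.comp_apply, hΦ, hΨ, hu, hsu, star_star]
    change T.factor n _ = T.factor n x
    congr 1
    simp only [mul_assoc]
    rw [clock_mul_star, mul_one, ← mul_assoc, clock_mul_star, one_mul]
  have h2 : Ψ.comp Φ = StarAlgHom.id ℂ A := T.starAlgHom_ext fun n x => by
    simp only [StarAlgHom.comp_apply, hΦ, hΨ, hu, hsu, star_star]
    change T.factor n _ = T.factor n x
    congr 1
    simp only [mul_assoc]
    rw [star_clock_mul, mul_one, ← mul_assoc, star_clock_mul, one_mul]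
  let σ : A ≃⋆ₐ[ℂ] A := StarAlgEquiv.ofStarAlgHom Φ Ψ h2 h1
  have hσ : ∀ n x, σ (T.factor n x) = T.factor n (clock k * x * star (clock k)) := hΦ
  refine ⟨σ, hσ, ?_⟩
  have hpow : ∀ m n x, (σ ^ m) (T.factor n x) =
      T.factor n (clock k ^ m * x * star (clock k ^ m)) := by
    intro m n
    induction m with
    | zero => intro x; simp
    | succ m ih =>
      intro x
      rw [pow_succ, StarAlgEquiv.mul_apply, hσ, ih]
      congr 1
      rw [star_pow, star_pow, pow_succ, pow_succ']
      simp only [mul_assoc]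
  have : ((σ ^ k : A ≃⋆ₐ[ℂ] A) : A →⋆ₐ[ℂ] A) = StarAlgHom.id ℂ A :=
    T.starAlgHom_ext fun n x => by
      change (σ ^ k) (T.factor n x) = T.factor n x
      rw [hpow, clock_pow]; simp
  ext x
  exact DFunLike.congr_fun this x

variable {σ : A ≃⋆ₐ[ℂ] A}

/-- The spectral component of `y` for the eigenvalue `ω ^ j` of `σ`. -/
def eigComp (k : ℕ) [NeZero k] (σ : A ≃⋆ₐ[ℂ] A) (j : ℕ) (y : A) : A :=
  (k : ℂ)⁻¹ • ∑ m ∈ Finset.range k, (rootOfUnity k ^ (j * m))⁻¹ • (σ ^ m) y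

theorem sum_eigComp (y : A) : ∑ j ∈ Finset.range k, eigComp k σ j y = y := by
  have hk : (k : ℂ) ≠ 0 := Nat.cast_ne_zero.mpr (NeZero.ne k)
  simp only [eigComp]
  rw [← Finset.smul_sum, Finset.sum_comm]
  have : ∀ m ∈ Finset.range k, ∑ j ∈ Finset.range k, (rootOfUnity k ^ (j * m))⁻¹ • (σ ^ m) y =
      if m = 0 then (k : ℂ) • y else 0 := by
    intro m hm
    rw [← Finset.sum_smul]
    have h := sum_rootOfUnity k m 0 (Finset.mem_range.mp hm) (NeZero.pos k)
    simp only [zero_mul, pow_zero, mul_one] at h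
    simp_rw [mul_comm _ m]
    rw [h]
    split_ifs with h
    · rw [h]; simp
    · simp
  rw [Finset.sum_congr rfl this, Finset.sum_ite_eq' (Finset.range k) 0]
  simp [NeZero.pos k, smul_smul, hk]

theorem map_eigComp (hσ : σ ^ k = 1) (j : ℕ) (y : A) :
    σ (eigComp k σ j y) = rootOfUnity k ^ j • eigComp k σ j y := by
  have h0 := rootOfUnity_ne_zero k
  simp only [eigComp, map_smul, map_sum]
  rw [smul_comm]
  congr 1
  have h1 : ∀ m, (rootOfUnity k ^ (j * m))⁻¹ • σ ((σ ^ m) y) =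
      rootOfUnity k ^ j • ((rootOfUnity k ^ (j * (m + 1)))⁻¹ • (σ ^ (m + 1)) y) := by
    intro m
    rw [pow_succ' σ, StarAlgEquiv.mul_apply, smul_smul]
    congr 1
    rw [mul_add, mul_one, pow_add]
    field_simp
  simp only [h1, ← Finset.smul_sum]
  congr 1
  -- Applying `σ` shifts the summation index by one. The sum over `m = 1, …, k` equals that over `m
  -- = 0, …, k - 1` because the terms for `m = 0` and `m = k` coincide.
  have h2 := Finset.sum_range_succ (fun m => (rootOfUnity k ^ (j * m))⁻¹ • (σ ^ m) y) k
  rw [Finset.sum_range_succ'] at h2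
  rw [hσ, mul_comm j k, pow_mul (rootOfUnity k) k, rootOfUnity_pow] at h2
  simpa using h2

theorem eigComp_zero_of_fixed {y : A} (hy : σ y = y) : eigComp k σ 0 y = y := by
  have hk : (k : ℂ) ≠ 0 := Nat.cast_ne_zero.mpr (NeZero.ne k)
  have : ∀ m, (σ ^ m) y = y := by
    intro m
    induction m with
    | zero => rfl
    | succ m ih => rw [pow_succ, StarAlgEquiv.mul_apply, hy, ih]
  simp [eigComp, this, ← Nat.cast_smul_eq_nsmul ℂ, smul_smul, hk]

theorem continuous_eigComp (j : ℕ) : Continuous (eigComp k σ j) := by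
  have : ∀ m : ℕ, Continuous ((σ ^ m : A ≃⋆ₐ[ℂ] A) : A → A) := fun m =>
    continuous_starAlgHom ((σ ^ m : A ≃⋆ₐ[ℂ] A) : A →⋆ₐ[ℂ] A)
  unfold eigComp
  fun_prop

variable {T : UHF k A}

theorem gauge_single
    (hσT : ∀ n x, σ (T.factor n x) = T.factor n (clock k * x * star (clock k)))
    (n : ℕ) (a b : Fin k) : σ (T.factor n (Matrix.single a b 1)) =
    (rootOfUnity k ^ (a : ℕ) * (rootOfUnity k ^ (b : ℕ))⁻¹) •
      T.factor n (Matrix.single a b 1) := by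
  rw [hσT, clock_conj_single, map_smul]

theorem gauge_single_self
    (hσT : ∀ n x, σ (T.factor n x) = T.factor n (clock k * x * star (clock k)))
    (n : ℕ) (a : Fin k) :
    σ (T.factor n (Matrix.single a a 1)) = T.factor n (Matrix.single a a 1) := by
  rw [gauge_single hσT, mul_inv_cancel₀ (pow_ne_zero _ (rootOfUnity_ne_zero k)), one_smul]

theorem gauge_shift
    (hσT : ∀ n x, σ (T.factor n x) = T.factor n (clock k * x * star (clock k))) (n : ℕ) :
    σ (T.factor n (shift k)) = rootOfUnity k • T.factor n (shift k) := by
  rw [hσT, clock_conj_shift, map_smul]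

/-- Every element of `A e_{00}` is a combination of elements `b e_{j0}` with `b` fixed. -/
theorem mul_single_mem_span (hσ : σ ^ k = 1)
    (hσT : ∀ n x, σ (T.factor n x) = T.factor n (clock k * x * star (clock k))) (y : A) :
    y * T.factor 0 (Matrix.single 0 0 1) ∈ Submodule.span ℂ
      {z | ∃ b, σ b = b ∧ ∃ j, z = b * T.factor 0 (Matrix.single j 0 1)} := by
  rw [← sum_eigComp (k := k) (σ := σ) y, Finset.sum_mul]
  refine sum_mem fun j hj => Submodule.subset_span ?_
  have hj := Finset.mem_range.mp hj
  -- `e_{0j}` has degree `-j` and compensates the degree of the component, while `e_{0j} e_{j0} =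
  -- e_{00}` restores the product.
  refine ⟨eigComp k σ j y * T.factor 0 (Matrix.single 0 ⟨j, hj⟩ 1), ?_, ⟨j, hj⟩, ?_⟩
  · rw [map_mul, map_eigComp hσ, gauge_single hσT, smul_mul_smul_comm]
    simp [rootOfUnity_ne_zero]
  · rw [mul_assoc, ← map_mul]; simp

/-- If `q` absorbs the shift of the `n`-th factor, then `A q = A^σ q`. -/
theorem exists_fixed_mul_eq (hσ : σ ^ k = 1)
    (hσT : ∀ n x, σ (T.factor n x) = T.factor n (clock k * x * star (clock k))) (n : ℕ) {q : A}
    (hq : T.factor n (shift k) * q = q) (y : A) : ∃ b, σ b = b ∧ y * q = b * q := by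
  have h0 := rootOfUnity_ne_zero k
  set w := T.factor n (shift k)
  have hw : star w * w = 1 := by rw [← map_star, ← map_mul, star_shift_mul, map_one]
  have hq' : ∀ j : ℕ, star w ^ j * q = q := by
    intro j
    induction j with
    | zero => simp
    | succ j ih =>
      rw [pow_succ, mul_assoc]
      nth_rw 1 [← hq]
      rw [← mul_assoc (star w), hw, one_mul, ih]
  have hσw : ∀ j : ℕ, σ (star w ^ j) = (rootOfUnity k ^ j)⁻¹ • star w ^ j := by
    intro j
    rw [map_pow, map_star, gauge_shift hσT, star_smul, star_rootOfUnity, smul_pow, inv_pow]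
  -- Each spectral component is corrected to degree zero by a power of `w*`, which `q` absorbs.
  refine ⟨∑ j ∈ Finset.range k, eigComp k σ j y * star w ^ j, ?_, ?_⟩
  · rw [map_sum]
    refine Finset.sum_congr rfl fun j _ => ?_
    rw [map_mul, map_eigComp hσ, hσw, smul_mul_smul_comm, mul_inv_cancel₀ (pow_ne_zero _ h0),
      one_smul]
  · conv_lhs => rw [← sum_eigComp (k := k) (σ := σ) y]
    rw [Finset.sum_mul, Finset.sum_mul]
    refine Finset.sum_congr rfl fun j _ => ?_
    rw [mul_assoc, hq']

end Gauge

/-! ### Commutants that are diagonal on a family of vectors -/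

section AtomicCommutant

theorem norm_sum_sq_of_orthogonal {I H : Type*} [NormedAddCommGroup H] [InnerProductSpace ℂ H]
    (s : Finset I) (a : I → H) (h : ∀ i ∈ s, ∀ j ∈ s, i ≠ j → inner ℂ (a i) (a j) = 0) :
    ‖∑ i ∈ s, a i‖ ^ 2 = ∑ i ∈ s, ‖a i‖ ^ 2 := by
  classical
  induction s using Finset.induction_on with
  | empty => simp
  | insert i s hi ih =>
    rw [Finset.sum_insert hi, Finset.sum_insert hi, pow_two,
      norm_add_sq_eq_norm_sq_add_norm_sq_of_inner_eq_zero (𝕜 := ℂ), ← pow_two, ← pow_two,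
      ih fun a ha b hb => h a (Finset.mem_insert_of_mem ha) b (Finset.mem_insert_of_mem hb)]
    rw [inner_sum]
    refine Finset.sum_eq_zero fun j hj => ?_
    exact h i (Finset.mem_insert_self _ _) j (Finset.mem_insert_of_mem hj)
      (fun h' => hi (h' ▸ hj))

variable {H : Type*} [NormedAddCommGroup H] [InnerProductSpace ℂ H] [CompleteSpace H]
  {C : Type*} [Ring C] [StarRing C] [Algebra ℂ C] (ρ : C →⋆ₐ[ℂ] (H →L[ℂ] H))

theorem mem_centralizer_range {R : H →L[ℂ] H} :
    R ∈ StarSubalgebra.centralizer ℂ (Set.range ρ) ↔ ∀ x, Commute R (ρ x) := by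
  rw [StarSubalgebra.mem_centralizer_iff]
  constructor
  · intro h x
    exact (h _ ⟨x, rfl⟩).1.symm
  · rintro h _ ⟨x, rfl⟩
    refine ⟨(h x).eq.symm, ?_⟩
    rw [← map_star]
    exact (h _).eq.symm

variable {ρ} {I : Type*} {ζ : I → H}

theorem commutant_apply {R : H →L[ℂ] H} (hR : ∀ x, Commute R (ρ x)) (x : C) (v : H) :
    R (ρ x v) = ρ x (R v) :=
  congrArg (fun S : H →L[ℂ] H => S v) (hR x).eq

theorem apply_eq_inner_smul (hnorm : ∀ s, ‖ζ s‖ = 1)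
    (heig : ∀ R : H →L[ℂ] H, (∀ x, Commute R (ρ x)) → ∀ s, ∃ c : ℂ, R (ζ s) = c • ζ s)
    {R : H →L[ℂ] H} (hR : ∀ x, Commute R (ρ x)) (s : I) :
    R (ζ s) = inner ℂ (ζ s) (R (ζ s)) • ζ s := by
  obtain ⟨c, hc⟩ := heig R hR s
  rw [hc, inner_smul_right, inner_self_eq_norm_sq_to_K, hnorm]
  simp

/-- The diagonal coefficients of the commutant of a multiplicity-free representation. -/
def diagCoeff (hnorm : ∀ s, ‖ζ s‖ = 1)
    (heig : ∀ R : H →L[ℂ] H, (∀ x, Commute R (ρ x)) → ∀ s, ∃ c : ℂ, R (ζ s) = c • ζ s) :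
    StarSubalgebra.centralizer ℂ (Set.range ρ) →⋆ₐ[ℂ] (I → ℂ) where
  toFun R s := inner ℂ (ζ s) ((R : H →L[ℂ] H) (ζ s))
  map_one' := by
    ext s
    change inner ℂ (ζ s) (ζ s) = 1
    rw [inner_self_eq_norm_sq_to_K, hnorm]; simp
  map_mul' R R' := by
    ext s
    change inner ℂ (ζ s) ((R : H →L[ℂ] H) ((R' : H →L[ℂ] H) (ζ s))) = _
    rw [apply_eq_inner_smul hnorm heig ((mem_centralizer_range ρ).mp R'.2) s, map_smul,
      inner_smul_right, Pi.mul_apply, mul_comm]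
  map_zero' := by ext s; simp
  map_add' R R' := by
    ext s
    simp
  commutes' c := by
    ext s
    change inner ℂ (ζ s) ((algebraMap ℂ (H →L[ℂ] H) c) (ζ s)) = c
    rw [Algebra.algebraMap_eq_smul_one]
    change inner ℂ (ζ s) (c • ζ s) = c
    rw [inner_smul_right, inner_self_eq_norm_sq_to_K, hnorm]; simp
  map_star' R := by
    ext s
    change inner ℂ (ζ s) ((star (R : H →L[ℂ] H)) (ζ s)) = star (inner ℂ (ζ s) _)
    rw [ContinuousLinearMap.star_eq_adjoint, ContinuousLinearMap.adjoint_inner_right]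
    exact (inner_conj_symm _ _).symm

theorem ext_of_total {R R' : H →L[ℂ] H}
    (htot : Dense (Submodule.span ℂ {v | ∃ x s, v = ρ x (ζ s)} : Set H))
    (h : ∀ x s, R (ρ x (ζ s)) = R' (ρ x (ζ s))) : R = R' := by
  refine ContinuousLinearMap.ext_on htot ?_
  rintro _ ⟨x, s, rfl⟩
  exact h x s

theorem diagCoeff_injective (hnorm : ∀ s, ‖ζ s‖ = 1)
    (heig : ∀ R : H →L[ℂ] H, (∀ x, Commute R (ρ x)) → ∀ s, ∃ c : ℂ, R (ζ s) = c • ζ s)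
    (htot : Dense (Submodule.span ℂ {v | ∃ x s, v = ρ x (ζ s)} : Set H)) :
    Function.Injective (diagCoeff hnorm heig) := by
  intro R R' h
  refine Subtype.ext (ext_of_total htot fun x s => ?_)
  have hR := (mem_centralizer_range ρ).mp R.2
  have hR' := (mem_centralizer_range ρ).mp R'.2
  have h1 : inner ℂ (ζ s) ((R : H →L[ℂ] H) (ζ s)) = inner ℂ (ζ s) ((R' : H →L[ℂ] H) (ζ s)) :=
    congrFun h s
  rw [commutant_apply hR, commutant_apply hR', apply_eq_inner_smul hnorm heig hR,
    apply_eq_inner_smul hnorm heig hR', h1]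

theorem norm_diagCoeff_le (hnorm : ∀ s, ‖ζ s‖ = 1)
    (heig : ∀ R : H →L[ℂ] H, (∀ x, Commute R (ρ x)) → ∀ s, ∃ c : ℂ, R (ζ s) = c • ζ s)
    (R : StarSubalgebra.centralizer ℂ (Set.range ρ)) (s : I) :
    ‖diagCoeff hnorm heig R s‖ ≤ ‖(R : H →L[ℂ] H)‖ := by
  refine (norm_inner_le_norm _ _).trans ?_
  have := (R : H →L[ℂ] H).le_opNorm (ζ s)
  rw [hnorm] at *
  linarith

/-- Every bounded family of scalars is realized by an operator in the commutant. -/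
theorem exists_diagonal
    (horth : ∀ x s t, s ≠ t → inner ℂ (ρ x (ζ s)) (ζ t) = 0)
    (htot : Dense (Submodule.span ℂ {v | ∃ x s, v = ρ x (ζ s)} : Set H))
    {c : I → ℂ} {K : ℝ} (hc : ∀ s, ‖c s‖ ≤ K) :
    ∃ R : H →L[ℂ] H, (∀ x, Commute R (ρ x)) ∧ ∀ s, R (ζ s) = c s • ζ s := by
  classical
  let r : I → C →ₗ[ℂ] H := fun s =>
    (ContinuousLinearMap.apply ℂ H (ζ s)).toLinearMap ∘ₗ ρ.toAlgHom.toLinearMap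
  have hr : ∀ s x, r s x = ρ x (ζ s) := fun _ _ => rfl
  let e : (I →₀ C) →ₗ[ℂ] H := Finsupp.lsum ℂ r
  let b : (I →₀ C) →ₗ[ℂ] H := Finsupp.lsum ℂ fun s => c s • r s
  have he : ∀ x s, e (Finsupp.single s x) = ρ x (ζ s) := by
    intro x s; simp [e, hr]
  have hb : ∀ x s, b (Finsupp.single s x) = c s • ρ x (ζ s) := by
    intro x s; simp [b, hr]
  have horth' : ∀ x y s t, s ≠ t → inner ℂ (ρ x (ζ s)) (ρ y (ζ t)) = 0 := by
    intro x y s t hst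
    rw [← ContinuousLinearMap.adjoint_inner_left, ← ContinuousLinearMap.star_eq_adjoint,
      ← map_star]
    change inner ℂ ((ρ (star y) * ρ x) (ζ s)) (ζ t) = 0
    rw [← map_mul]
    exact horth _ s t hst
  have hdense : DenseRange e := by
    have : Submodule.span ℂ {v | ∃ x s, v = ρ x (ζ s)} ≤ LinearMap.range e := by
      rw [Submodule.span_le]
      rintro _ ⟨x, s, rfl⟩
      exact ⟨_, he x s⟩
    exact htot.mono this
  -- The cyclic subspaces of different `ζ s` are orthogonal, so both norms are computed by
  -- Pythagoras.
  have hbound : ∀ F, ‖b F‖ ≤ K * ‖e F‖ := by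
    intro F
    rcases isEmpty_or_nonempty I with hI | ⟨⟨s₀⟩⟩
    · have : F = 0 := Subsingleton.elim _ _
      simp [this]
    have hK : 0 ≤ K := (norm_nonneg _).trans (hc s₀)
    have h1 : e F = ∑ s ∈ F.support, ρ (F s) (ζ s) := rfl
    have h2 : b F = ∑ s ∈ F.support, c s • ρ (F s) (ζ s) := rfl
    refine le_of_sq_le_sq ?_ (by positivity)
    rw [mul_pow, h1, h2, norm_sum_sq_of_orthogonal _ _ fun s _ t _ hst => horth' _ _ s t hst,
      norm_sum_sq_of_orthogonal, Finset.mul_sum]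
    · refine Finset.sum_le_sum fun s _ => ?_
      rw [norm_smul, mul_pow]
      have := hc s
      gcongr
    · intro s _ t _ hst
      rw [inner_smul_left, inner_smul_right, horth' _ _ s t hst]
      simp
  let R := b.extendOfNorm e
  have hR : ∀ F, R (e F) = b F := LinearMap.extendOfNorm_eq hdense ⟨K, hbound⟩
  have hR' : ∀ x s, R (ρ x (ζ s)) = c s • ρ x (ζ s) := by
    intro x s
    rw [← hb, ← hR, he]
  refine ⟨R, fun x => ext_of_total htot fun y s => ?_, fun s => ?_⟩
  · change R (ρ x (ρ y (ζ s))) = ρ x (R (ρ y (ζ s)))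
    have : ρ x (ρ y (ζ s)) = ρ (x * y) (ζ s) := by rw [map_mul]; rfl
    rw [hR', map_smul, this, hR']
  · have := hR' 1 s
    rw [map_one] at this
    exact this

/-- Finitely many coefficients are automatically bounded, so every family is realized. -/
theorem nonempty_starAlgEquiv_pi [Finite I] (hnorm : ∀ s, ‖ζ s‖ = 1)
    (heig : ∀ R : H →L[ℂ] H, (∀ x, Commute R (ρ x)) → ∀ s, ∃ c : ℂ, R (ζ s) = c • ζ s)
    (horth : ∀ x s t, s ≠ t → inner ℂ (ρ x (ζ s)) (ζ t) = 0)
    (htot : Dense (Submodule.span ℂ {v | ∃ x s, v = ρ x (ζ s)} : Set H)) :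
    Nonempty (StarSubalgebra.centralizer ℂ (Set.range ρ) ≃⋆ₐ[ℂ] (I → ℂ)) := by
  refine ⟨StarAlgEquiv.ofBijective (diagCoeff hnorm heig)
    ⟨diagCoeff_injective hnorm heig htot, fun c => ?_⟩⟩
  obtain ⟨K, hK⟩ := (Set.finite_range fun s => ‖c s‖).bddAbove
  obtain ⟨R, hR, hRc⟩ := exists_diagonal horth htot (c := c) (K := K) fun s => hK ⟨s, rfl⟩
  refine ⟨⟨R, (mem_centralizer_range ρ).mpr hR⟩, ?_⟩
  ext s
  change inner ℂ (ζ s) (R (ζ s)) = _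
  rw [hRc, inner_smul_right, inner_self_eq_norm_sq_to_K, hnorm]
  simp

/-- For infinite index sets the coefficients are bounded by the operator norm, and `exists_diagonal`
shows that boundedness is also sufficient. -/
theorem nonempty_starAlgEquiv_lp (hnorm : ∀ s, ‖ζ s‖ = 1)
    (heig : ∀ R : H →L[ℂ] H, (∀ x, Commute R (ρ x)) → ∀ s, ∃ c : ℂ, R (ζ s) = c • ζ s)
    (horth : ∀ x s t, s ≠ t → inner ℂ (ρ x (ζ s)) (ζ t) = 0)
    (htot : Dense (Submodule.span ℂ {v | ∃ x s, v = ρ x (ζ s)} : Set H)) :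
    Nonempty (StarSubalgebra.centralizer ℂ (Set.range ρ) ≃⋆ₐ[ℂ] lp (fun _ : I => ℂ) ∞) := by
  let D := diagCoeff hnorm heig
  have hmem : ∀ R, Memℓp (D R) ∞ := fun R => memℓp_infty ⟨‖(R : H →L[ℂ] H)‖, by
    rintro _ ⟨s, rfl⟩
    exact norm_diagCoeff_le hnorm heig R s⟩
  let D' : StarSubalgebra.centralizer ℂ (Set.range ρ) →⋆ₙₐ[ℂ] lp (fun _ : I => ℂ) ∞ :=
    { toFun := fun R => ⟨D R, hmem R⟩
      map_smul' := fun c R => Subtype.ext (map_smul D c R)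
      map_zero' := Subtype.ext (map_zero D)
      map_add' := fun R R' => Subtype.ext (map_add D R R')
      map_mul' := fun R R' => Subtype.ext (map_mul D R R')
      map_star' := fun R => Subtype.ext (map_star D R) }
  refine ⟨StarAlgEquiv.ofBijective D' ⟨fun R R' h => ?_, fun c => ?_⟩⟩
  · exact diagCoeff_injective hnorm heig htot (congrArg Subtype.val h)
  · obtain ⟨K, hK⟩ := memℓp_infty_iff.mp c.2
    obtain ⟨R, hR, hRc⟩ := exists_diagonal horth htot (c := c) (K := K) fun s => hK ⟨s, rfl⟩
    refine ⟨⟨R, (mem_centralizer_range ρ).mpr hR⟩, Subtype.ext ?_⟩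
    funext s
    change inner ℂ (ζ s) (R (ζ s)) = _
    rw [hRc, inner_smul_right, inner_self_eq_norm_sq_to_K, hnorm]
    simp

end AtomicCommutant

/-! ### Commutants in GNS representations and central sequences -/

section Commutants

variable {A : Type*} [CStarAlgebra A] [PartialOrder A] [StarOrderedRing A]

theorem gnsCommutant_eq (f : A →ₚ[ℂ] ℂ) (γ : A →⋆ₐ[ℂ] A) :
    gnsCommutant f γ = StarSubalgebra.centralizer ℂ (Set.range (f.gnsStarAlgHom.comp γ)) := rfl

theorem mem_gnsCommutant {f : A →ₚ[ℂ] ℂ} {γ : A →⋆ₐ[ℂ] A} {R : f.GNS →L[ℂ] f.GNS} :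
    R ∈ gnsCommutant f γ ↔ ∀ x, Commute R (f.gnsStarAlgHom (γ x)) :=
  mem_centralizer_range (f.gnsStarAlgHom.comp γ)

/-- A sequence of factor elements with common eigenvalue on the cyclic vector converges strongly. -/
theorem tendsto_gns_factor {B : Type*} [Ring B] [StarRing B] [Algebra ℂ B]
    (T : InfTensorPower B A) (f : A →ₚ[ℂ] ℂ) {u : B} {c : ℂ} (hu : ∀ n, ‖T.factor n u‖ ≤ 1)
    (h : ∀ n, f.gnsStarAlgHom (T.factor n u) (cyclicVector f) = c • cyclicVector f) (ζ : f.GNS) :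
    Tendsto (fun n => f.gnsStarAlgHom (T.factor n u) ζ) atTop (𝓝 (c • ζ)) := by
  refine tendsto_of_denseRange (L := c • (1 : f.GNS →L[ℂ] f.GNS)) (K := 1) (fun n => ?_)
    (denseRange_gns f) (fun x => ?_) ζ
  · exact (NonUnitalStarAlgHom.norm_apply_le _ _).trans (hu n)
  · change Tendsto _ _ (𝓝 (c • f.gnsStarAlgHom x _))
    -- The sequence is asymptotically central: the `n`-th factor commutes with every elementary
    -- tensor of length at most `n`. Its eigenvalue on `Ω` therefore spreads to every `xΩ`.
    have hcomm : Tendsto (fun n => T.factor n u * x - x * T.factor n u) atTop (𝓝 0) := by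
      refine T.tprod_induction (P := fun x => Tendsto (fun n => T.factor n u * x -
        x * T.factor n u) atTop (𝓝 0)) ?_ ?_ ?_ ?_ x
      · refine isClosed_setOf_tendsto_of_lipschitz (T := fun n (x : A) => T.factor n u * x -
          x * T.factor n u) (L := fun _ => 0) (K := 2) (fun n => ?_) continuous_const
        refine LipschitzWith.of_dist_le_mul fun y z => ?_
        rw [dist_eq_norm, dist_eq_norm]
        have h1 : T.factor n u * y - y * T.factor n u - (T.factor n u * z - z * T.factor n u) =
            T.factor n u * (y - z) - (y - z) * T.factor n u := by
          rw [mul_sub, sub_mul]; abel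
        rw [h1]
        have h2 := norm_sub_le (T.factor n u * (y - z)) ((y - z) * T.factor n u)
        have h3 := norm_mul_le (T.factor n u) (y - z)
        have h4 := norm_mul_le (y - z) (T.factor n u)
        have h5 := hu n
        have h6 := norm_nonneg (y - z)
        push_cast
        nlinarith
      · intro m y
        refine tendsto_const_nhds.congr' ?_
        filter_upwards [eventually_ge_atTop m] with n hn
        rw [(T.tprod_commute_factor hn y u).eq, sub_self]
      · intro y z hy hz
        have := hy.add hz
        rw [add_zero] at this
        refine this.congr fun n => ?_
        rw [mul_add, add_mul]; abel
      · intro r y hy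
        have := hy.const_smul r
        rw [smul_zero] at this
        refine this.congr fun n => ?_
        rw [smul_sub, mul_smul_comm, smul_mul_assoc]
    rw [← tendsto_sub_nhds_zero_iff]
    refine squeeze_zero_norm (a := fun n => ‖T.factor n u * x - x * T.factor n u‖ *
      ‖cyclicVector f‖) (fun n => ?_) ?_
    · refine le_of_eq_of_le ?_ (norm_gns_apply_le f _ _)
      rw [map_sub, sub_apply, gns_mul_apply, gns_mul_apply, h, map_smul]
    · simpa using hcomm.norm.mul_const ‖cyclicVector f‖

end Commutants

/-! ### The states `φ`, `χ` and `ψ` and their excising projections -/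

section BaseStates

theorem IsProjSeq.const {B : Type*} [Ring B] [StarRing B] [Algebra ℂ B] {p : B}
    (h : IsStarProjection p) (hf : IsFull p) : IsProjSeq fun _ : ℕ => p :=
  ⟨fun _ => h, fun _ _ _ => h.isIdempotentElem, fun _ => hf⟩

/-- The index shift discards `p 0`, which in the application is the empty tensor `1` and need not be
fixed by `Y* Y`. -/
theorem IsProjSeq.conj_succ {B : Type*} [Ring B] [StarRing B] [Algebra ℂ B] {p : ℕ → B}
    (h : IsProjSeq p) {Y : B} (hY : ∀ n, star Y * Y * p (n + 1) = p (n + 1)) :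
    IsProjSeq fun n => Y * p (n + 1) * star Y where
  proj n := by
    constructor
    · rw [IsIdempotentElem]
      calc Y * p (n + 1) * star Y * (Y * p (n + 1) * star Y) =
          Y * p (n + 1) * (star Y * Y * p (n + 1)) * star Y := by simp only [mul_assoc]
        _ = _ := by rw [hY, mul_assoc Y, (h.proj _).isIdempotentElem.eq]
    · rw [isSelfAdjoint_iff]
      simp [(h.proj _).isSelfAdjoint.star_eq, mul_assoc]
  anti m n hmn := by
    calc Y * p (n + 1) * star Y * (Y * p (m + 1) * star Y) =
          Y * p (n + 1) * (star Y * Y * p (m + 1)) * star Y := by simp only [mul_assoc]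
        _ = _ := by rw [hY, mul_assoc Y, h.anti _ _ (by omega)]
  full n := by
    refine (h.full (n + 1)).of_mul (a := star Y) (b := Y) ?_
    have hpY : p (n + 1) * (star Y * Y) = p (n + 1) := by
      have := congrArg star (hY n)
      simpa [(h.proj _).isSelfAdjoint.star_eq, mul_assoc] using this
    calc p (n + 1) = (star Y * Y * p (n + 1)) * (star Y * Y) := by rw [hY, hpY]
      _ = _ := by simp only [mul_assoc]

theorem Excised.succ {A : Type*} [CStarAlgebra A] [PartialOrder A] [StarOrderedRing A]
    {f : A →ₚ[ℂ] ℂ} {p : ℕ → A} (h : Excised f p) : Excised f fun n => p (n + 1) :=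
  ⟨h.map_one, fun _ => h.proj _, fun _ => h.map _,
    fun x => (h.tendsto x).comp (tendsto_add_atTop_nat 1)⟩

variable {k : ℕ} [NeZero k]

theorem isStarProjection_single {k : ℕ} (j : Fin k) : IsStarProjection (Matrix.single j j (1 : ℂ)) :=
  ⟨by simp [IsIdempotentElem], by
    simp [isSelfAdjoint_iff, Matrix.star_eq_conjTranspose, Matrix.conjTranspose_single]⟩

theorem isFull_single : IsFull (Matrix.single (0 : Fin k) (0 : Fin k) (1 : ℂ)) := by
  rw [IsFull, ← sum_map_single (AlgHom.id ℂ (Matrix (Fin k) (Fin k) ℂ))]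
  refine sum_mem fun j _ => Submodule.subset_span
    ⟨Matrix.single j 0 1, Matrix.single 0 j 1, by simp⟩

theorem single_mul_mul_single (x : Matrix (Fin k) (Fin k) ℂ) :
    Matrix.single 0 0 1 * x * Matrix.single 0 0 1 = x 0 0 • Matrix.single 0 0 (1 : ℂ) := by
  rw [Matrix.single_mul_mul_single, Matrix.smul_single]
  simp

/-- The projection onto the vector with equal entries. -/
def flatProj (k : ℕ) : Matrix (Fin k) (Fin k) ℂ := fun _ _ => (k : ℂ)⁻¹

theorem flatProj_mul_mul_flatProj {k : ℕ} (x : Matrix (Fin k) (Fin k) ℂ) :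
    flatProj k * x * flatProj k = ((k : ℂ)⁻¹ * ∑ i, ∑ j, x i j) • flatProj k := by
  ext a b
  simp only [Matrix.mul_apply, flatProj, Matrix.smul_apply, smul_eq_mul]
  rw [← Finset.sum_mul, Finset.sum_comm]
  simp only [← Finset.mul_sum]

theorem isStarProjection_flatProj : IsStarProjection (flatProj k) := by
  have hk : (k : ℂ) ≠ 0 := Nat.cast_ne_zero.mpr (NeZero.ne k)
  constructor
  · have := flatProj_mul_mul_flatProj (1 : Matrix (Fin k) (Fin k) ℂ)
    rw [mul_one] at this
    rw [IsIdempotentElem, this]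
    simp [Matrix.one_apply, hk]
  · rw [isSelfAdjoint_iff]
    ext a b
    simp [flatProj, Matrix.star_apply]

theorem isFull_flatProj : IsFull (flatProj k) := by
  have hk : (k : ℂ) ≠ 0 := Nat.cast_ne_zero.mpr (NeZero.ne k)
  refine isFull_single.of_mul (a := (k : ℂ) • Matrix.single (0 : Fin k) (0 : Fin k) 1)
    (b := Matrix.single 0 0 1) ?_
  rw [smul_mul_assoc, smul_mul_assoc, single_mul_mul_single, smul_smul, flatProj, mul_inv_cancel₀ hk,
    one_smul]

theorem sum_shift_apply : ∑ i : Fin k, ∑ j : Fin k, shift k i j = k := by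
  change ∑ i : Fin k, ∑ j : Fin k, (if i = j + 1 then (1 : ℂ) else 0) = k
  rw [Finset.sum_comm]
  simp

theorem shift_mul_flatProj : shift k * flatProj k = flatProj k := by
  ext a b
  simp only [Matrix.mul_apply, flatProj, ← Finset.sum_mul]
  have : ∑ j, shift k a j = 1 := by
    have : ∀ j, (a = j + 1) ↔ (j = a - 1) := fun j => by rw [eq_sub_iff_add_eq, eq_comm]
    simp [shift, this]
  rw [this, one_mul]

/-- The matrix `k^{-1/2} ∑_j e_{j0}`. -/
def flatColumn (k : ℕ) [NeZero k] : Matrix (Fin k) (Fin k) ℂ :=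
  ((Real.sqrt k : ℂ))⁻¹ • ∑ j, Matrix.single j 0 1

theorem sqrt_inv_mul_self {k : ℕ} : ((Real.sqrt k : ℂ))⁻¹ * ((Real.sqrt k : ℂ))⁻¹ = (k : ℂ)⁻¹ := by
  rw [← mul_inv, ← Complex.ofReal_mul, Real.mul_self_sqrt (Nat.cast_nonneg k)]
  simp

theorem star_flatColumn : star (flatColumn k) =
    ((Real.sqrt k : ℂ))⁻¹ • ∑ j, Matrix.single 0 j 1 := by
  simp [flatColumn, star_smul, star_sum, Matrix.star_eq_conjTranspose,
    Matrix.conjTranspose_single]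

theorem single_mul_flatColumn (i j : Fin k) : Matrix.single i j 1 * flatColumn k =
    ((Real.sqrt k : ℂ))⁻¹ • Matrix.single i 0 1 := by
  rw [flatColumn, mul_smul_comm, Finset.mul_sum, Finset.sum_eq_single j]
  · simp
  · intro b _ hb
    simp [Ne.symm hb]
  · simp

theorem star_flatColumn_mul : star (flatColumn k) * flatColumn k = Matrix.single 0 0 1 := by
  have hk : (k : ℂ) ≠ 0 := Nat.cast_ne_zero.mpr (NeZero.ne k)
  rw [star_flatColumn, smul_mul_assoc, Finset.sum_mul]
  simp only [single_mul_flatColumn]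
  rw [← Finset.smul_sum, smul_smul, sqrt_inv_mul_self]
  simp [← Nat.cast_smul_eq_nsmul ℂ, hk]

theorem shift_mul_flatColumn : shift k * flatColumn k = flatColumn k := by
  rw [flatColumn, mul_smul_comm, Finset.mul_sum]
  congr 1
  simp only [shift_mul_single]
  exact Equiv.sum_comp (Equiv.addRight (1 : Fin k)) fun j => Matrix.single j 0 (1 : ℂ)

variable {A : Type*} [CStarAlgebra A]

/-- The projections `e_{00} ⊗ ⋯ ⊗ e_{00}`. -/
def vacProj (T : UHF k A) (n : ℕ) : A := T.tprod n fun _ => Matrix.single 0 0 1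

theorem isProjSeq_vacProj (T : UHF k A) : IsProjSeq (vacProj T) :=
  (IsProjSeq.const (isStarProjection_single 0) isFull_single).tprod T

/-- The element `k^{-1/2} ∑_j e_{j0}` of the first tensor factor. -/
def flatElt (T : UHF k A) : A := T.factor 0 (flatColumn k)

theorem star_flatElt_mul (T : UHF k A) :
    star (flatElt T) * flatElt T = T.factor 0 (Matrix.single 0 0 1) := by
  rw [flatElt, ← map_star, ← map_mul, star_flatColumn_mul]

theorem single_mul_vacProj (T : UHF k A) (n : ℕ) :
    T.factor 0 (Matrix.single 0 0 1) * vacProj T (n + 1) = vacProj T (n + 1) := by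
  rw [← T.tprod_mulSingle (Nat.succ_pos n), vacProj, T.tprod_mul]
  refine T.tprod_congr fun i _ => ?_
  by_cases hi : i = 0
  · subst hi; simp
  · simp [Pi.mulSingle_eq_of_ne hi]

theorem star_flatElt_mul_vacProj (T : UHF k A) (n : ℕ) :
    star (flatElt T) * flatElt T * vacProj T (n + 1) = vacProj T (n + 1) := by
  rw [star_flatElt_mul, single_mul_vacProj]

/-- The projections excising the vector state of `flatVector`. -/
def flatVacProj (T : UHF k A) (n : ℕ) : A := flatElt T * vacProj T (n + 1) * star (flatElt T)

theorem isProjSeq_flatVacProj (T : UHF k A) : IsProjSeq (flatVacProj T) :=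
  (isProjSeq_vacProj T).conj_succ (star_flatElt_mul_vacProj T)

variable [PartialOrder A] [StarOrderedRing A]

/-- Compression by a rank-one projection is exactly scalar, so the convergence required in each
factor is an equality. -/
theorem exists_vacuumState [Nontrivial A] (T : UHF k A) :
    ∃ φ : A →ₚ[ℂ] ℂ, T.IsProduct φ (fun x => x 0 0) ∧ Excised φ (vacProj T) :=
  T.exists_product_state (IsProjSeq.const (isStarProjection_single 0) isFull_single)
    fun i x => by simp

theorem exists_flatState [Nontrivial A] (T : UHF k A) :
    ∃ χ : A →ₚ[ℂ] ℂ, T.IsProduct χ (fun x => (k : ℂ)⁻¹ * ∑ i, ∑ j, x i j) ∧ ∃ p, Excised χ p := by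
  obtain ⟨χ, h1, h2⟩ := T.exists_product_state
    (IsProjSeq.const (isStarProjection_flatProj (k := k)) isFull_flatProj)
    (f₀ := fun x => (k : ℂ)⁻¹ * ∑ i, ∑ j, x i j) fun i x => by
      simp [flatProj_mul_mul_flatProj]
  exact ⟨χ, h1, _, h2⟩

theorem flatVector_eq (T : UHF k A) (f : A →ₚ[ℂ] ℂ) :
    flatVector T f = f.gnsStarAlgHom (flatElt T) (cyclicVector f) := by
  simp only [flatVector, flatElt, flatColumn, map_smul, map_sum, smul_apply,
    sum_apply]

theorem exists_flatVectorState {T : UHF k A} {φ : A →ₚ[ℂ] ℂ} (hφ : Excised φ (vacProj T)) :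
    ∃ ψ : A →ₚ[ℂ] ℂ, (∀ x, ψ x = φ (star (flatElt T) * x * flatElt T)) ∧
      Excised ψ (flatVacProj T) := by
  let ψ : A →ₚ[ℂ] ℂ := PositiveLinearMap.mk₀
    (φ.toLinearMap ∘ₗ LinearMap.mulRight ℂ (flatElt T) ∘ₗ LinearMap.mulLeft ℂ (star (flatElt T)))
    fun x hx => φ.map_nonneg (star_left_conjugate_nonneg hx (flatElt T))
  have hψ : ∀ x, ψ x = φ (star (flatElt T) * x * flatElt T) := fun _ => rfl
  exact ⟨ψ, hψ, hφ.succ.conj (star_flatElt_mul_vacProj T) hψ⟩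

theorem flatVectorState_eq_inner {T : UHF k A} {φ ψ : A →ₚ[ℂ] ℂ}
    (hψ : ∀ x, ψ x = φ (star (flatElt T) * x * flatElt T)) (x : A) :
    ψ x = inner ℂ (flatVector T φ) (φ.gnsStarAlgHom x (flatVector T φ)) := by
  rw [flatVector_eq, ← gns_mul_apply, inner_gns_gns, hψ, mul_assoc]

end BaseStates

/-! ### The representation of the product state `φ` restricted to the fixed points of `σ` -/

section Gauge

variable {k : ℕ} [NeZero k] {A : Type*} [CStarAlgebra A] {T : UHF k A} {σ : A ≃⋆ₐ[ℂ] A}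

/-- `σ` is the automorphism `⊗ Ad v`, of period `k`. -/
structure IsGauge (T : UHF k A) (σ : A ≃⋆ₐ[ℂ] A) : Prop where
  map_factor : ∀ n x, σ (T.factor n x) = T.factor n (clock k * x * star (clock k))
  pow_eq_one : σ ^ k = 1

theorem gauge_vacProj (h : IsGauge T σ) (n : ℕ) : σ (vacProj T n) = vacProj T n := by
  refine (T.map_tprod (σ : A →⋆ₐ[ℂ] A) n _).trans ?_
  rw [vacProj, InfTensorPower.tprod]
  congr 1
  exact List.map_congr_left fun i _ => gauge_single_self h.map_factor i 0

theorem star_factor_single {k : ℕ} {T : UHF k A} (n : ℕ) (i j : Fin k) :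
    star (T.factor n (Matrix.single i j 1)) = T.factor n (Matrix.single j i 1) := by
  rw [← map_star, Matrix.star_eq_conjTranspose, Matrix.conjTranspose_single, star_one]

theorem fixed_of_range {γ : A →⋆ₐ[ℂ] A} (hγ : Set.range γ = {x | σ x = x}) (x : A) :
    σ (γ x) = γ x := by
  have : γ x ∈ {x | σ x = x} := hγ ▸ ⟨x, rfl⟩
  exact this

theorem exists_of_fixed {γ : A →⋆ₐ[ℂ] A} (hγ : Set.range γ = {x | σ x = x}) {b : A}
    (hb : σ b = b) : ∃ x, γ x = b := by
  have : b ∈ Set.range γ := hγ ▸ hb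
  exact this

theorem rootOfUnity_ratio_ne_one {i j : Fin k} (h : i ≠ j) :
    (rootOfUnity k ^ (i : ℕ))⁻¹ * rootOfUnity k ^ (j : ℕ) ≠ 1 := by
  intro h'
  rw [inv_mul_eq_one₀ (pow_ne_zero _ (rootOfUnity_ne_zero k))] at h'
  exact h (Fin.ext ((isPrimitiveRoot_rootOfUnity k).pow_inj i.2 j.2 h'))

variable [PartialOrder A] [StarOrderedRing A] {φ : A →ₚ[ℂ] ℂ} {γ : A →⋆ₐ[ℂ] A}

theorem map_gauge_of_isProduct {k : ℕ} {T : UHF k A} {f₀ : Matrix (Fin k) (Fin k) ℂ → ℂ} {f : A →ₚ[ℂ] ℂ}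
    (hσ : IsGauge T σ) (hf : T.IsProduct f f₀)
    (h0 : ∀ x, f₀ (clock k * x * star (clock k)) = f₀ x) (h1 : f 1 = 1)
    (x : A) : f (σ x) = f x := by
  have hc := continuous_of_map_one h1
  have hσc : Continuous σ := continuous_starAlgHom (σ : A →⋆ₐ[ℂ] A)
  refine T.tprod_induction (P := fun x => f (σ x) = f x) ?_ ?_ ?_ ?_ x
  · exact isClosed_eq (hc.comp hσc) hc
  · intro n x
    have : σ (T.tprod n x) = T.tprod n fun i => clock k * x i * star (clock k) := by
      have := T.map_tprod (σ : A →⋆ₐ[ℂ] A) n x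
      refine this.trans ?_
      rw [InfTensorPower.tprod]
      congr 1
      exact List.map_congr_left fun i _ => hσ.map_factor i (x i)
    rw [this, hf.map_tprod, hf.map_tprod]
    exact Finset.prod_congr rfl fun i _ => h0 (x i)
  · intro x y hx hy; rw [map_add, map_add, map_add, hx, hy]
  · intro c x hx; rw [map_smul, map_smul, map_smul, hx]

/-- `φ` is the product state of `x ↦ x₀₀`, invariant under the gauge automorphism `σ`. -/
structure IsVacuum (T : UHF k A) (σ : A ≃⋆ₐ[ℂ] A) (φ : A →ₚ[ℂ] ℂ) : Prop where
  gauge : IsGauge T σ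
  isProduct : T.IsProduct φ (fun x => x 0 0)
  excised : Excised φ (vacProj T)
  invariant : ∀ x, φ (σ x) = φ x

theorem exists_isVacuum [Nontrivial A] (h : IsGauge T σ) : ∃ φ : A →ₚ[ℂ] ℂ, IsVacuum T σ φ := by
  obtain ⟨φ, h1, h2⟩ := exists_vacuumState T
  refine ⟨φ, h, h1, h2, map_gauge_of_isProduct h h1 (fun x => ?_) h2.map_one⟩
  rw [star_clock, clock_eq, Matrix.mul_diagonal, Matrix.diagonal_mul]
  simp

namespace IsVacuum

theorem map_eq_zero (h : IsVacuum T σ φ) {z : A} {c : ℂ} (hz : σ z = c • z) (hc : c ≠ 1) :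
    φ z = 0 := by
  have h := h.invariant z
  rw [hz, map_smul, smul_eq_mul] at h
  have : (c - 1) * φ z = 0 := by rw [sub_mul, h]; ring
  exact (mul_eq_zero.mp this).resolve_left (sub_ne_zero.mpr hc)

/-- Off-diagonal matrix coefficients of fixed elements vanish in the vacuum state. -/
theorem offDiag (h : IsVacuum T σ φ) {b : A} (hb : σ b = b) {i j : Fin k} (hij : i ≠ j) :
    φ (T.factor 0 (Matrix.single 0 i 1) * b * T.factor 0 (Matrix.single j 0 1)) = 0 := by
  refine h.map_eq_zero (c := (rootOfUnity k ^ (i : ℕ))⁻¹ * rootOfUnity k ^ (j : ℕ)) ?_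
    (rootOfUnity_ratio_ne_one hij)
  rw [map_mul, map_mul, hb, gauge_single h.gauge.map_factor, gauge_single h.gauge.map_factor,
    smul_mul_assoc, smul_mul_smul_comm]
  simp

theorem gns_single_zero (h : IsVacuum T σ φ) (n : ℕ) :
    φ.gnsStarAlgHom (T.factor n (Matrix.single 0 0 1)) (cyclicVector φ) = cyclicVector φ := by
  refine gns_fix h.excised.map_one ?_ ?_
  · refine IsStarProjection.norm_le _ ⟨?_, ?_⟩
    · rw [IsIdempotentElem, ← map_mul]; simp
    · rw [isSelfAdjoint_iff, star_factor_single]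
  · rw [h.isProduct.map_factor (by simp)]; simp

end IsVacuum

/-- The vectors `e_{j0} Ω`. -/
def vacVector (T : UHF k A) (φ : A →ₚ[ℂ] ℂ) (j : Fin k) : φ.GNS :=
  φ.gnsStarAlgHom (T.factor 0 (Matrix.single j 0 1)) (cyclicVector φ)

namespace IsVacuum

theorem norm_vacVector (h : IsVacuum T σ φ) (j : Fin k) : ‖vacVector T φ j‖ = 1 := by
  have h : inner ℂ (vacVector T φ j) (vacVector T φ j) = (1 : ℂ) := by
    rw [vacVector, inner_gns_gns, star_factor_single, ← map_mul]
    simp [h.isProduct.map_factor]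
  rw [inner_self_eq_norm_sq_to_K] at h
  have h2 : ‖vacVector T φ j‖ ^ 2 = 1 := Complex.ofReal_injective (by push_cast; exact h)
  nlinarith [norm_nonneg (vacVector T φ j)]

/-- The elements `e_{j0} p_n e_{0j}` are fixed by `σ`, hence lie in the range of `γ` and commute
with `R`. -/
theorem vacVector_eigen (h : IsVacuum T σ φ) (hγ : Set.range γ = {x | σ x = x})
    (R : φ.GNS →L[ℂ] φ.GNS) (hR : ∀ x, Commute R ((φ.gnsStarAlgHom.comp γ) x)) (j : Fin k) :
    ∃ c : ℂ, R (vacVector T φ j) = c • vacVector T φ j := by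
  refine h.excised.exists_eq_smul _ ?_ R (Eventually.of_forall fun n => ?_)
  · rw [star_factor_single, ← map_mul]
    simpa using h.gns_single_zero 0
  · have : σ (T.factor 0 (Matrix.single j 0 1) * vacProj T n *
        star (T.factor 0 (Matrix.single j 0 1))) = T.factor 0 (Matrix.single j 0 1) *
        vacProj T n * star (T.factor 0 (Matrix.single j 0 1)) := by
      rw [star_factor_single, map_mul, map_mul, gauge_vacProj h.gauge,
        gauge_single h.gauge.map_factor, gauge_single h.gauge.map_factor, smul_mul_assoc,
        smul_mul_smul_comm]
      simp [rootOfUnity_ne_zero]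
    obtain ⟨x, hx⟩ := exists_of_fixed hγ this
    rw [← hx]
    exact hR x

/-- The inner product is the value of the invariant state `φ` on an element of non-zero degree. -/
theorem vacVector_orth (h : IsVacuum T σ φ) (hγ : Set.range γ = {x | σ x = x}) (x : A)
    (s t : Fin k) (hst : s ≠ t) :
    inner ℂ ((φ.gnsStarAlgHom.comp γ) x (vacVector T φ s)) (vacVector T φ t) = 0 := by
  change inner ℂ (φ.gnsStarAlgHom (γ x) (vacVector T φ s)) (vacVector T φ t) = 0
  rw [vacVector, vacVector, ← gns_mul_apply, inner_gns_gns, star_mul, star_factor_single,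
    ← map_star]
  exact h.offDiag (fixed_of_range hγ _) hst

/-- Since `e_{00}` fixes `Ω`, every `yΩ` equals `y e_{00} Ω`, to which `mul_single_mem_span`
applies. -/
theorem vacVector_total (h : IsVacuum T σ φ) (hγ : Set.range γ = {x | σ x = x}) :
    Dense (Submodule.span ℂ {v | ∃ x s,
      v = (φ.gnsStarAlgHom.comp γ) x (vacVector T φ s)} : Set φ.GNS) := by
  refine (denseRange_gns φ).mono ?_
  rintro _ ⟨y, rfl⟩
  have h1 := mul_single_mem_span h.gauge.pow_eq_one h.gauge.map_factor y
  have h2 := Submodule.mem_map_of_mem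
    (f := (ContinuousLinearMap.apply ℂ φ.GNS (cyclicVector φ)).toLinearMap ∘ₗ
      φ.gnsStarAlgHom.toAlgHom.toLinearMap) h1
  change φ.gnsStarAlgHom (y * T.factor 0 (Matrix.single 0 0 1)) (cyclicVector φ) ∈ _ at h2
  rw [gns_mul_apply, h.gns_single_zero, Submodule.map_span] at h2
  refine Submodule.span_mono ?_ h2
  rintro _ ⟨_, ⟨b, hb, j, rfl⟩, rfl⟩
  obtain ⟨x, rfl⟩ := exists_of_fixed hγ hb
  exact ⟨x, j, gns_mul_apply φ _ _ _⟩

theorem commutant_equiv (h : IsVacuum T σ φ) (hγ : Set.range γ = {x | σ x = x}) :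
    Nonempty (gnsCommutant φ γ ≃⋆ₐ[ℂ] (Fin k → ℂ)) := by
  have := nonempty_starAlgEquiv_pi (ρ := φ.gnsStarAlgHom.comp γ) (ζ := vacVector T φ)
    h.norm_vacVector (h.vacVector_eigen hγ) (h.vacVector_orth hγ) (h.vacVector_total hγ)
  rwa [← gnsCommutant_eq] at this

/-- The unitary implementing the gauge automorphism in the vacuum representation generates the
commutant of the fixed point algebra. -/
theorem exists_unitary (h : IsVacuum T σ φ) (hγ : Set.range γ = {x | σ x = x}) :
    ∃ U : unitary (φ.GNS →L[ℂ] φ.GNS),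
    (∀ x, (U : φ.GNS →L[ℂ] φ.GNS) (φ.gnsStarAlgHom x (cyclicVector φ)) =
      φ.gnsStarAlgHom (σ x) (cyclicVector φ)) ∧
    Implements φ U σ ∧ U ^ k = 1 ∧
    gnsCommutant φ γ = doubleCommutant (U : φ.GNS →L[ℂ] φ.GNS) := by
  obtain ⟨U, hU, hUΩ⟩ := exists_implements (f := φ) (σ : A →⋆ₐ[ℂ] A) (cyclicVector φ)
    (fun x => by rw [inner_cyclicVector_gns]; exact (h.invariant x).symm)
    (by
      have : (fun x => φ.gnsStarAlgHom ((σ : A →⋆ₐ[ℂ] A) x) (cyclicVector φ)) =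
        (fun x => φ.gnsStarAlgHom x (cyclicVector φ)) ∘ σ := rfl
      rw [DenseRange, this, (EquivLike.surjective σ).range_comp]
      exact denseRange_gns φ)
  have hUΩ' : ∀ x, (U : φ.GNS →L[ℂ] φ.GNS) (φ.gnsStarAlgHom x (cyclicVector φ)) =
      φ.gnsStarAlgHom (σ x) (cyclicVector φ) := hUΩ
  set V : φ.GNS →L[ℂ] φ.GNS := (U : φ.GNS →L[ℂ] φ.GNS) with hV
  have hpow : ∀ (m : ℕ) x, (V ^ m) (φ.gnsStarAlgHom x (cyclicVector φ)) =
      φ.gnsStarAlgHom ((σ ^ m) x) (cyclicVector φ) := by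
    intro m x
    induction m with
    | zero => rfl
    | succ m ih =>
      rw [pow_succ', pow_succ']
      change V ((V ^ m) _) = φ.gnsStarAlgHom (σ ((σ ^ m) x)) (cyclicVector φ)
      rw [ih, hUΩ']
  refine ⟨U, hUΩ', hU, ?_, ?_⟩
  · refine Subtype.ext ?_
    rw [SubmonoidClass.coe_pow]
    refine gns_ext fun x => ?_
    rw [hpow, h.gauge.pow_eq_one]
    rfl
  · have hUcomm : ∀ x, V * φ.gnsStarAlgHom (γ x) = φ.gnsStarAlgHom (γ x) * V := by
      intro x
      have h1 := (hU (γ x)).trans (congrArg φ.gnsStarAlgHom (fixed_of_range hγ x))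
      have h3 := congrArg (· * V) h1
      simp only [mul_assoc] at h3
      rwa [hV, Unitary.star_mul_self_of_mem U.2, mul_one] at h3
    ext R
    constructor
    · intro hR
      have hR' := mem_gnsCommutant.mp hR
      choose c hc using h.vacVector_eigen hγ R hR'
      -- `V` is the scalar `ω^j` on the cyclic subspace of the `j`-th vector.
      have hVvec : ∀ (m : ℕ) x j, (V ^ m) (φ.gnsStarAlgHom (γ x) (vacVector T φ j)) =
          rootOfUnity k ^ ((j : ℕ) * m) • φ.gnsStarAlgHom (γ x) (vacVector T φ j) := by
        intro m x j
        induction m with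
        | zero => simp
        | succ m ih =>
          rw [pow_succ']
          change V ((V ^ m) _) = _
          rw [ih, map_smul, vacVector, ← gns_mul_apply, hUΩ', map_mul, fixed_of_range hγ,
            gauge_single h.gauge.map_factor, mul_smul_comm, map_smul, smul_apply, smul_smul,
            mul_add, mul_one, pow_add]
          simp
      -- Fourier inversion writes the projection onto the `i`-th subspace as a polynomial in `V`,
      -- and `R` is a combination of these projections.
      have hRV : R = ∑ i : Fin k, c i • ((k : ℂ)⁻¹ • ∑ m ∈ Finset.range k,
          (rootOfUnity k ^ ((i : ℕ) * m))⁻¹ • V ^ m) := by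
        refine ext_of_total (h.vacVector_total hγ) fun x j => ?_
        have hx : (φ.gnsStarAlgHom.comp γ) x = φ.gnsStarAlgHom (γ x) := rfl
        rw [commutant_apply (ρ := φ.gnsStarAlgHom.comp γ) hR', hc, hx]
        simp only [sum_apply, smul_apply, hVvec, smul_smul, ← Finset.sum_smul]
        rw [Finset.sum_eq_single j]
        · rw [sum_rootOfUnity k _ _ j.2 j.2, if_pos rfl, mul_assoc, inv_mul_cancel₀
            (Nat.cast_ne_zero.mpr (NeZero.ne k) : (k : ℂ) ≠ 0), mul_one]
          exact map_smul _ _ _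
        · intro i _ hij
          rw [sum_rootOfUnity k _ _ i.2 j.2, if_neg fun h => hij (Fin.ext h)]
          simp
        · simp
      rw [hRV, doubleCommutant]
      have hVmem : V ∈ StarSubalgebra.centralizer ℂ
          (StarSubalgebra.centralizer ℂ {V} : Set (φ.GNS →L[ℂ] φ.GNS)) := by
        rw [StarSubalgebra.mem_centralizer_iff]
        intro S hS
        rw [SetLike.mem_coe, StarSubalgebra.mem_centralizer_iff] at hS
        obtain ⟨h1, h2⟩ := hS V rfl
        refine ⟨h1.symm, ?_⟩
        have := congrArg star h2
        simpa using this
      exact sum_mem fun i _ => SMulMemClass.smul_mem _ (SMulMemClass.smul_mem _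
        (sum_mem fun m _ => SMulMemClass.smul_mem _ (pow_mem hVmem m)))
    · intro hR
      rw [doubleCommutant, StarSubalgebra.mem_centralizer_iff] at hR
      refine mem_gnsCommutant.mpr fun x => ?_
      refine (hR (φ.gnsStarAlgHom (γ x)) ?_).1.symm
      rw [SetLike.mem_coe, StarSubalgebra.mem_centralizer_iff]
      rintro _ rfl
      refine ⟨hUcomm x, ?_⟩
      have := congrArg star (hUcomm (star x))
      simp only [star_mul, ← map_star, star_star] at this
      exact this.symm

end IsVacuum

end Gauge

/-! ### The representation of `χ`: trivial commutant and disjointness -/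

section Flat

variable {k : ℕ} [NeZero k] {A : Type*} [CStarAlgebra A] {T : UHF k A} {σ : A ≃⋆ₐ[ℂ] A}

theorem factor_shift_mem_unitary (n : ℕ) : T.factor n (shift k) ∈ unitary A := by
  refine ⟨?_, ?_⟩
  · rw [← map_star, ← map_mul, star_shift_mul, map_one]
  · rw [← map_star, ← map_mul, shift_mul_star, map_one]

theorem pow_gauge_shift (h : IsGauge T σ) (i n : ℕ) :
    (σ ^ i) (T.factor n (shift k)) = rootOfUnity k ^ i • T.factor n (shift k) := by
  induction i with
  | zero => simp
  | succ i ih =>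
    rw [pow_succ', StarAlgEquiv.mul_apply, ih, map_smul, gauge_shift h.map_factor, smul_smul,
      pow_succ]

variable [PartialOrder A] [StarOrderedRing A] {χ : A →ₚ[ℂ] ℂ} {γ : A →⋆ₐ[ℂ] A}

/-- `χ` is the product of the vector states of the vector with equal entries. -/
structure IsFlat (T : UHF k A) (σ : A ≃⋆ₐ[ℂ] A) (χ : A →ₚ[ℂ] ℂ) : Prop where
  gauge : IsGauge T σ
  isProduct : T.IsProduct χ (fun x => (k : ℂ)⁻¹ * ∑ i, ∑ j, x i j)
  excised : ∃ p, Excised χ p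

namespace IsFlat

theorem map_one (h : IsFlat T σ χ) : χ 1 = 1 := by
  obtain ⟨p, hp⟩ := h.excised
  exact hp.map_one

theorem map_factor (h : IsFlat T σ χ) (n : ℕ) (x : Matrix (Fin k) (Fin k) ℂ) :
    χ (T.factor n x) = (k : ℂ)⁻¹ * ∑ i, ∑ j, x i j := by
  have hk : (k : ℂ) ≠ 0 := Nat.cast_ne_zero.mpr (NeZero.ne k)
  exact h.isProduct.map_factor (by simp [Matrix.one_apply, hk]) n x

theorem map_shift (h : IsFlat T σ χ) (n : ℕ) : χ (T.factor n (shift k)) = 1 := by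
  rw [h.map_factor, sum_shift_apply, inv_mul_cancel₀ (Nat.cast_ne_zero.mpr (NeZero.ne k))]

variable [Nontrivial A]

theorem gns_shift (h : IsFlat T σ χ) (n : ℕ) :
    χ.gnsStarAlgHom (T.factor n (shift k)) (cyclicVector χ) = cyclicVector χ :=
  gns_fix h.map_one (CStarRing.norm_of_mem_unitary (factor_shift_mem_unitary n)).le (h.map_shift n)

theorem gns_star_shift_pow (h : IsFlat T σ χ) (n j : ℕ) :
    χ.gnsStarAlgHom (T.factor n (star (shift k) ^ j)) (cyclicVector χ) = cyclicVector χ := by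
  induction j with
  | zero => rw [pow_zero, _root_.map_one, gns_one_apply]
  | succ j ih =>
    nth_rw 1 [← h.gns_shift n]
    rw [← gns_mul_apply, ← map_mul, pow_succ, mul_assoc, star_shift_mul, mul_one, ih]

theorem tendsto_star_shift_pow (h : IsFlat T σ χ) (j : ℕ) (ζ : χ.GNS) :
    Tendsto (fun n => χ.gnsStarAlgHom (T.factor n (star (shift k) ^ j)) ζ) atTop (𝓝 ζ) := by
  have := tendsto_gns_factor T χ (u := star (shift k) ^ j) (c := 1) (fun n => ?_)
    (fun n => by rw [h.gns_star_shift_pow, one_smul]) ζ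
  · rwa [one_smul] at this
  · rw [map_pow, map_star]
    exact (CStarRing.norm_of_mem_unitary
      (pow_mem (Unitary.star_mem (factor_shift_mem_unitary n)) j)).le

/-- A component `z` of degree `j` is the strong limit of the fixed elements `z w_n^{-j}`. What
commutes with the fixed points therefore commutes with all of `A`, and `π_χ` is irreducible. -/
theorem gnsCommutant_eq_bot (h : IsFlat T σ χ) (hγ : Set.range γ = {x | σ x = x}) :
    gnsCommutant χ γ = ⊥ := by
  rw [eq_bot_iff]
  intro R hR
  have hR' := mem_gnsCommutant.mp hR
  have key : ∀ y, Commute R (χ.gnsStarAlgHom y) := by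
    intro y
    rw [← sum_eigComp (k := k) (σ := σ) y, map_sum]
    refine Commute.sum_right _ _ _ fun j _ => ?_
    set z := eigComp k σ j y
    have hz : σ z = rootOfUnity k ^ j • z := map_eigComp h.gauge.pow_eq_one j y
    have hfix : ∀ n, σ (z * T.factor n (star (shift k) ^ j)) =
        z * T.factor n (star (shift k) ^ j) := by
      intro n
      rw [map_mul, hz, map_pow, map_star, map_pow, map_star, gauge_shift h.gauge.map_factor,
        star_smul, star_rootOfUnity, smul_pow, smul_mul_smul_comm, inv_pow,
        mul_inv_cancel₀ (pow_ne_zero _ (rootOfUnity_ne_zero k)), one_smul]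
    refine ContinuousLinearMap.ext fun ζ => ?_
    have h1 : Tendsto (fun n => R (χ.gnsStarAlgHom z
        (χ.gnsStarAlgHom (T.factor n (star (shift k) ^ j)) ζ))) atTop
        (𝓝 (R (χ.gnsStarAlgHom z ζ))) :=
      ((R * χ.gnsStarAlgHom z).continuous.tendsto ζ).comp (h.tendsto_star_shift_pow j ζ)
    have h2 : Tendsto (fun n => χ.gnsStarAlgHom z
        (χ.gnsStarAlgHom (T.factor n (star (shift k) ^ j)) (R ζ))) atTop
        (𝓝 (χ.gnsStarAlgHom z (R ζ))) :=
      ((χ.gnsStarAlgHom z).continuous.tendsto _).comp (h.tendsto_star_shift_pow j (R ζ))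
    refine tendsto_nhds_unique h1 (h2.congr fun n => ?_)
    obtain ⟨x, hx⟩ := exists_of_fixed hγ (hfix n)
    rw [← gns_mul_apply, ← gns_mul_apply, ← hx]
    exact (commutant_apply (ρ := χ.gnsStarAlgHom.comp γ) hR' x ζ).symm
  obtain ⟨p, hp⟩ := h.excised
  obtain ⟨c, hc⟩ := hp.eq_smul_one R key
  rw [hc]
  exact SMulMemClass.smul_mem c (one_mem _)

/-- `π_χ` is faithful because `A` is simple, and it carries the relative commutant into the trivial
commutant. -/
theorem centralizer_eq_bot (h : IsFlat T σ χ) (hγ : Set.range γ = {x | σ x = x}) :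
    StarSubalgebra.centralizer ℂ (Set.range γ) = ⊥ := by
  rw [eq_bot_iff]
  intro z hz
  rw [StarSubalgebra.mem_centralizer_iff] at hz
  have h1 : χ.gnsStarAlgHom z ∈ gnsCommutant χ γ := by
    refine mem_gnsCommutant.mpr fun x => ?_
    have := (hz _ ⟨x, rfl⟩).1.symm
    exact Commute.map (f := χ.gnsStarAlgHom) this
  rw [h.gnsCommutant_eq_bot hγ, StarSubalgebra.mem_bot] at h1
  obtain ⟨c, hc⟩ := h1
  have hnt : Nontrivial χ.GNS := ⟨cyclicVector χ, 0, fun h0 => by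
    have := norm_cyclicVector h.map_one
    rw [h0, norm_zero] at this
    exact zero_ne_one this⟩
  rw [StarSubalgebra.mem_bot]
  refine ⟨c, T.injective_map χ.gnsStarAlgHom ?_⟩
  rw [← hc]
  exact AlgHomClass.commutes χ.gnsStarAlgHom c

/-- Composing `χ` with `σ^i` turns the value `1` on each shift into `ω^i`. The contraction `ω^{-i}
w_n` then fixes the new cyclic vector. -/
theorem tendsto_pullback_shift (h : IsFlat T σ χ) (i : ℕ)
    (ζ : (pullback χ ((σ ^ i : A ≃⋆ₐ[ℂ] A) : A →⋆ₐ[ℂ] A)).GNS) :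
    Tendsto (fun n => (pullback χ ((σ ^ i : A ≃⋆ₐ[ℂ] A) : A →⋆ₐ[ℂ] A)).gnsStarAlgHom
      (T.factor n (shift k)) ζ) atTop (𝓝 (rootOfUnity k ^ i • ζ)) := by
  let f := pullback χ ((σ ^ i : A ≃⋆ₐ[ℂ] A) : A →⋆ₐ[ℂ] A)
  have hf : ∀ x, f x = χ ((σ ^ i) x) := fun _ => rfl
  have h0 := pow_ne_zero i (rootOfUnity_ne_zero k)
  have hu : ∀ n, ‖T.factor n (shift k)‖ ≤ 1 := fun n =>
    (CStarRing.norm_of_mem_unitary (factor_shift_mem_unitary n)).le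
  refine tendsto_gns_factor T f hu (fun n => ?_) ζ
  have := gns_fix (f := f) (by rw [hf, _root_.map_one, h.map_one])
    (u := (rootOfUnity k ^ i)⁻¹ • T.factor n (shift k))
    (by
      rw [norm_smul, norm_inv, norm_pow, norm_rootOfUnity, one_pow, inv_one, one_mul]
      exact hu n)
    (by
      rw [map_smul, hf, pow_gauge_shift h.gauge, map_smul, h.map_shift, smul_smul,
        inv_mul_cancel₀ h0, one_smul])
  rw [map_smul, smul_apply] at this
  nth_rw 2 [← this]
  rw [smul_smul, mul_inv_cancel₀ h0, one_smul]

/-- An intertwiner carries the strong limit of the central sequence `w_n` on one side to that on the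
other, and `ω^i ≠ ω^j`. -/
theorem disjointGNS (h : IsFlat T σ χ) {i j : ℕ} (hi : i < k) (hj : j < k) (hij : i ≠ j) :
    DisjointGNS (pullback χ ((σ ^ i : A ≃⋆ₐ[ℂ] A) : A →⋆ₐ[ℂ] A))
      (pullback χ ((σ ^ j : A ≃⋆ₐ[ℂ] A) : A →⋆ₐ[ℂ] A)) := by
  intro R hR
  refine ContinuousLinearMap.ext fun ζ => ?_
  have h1 := (R.continuous.tendsto _).comp (h.tendsto_pullback_shift i ζ)
  have h2 := h.tendsto_pullback_shift j (R ζ)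
  have h3 := tendsto_nhds_unique h1 (h2.congr fun n =>
    (congrArg (fun S => S ζ) (hR (T.factor n (shift k)))).symm)
  rw [map_smul, ← sub_eq_zero, ← sub_smul] at h3
  refine (smul_eq_zero.mp h3).resolve_left fun h4 => hij ?_
  exact (isPrimitiveRoot_rootOfUnity k).pow_inj hi hj (sub_eq_zero.mp h4)

end IsFlat

end Flat

/-! ### The vector state `ψ`, and purity of `φ` on the fixed points -/

section FlatVectorState

variable {k : ℕ} [NeZero k] {A : Type*} [CStarAlgebra A] {T : UHF k A} {σ : A ≃⋆ₐ[ℂ] A}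

theorem flatColumn_mul_star_clock : flatColumn k * star (clock k) = flatColumn k := by
  rw [flatColumn, smul_mul_assoc, Finset.sum_mul]
  congr 1
  refine Finset.sum_congr rfl fun j _ => ?_
  rw [star_clock]
  ext a b
  rw [Matrix.mul_diagonal, Matrix.single_apply]
  split_ifs with h
  · rw [← h.2]; simp
  · simp

theorem gauge_flatElt (h : IsGauge T σ) : σ (flatElt T) = T.factor 0 (clock k) * flatElt T := by
  rw [flatElt, h.map_factor, mul_assoc, flatColumn_mul_star_clock, map_mul]

theorem shift_mul_flatElt : T.factor 0 (shift k) * flatElt T = flatElt T := by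
  rw [flatElt, ← map_mul, shift_mul_flatColumn]

variable [PartialOrder A] [StarOrderedRing A] {φ ψ : A →ₚ[ℂ] ℂ}

/-- The shift of the first factor fixes the flat column, so `ψ` takes the value `1` on it, whereas
`σ` multiplies it by `ω ≠ 1`. -/
theorem IsVacuum.exists_flatVectorState_ne (h : IsVacuum T σ φ) (hk : 1 < k)
    (hψ : ∀ x, ψ x = φ (star (flatElt T) * x * flatElt T)) : ∃ x, ψ (σ x) ≠ ψ x := by
  have h1 : ψ (T.factor 0 (shift k)) = 1 := by
    rw [hψ, mul_assoc, shift_mul_flatElt, star_flatElt_mul, h.isProduct.map_factor (by simp)]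
    simp
  refine ⟨T.factor 0 (shift k), ?_⟩
  rw [gauge_shift h.gauge.map_factor, map_smul, h1, smul_eq_mul, mul_one]
  exact (isPrimitiveRoot_rootOfUnity k).ne_one hk

/-- `σ` multiplies the flat column on the left by the clock `v` of the first factor. With the
invariance of `φ`, this makes `ψ` the vector state of `v Ω_ψ` for `π_ψ ∘ σ`. -/
theorem IsVacuum.exists_flatVectorState_implements (h : IsVacuum T σ φ)
    (hψ : ∀ x, ψ x = φ (star (flatElt T) * x * flatElt T)) : ∃ W, Implements ψ W σ := by
  set v := T.factor 0 (clock k)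
  have hv : star v * v = 1 := by rw [← map_star, ← map_mul, star_clock_mul, map_one]
  obtain ⟨W, hW, -⟩ := exists_implements (f := ψ) (σ : A →⋆ₐ[ℂ] A)
    (ψ.gnsStarAlgHom v (cyclicVector ψ)) (fun x => by
      change ψ x = inner ℂ _ (ψ.gnsStarAlgHom (σ x) _)
      rw [← gns_mul_apply, inner_gns_gns, hψ, hψ, ← h.invariant]
      congr 1
      rw [map_mul, map_mul, map_star, gauge_flatElt h.gauge, star_mul]
      simp only [mul_assoc, v]) (by
      have : (fun x => ψ.gnsStarAlgHom ((σ : A →⋆ₐ[ℂ] A) x)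
          (ψ.gnsStarAlgHom v (cyclicVector ψ))) =
          (fun x => ψ.gnsStarAlgHom x (cyclicVector ψ)) ∘ fun x => σ x * v := by
        ext x
        exact (gns_mul_apply ψ (σ x) v _).symm
      rw [DenseRange, this, Function.Surjective.range_comp]
      · exact denseRange_gns ψ
      · intro y
        refine ⟨σ.symm (y * star v), ?_⟩
        change σ (σ.symm (y * star v)) * v = y
        rw [StarAlgEquiv.apply_symm_apply, mul_assoc, hv, mul_one])
  exact ⟨W, hW⟩

theorem IsVacuum.isPureState_restrict [Nontrivial A] (h : IsVacuum T σ φ) {γ : A →⋆ₐ[ℂ] A}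
    (hγ : Set.range γ = {x | σ x = x}) :
    IsPureState (φ.toLinearMap ∘ₗ γ.range.subtype.toAlgHom.toLinearMap) :=
  h.excised.isPureState_restrict γ (T.norm_map_eq γ) fun n => by
    obtain ⟨x, hx⟩ := exists_of_fixed hγ (gauge_vacProj h.gauge n)
    exact ⟨x, hx⟩

end FlatVectorState

/-! ### Paths of unitaries and asymptotic innerness -/

section Paths

variable {A : Type*} [CStarAlgebra A]

theorem commute_star_of_unitary {c : unitary A} {y : A} (h : Commute (c : A) y) :
    Commute (star (c : A)) y := by
  have h1 := Unitary.star_mul_self_of_mem c.2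
  have h2 := Unitary.mul_star_self_of_mem c.2
  calc star (c : A) * y = star (c : A) * (y * c) * star (c : A) := by
        rw [mul_assoc, mul_assoc y, h2, mul_one]
    _ = y * star (c : A) := by rw [← h.eq, ← mul_assoc, h1, one_mul]

theorem conj_eq_of_commute (c : unitary A) {y : A} (h : Commute (c : A) y) :
    (c : A) * y * star (c : A) = y := by
  rw [h.eq, mul_assoc, Unitary.mul_star_self_of_mem c.2, mul_one]

/-- A unitary of finite order is connected to `1` by a path of unitaries in its bicommutant. -/
theorem exists_unitary_path {c : unitary A} {k : ℕ} (hk : k ≠ 0) (hc : c ^ k = 1) :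
    ∃ a : ℝ → unitary A, Continuous a ∧ a 0 = 1 ∧ a 1 = c ∧
      ∀ s (y : A), Commute (c : A) y → Commute (a s : A) y := by
  have hck : (c : A) ^ k = 1 := by rw [← SubmonoidClass.coe_pow, hc]; rfl
  -- The spectrum consists of `k`-th roots of unity. Being finite, it makes `arg` continuous on it
  -- even if it meets the branch cut, so `c = exp (i arg c)` without a spectral gap.
  have hfin : (spectrum ℂ (c : A)).Finite := by
    nontriviality A
    refine (Polynomial.nthRoots k (1 : ℂ)).toFinset.finite_toSet.subset fun z hz => ?_
    have h1 := spectrum.pow_mem_pow (c : A) k hz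
    rw [hck, spectrum.one_eq] at h1
    simpa [Polynomial.mem_nthRoots (Nat.pos_of_ne_zero hk)] using h1
  have hcont : ContinuousOn Complex.arg (spectrum ℂ (c : A)) := hfin.continuousOn _
  have hexp : selfAdjoint.expUnitary (Unitary.argSelfAdjoint c) = c := by
    ext
    rw [selfAdjoint.expUnitary_coe, Unitary.argSelfAdjoint_coe,
      ← CFC.exp_eq_normedSpace_exp (𝕜 := ℂ), ← cfc_comp_smul .., ← cfc_comp' ..]
    conv_rhs => rw [← cfc_id' ℂ (c : A)]
    refine cfc_congr fun y hy => ?_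
    have hy₁ : ‖y‖ = 1 := spectrum.norm_eq_one_of_unitary c.2 hy
    have : Complex.I * y.arg = Complex.log y :=
      Complex.ext (by simp [Complex.log_re, hy₁]) (by simp [Complex.log_im])
    simpa [← Complex.exp_eq_exp_ℂ, this] using
      Complex.exp_log (by rintro rfl; simp at hy₁)
  refine ⟨fun s => selfAdjoint.expUnitary (s • Unitary.argSelfAdjoint c), ?_, ?_, ?_, ?_⟩
  · exact selfAdjoint.continuous_expUnitary.comp (by fun_prop)
  · simp
  · simp [hexp]
  · intro s y hy
    rw [selfAdjoint.expUnitary_coe]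
    refine Commute.exp_left (Commute.smul_left ?_ _)
    change Commute (s • cfc (Complex.arg · : ℂ → ℂ) (c : A)) y
    exact (Commute.cfc hy (commute_star_of_unitary hy) _).smul_left s

/-- The ordered product `b 0 τ * b 1 τ * ⋯ * b (N - 1) τ`. -/
def pathProd (b : ℕ → ℝ → unitary A) (N : ℕ) (τ : ℝ) : unitary A :=
  ((List.range N).map fun i => b i τ).prod

theorem pathProd_succ (b : ℕ → ℝ → unitary A) (N : ℕ) (τ : ℝ) :
    pathProd b (N + 1) τ = pathProd b N τ * b N τ := by
  simp [pathProd, List.range_succ]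

theorem continuous_pathProd {b : ℕ → ℝ → unitary A} (hb : ∀ i, Continuous (b i)) (N : ℕ) :
    Continuous (pathProd b N) := by
  induction N with
  | zero => exact continuous_const
  | succ N ih =>
    have : pathProd b (N + 1) = fun τ => pathProd b N τ * b N τ := funext (pathProd_succ b N)
    rw [this]
    exact ih.mul (hb N)

theorem pathProd_eq {b : ℕ → ℝ → unitary A} (hb1 : ∀ (i : ℕ) (τ : ℝ), τ ≤ i → b i τ = 1) {N : ℕ} {τ : ℝ}
    (h : τ ≤ N) : pathProd b N τ = pathProd b ⌈τ⌉₊ τ := by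
  have hN : ⌈τ⌉₊ ≤ N := Nat.ceil_le.mpr h
  induction N, hN using Nat.le_induction with
  | base => rfl
  | succ M hM ih =>
    have hM' := Nat.ceil_le.mp hM
    rw [pathProd_succ, hb1 M τ hM', mul_one, ih hM']

/-- Near a given `τ` the product may be taken of one fixed length, because the additional factors
are still equal to `1`. -/
theorem continuous_pathProd_ceil {b : ℕ → ℝ → unitary A} (hb : ∀ i, Continuous (b i))
    (hb1 : ∀ (i : ℕ) (τ : ℝ), τ ≤ i → b i τ = 1) : Continuous fun τ => pathProd b ⌈τ⌉₊ τ := by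
  rw [continuous_iff_continuousAt]
  intro τ
  obtain ⟨N, hN⟩ := exists_nat_gt τ
  refine (continuous_pathProd hb N).continuousAt.congr ?_
  filter_upwards [gt_mem_nhds hN] with τ' h
  exact pathProd_eq hb1 h.le

/-- A criterion for an endomorphism of an infinite tensor power to be asymptotically inner. -/
theorem isAsymptoticallyInner_of_pathProd {B : Type*} [Ring B] [StarRing B] [Algebra ℂ B]
    (T : InfTensorPower B A) {γ : A →⋆ₐ[ℂ] A} {b : ℕ → ℝ → unitary A}
    (hb : ∀ i, Continuous (b i)) (hb1 : ∀ (i : ℕ) (τ : ℝ), τ ≤ i → b i τ = 1)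
    (h : ∀ n x, Tendsto (fun τ => (pathProd b ⌈τ⌉₊ τ : A) * T.factor n x *
      star (pathProd b ⌈τ⌉₊ τ : A)) atTop (𝓝 (γ (T.factor n x)))) :
    IsAsymptoticallyInner γ := by
  have hall : ∀ x, Tendsto (fun τ => (pathProd b ⌈τ⌉₊ τ : A) * x *
      star (pathProd b ⌈τ⌉₊ τ : A)) atTop (𝓝 (γ x)) := by
    intro x
    refine T.factor_induction (P := fun x => Tendsto (fun τ => (pathProd b ⌈τ⌉₊ τ : A) * x *
      star (pathProd b ⌈τ⌉₊ τ : A)) atTop (𝓝 (γ x))) ?_ h ?_ ?_ ?_ x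
    · refine isClosed_setOf_tendsto_of_lipschitz (K := 1) (fun τ => ?_) (continuous_starAlgHom γ)
      have := NonUnitalStarAlgHom.norm_apply_le
        ((Unitary.conjStarAlgAut ℂ A (pathProd b ⌈τ⌉₊ τ) : A ≃⋆ₐ[ℂ] A) : A →⋆ₐ[ℂ] A)
      refine LipschitzWith.of_dist_le_mul fun x y => ?_
      rw [dist_eq_norm, dist_eq_norm, NNReal.coe_one, one_mul, ← sub_mul, ← mul_sub]
      exact this (x - y)
    · intro c
      rw [AlgHomClass.commutes]
      refine tendsto_const_nhds.congr fun τ => ?_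
      exact (conj_eq_of_commute _ (Algebra.commute_algebraMap_right c _)).symm
    · intro x y hx hy
      rw [map_add]
      refine (hx.add hy).congr fun τ => ?_
      rw [mul_add, add_mul]
    · intro x y hx hy
      rw [map_mul]
      refine (hx.mul hy).congr fun τ => ?_
      have := Unitary.star_mul_self_of_mem (pathProd b ⌈τ⌉₊ τ).2
      simp only [mul_assoc]
      rw [← mul_assoc (star _) _ (y * _), this, one_mul]
  -- The substitution `τ = t / (1 - t)` carries `[0, 1)` onto `[0, ∞)`.
  refine ⟨fun t => pathProd b ⌈t * (1 - t)⁻¹⌉₊ (t * (1 - t)⁻¹), ?_, ?_, fun x => ?_⟩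
  · refine (continuous_pathProd_ceil hb hb1).comp_continuousOn (f := fun t : ℝ => t * (1 - t)⁻¹) ?_
    refine continuousOn_id.mul (ContinuousOn.inv₀ (by fun_prop) fun t ht => ?_)
    exact (sub_pos.mpr ht.2).ne'
  · simp [pathProd]
  · refine (hall x).comp (Tendsto.pos_mul_atTop (C := 1) one_pos ?_ ?_)
    · exact tendsto_id.mono_left nhdsWithin_le_nhds
    · refine tendsto_inv_nhdsGT_zero.comp (tendsto_nhdsWithin_iff.mpr ⟨?_, ?_⟩)
      · have : Tendsto (fun t : ℝ => 1 - t) (𝓝 1) (𝓝 (1 - 1)) := by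
          exact (by fun_prop : Continuous fun t : ℝ => 1 - t).tendsto 1
        rw [sub_self] at this
        exact this.mono_left nhdsWithin_le_nhds
      · filter_upwards [self_mem_nhdsWithin] with t ht
        exact sub_pos.mpr (Set.mem_Iio.mp ht)

theorem isAsymptoticallyInner_tensor (S : InfTensorPower A A) {γ γS : A →⋆ₐ[ℂ] A}
    (hγ : IsAsymptoticallyInner γ) (hS : ∀ n x, γS (S.factor n x) = S.factor n (γ x)) :
    IsAsymptoticallyInner γS := by
  obtain ⟨u, hu, hu0, hux⟩ := hγ
  -- The path in the `i`-th factor rests at `1` until time `i` and then traverses `[0, 1)`, so only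
  -- finitely many factors have moved at any time.
  let r : ℕ → ℝ → ℝ := fun i τ => max 0 (τ - i)
  let θ : ℕ → ℝ → ℝ := fun i τ => 1 - (1 + r i τ)⁻¹
  have hr0 : ∀ i τ, 0 ≤ r i τ := fun i τ => le_max_left _ _
  have hθ : ∀ i τ, θ i τ ∈ Set.Ico (0 : ℝ) 1 := fun i τ => by
    have := hr0 i τ
    refine ⟨?_, ?_⟩
    · have : (1 + r i τ)⁻¹ ≤ 1 := inv_le_one_of_one_le₀ (by linarith)
      exact sub_nonneg.mpr this
    · have : 0 < (1 + r i τ)⁻¹ := by positivity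
      exact sub_lt_self _ this
  have hrc : ∀ i, Continuous (r i) := fun i => by fun_prop
  have hθc : ∀ i, Continuous (θ i) := fun i =>
    continuous_const.sub (Continuous.inv₀ (by fun_prop) fun τ => by have := hr0 i τ; positivity)
  let b : ℕ → ℝ → unitary A := fun i τ => ⟨S.factor i (u (θ i τ)), Unitary.map_mem (S.factor i) (u (θ i τ)).2⟩
  have hbval : ∀ i τ, (b i τ : A) = S.factor i (u (θ i τ)) := fun i τ => rfl
  have hb : ∀ i, Continuous (b i) := by
    intro i
    rw [continuous_induced_rng]
    exact (continuous_starAlgHom (S.factor i)).comp (continuous_subtype_val.comp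
      (hu.comp_continuous (hθc i) (hθ i)))
  have hb1 : ∀ (i : ℕ) (τ : ℝ), τ ≤ i → b i τ = 1 := by
    intro i τ h
    have : θ i τ = 0 := by simp [θ, r, h]
    refine Subtype.ext ?_
    rw [hbval, this, hu0]
    exact map_one _
  refine isAsymptoticallyInner_of_pathProd S hb hb1 fun n x => ?_
  have hcomm : ∀ N τ y, N ≤ n → Commute (pathProd b N τ : A) (S.factor n y) := by
    intro N τ y
    induction N with
    | zero => intro _; exact Commute.one_left _
    | succ N ih =>
      intro h
      rw [pathProd_succ]
      exact (ih (by omega)).mul_left (S.commute N n (by omega) _ _)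
  have hconj : ∀ N τ, n + 1 ≤ N → (pathProd b N τ : A) * S.factor n x * star (pathProd b N τ : A) =
      S.factor n ((u (θ n τ) : A) * x * star (u (θ n τ) : A)) := by
    intro N τ h
    induction N, h using Nat.le_induction with
    | base =>
      rw [pathProd_succ]
      have := conj_eq_of_commute _ (hcomm n τ ((u (θ n τ) : A) * x * star (u (θ n τ) : A)) le_rfl)
      rw [map_mul, map_mul, map_star] at this ⊢
      simpa only [Submonoid.coe_mul, hbval, star_mul, mul_assoc] using this
    | succ N h ih =>
      rw [← ih, pathProd_succ]
      have := conj_eq_of_commute (b N τ) (y := S.factor n x) (S.commute N n (by omega) _ _)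
      conv_rhs => rw [← this]
      simp only [Submonoid.coe_mul, star_mul, mul_assoc]
  rw [hS]
  have h1 : Tendsto (θ n) atTop (𝓝[<] 1) := by
    refine tendsto_nhdsWithin_iff.mpr ⟨?_, Eventually.of_forall fun τ => (hθ n τ).2⟩
    have : Tendsto (fun τ => 1 + r n τ) atTop atTop :=
      tendsto_atTop_mono (fun τ => le_add_of_nonneg_of_le zero_le_one (le_max_right 0 (τ - n)))
        (tendsto_atTop_add_const_right _ _ tendsto_id)
    have := (tendsto_inv_atTop_zero.comp this).const_sub 1
    rwa [sub_zero] at this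
  refine (((continuous_starAlgHom (S.factor n)).tendsto _).comp ((hux x).comp h1)).congr' ?_
  filter_upwards [eventually_ge_atTop ((n + 1 : ℕ) : ℝ)] with τ hτ
  exact (hconj ⌈τ⌉₊ τ (Nat.cast_le.mp (hτ.trans (Nat.le_ceil τ)))).symm

end Paths

/-! ### Powers of the shift and their commutation with the clock -/

section ShiftPow

variable {k : ℕ} [NeZero k]

theorem shift_pow_mul_single (m : ℕ) (a b : Fin k) :
    shift k ^ m * Matrix.single a b 1 = Matrix.single (a + m • (1 : Fin k)) b 1 := by
  induction m with
  | zero => simp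
  | succ m ih => rw [pow_succ', mul_assoc, ih, shift_mul_single, succ_nsmul, add_assoc]

theorem shift_pow : shift k ^ k = 1 := by
  have h : (k • (1 : Fin k)) = 0 := by
    have := card_nsmul_eq_zero (x := (1 : Fin k))
    rwa [Fintype.card_fin] at this
  have h2 := sum_map_single (AlgHom.id ℂ (Matrix (Fin k) (Fin k) ℂ))
  rw [← mul_one (shift k ^ k), ← h2, Finset.mul_sum]
  refine Finset.sum_congr rfl fun p _ => ?_
  have := shift_pow_mul_single k p p
  rwa [h, add_zero] at this

theorem star_shift_pow : star (shift k) ^ k = 1 := by rw [← star_pow, shift_pow, star_one]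

theorem star_shift_pow_val_add_one (j : Fin k) :
    star (shift k) ^ ((j + 1 : Fin k) : ℕ) = star (shift k) * star (shift k) ^ (j : ℕ) := by
  rw [← pow_succ', Fin.val_add, Fin.val_one', Nat.add_mod_mod, ← pow_eq_pow_mod _ star_shift_pow]

theorem shift_mul_single_self (j : Fin k) :
    shift k * Matrix.single j j 1 = Matrix.single (j + 1) (j + 1) 1 * shift k := by
  rw [shift_mul_single]
  ext a b
  rw [Matrix.mul_apply, Finset.sum_eq_single (j + 1)]
  · simp only [Matrix.single_apply, shift, add_left_inj]
    split_ifs <;> simp_all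
  · intro c _ hc
    simp [Ne.symm hc]
  · simp

theorem star_shift_mul_clock :
    star (shift k) * clock k = rootOfUnity k • (clock k * star (shift k)) := by
  have h := congrArg (fun x => star (shift k) * x * star (shift k)) (clock_mul_shift k)
  simp only [mul_smul_comm, smul_mul_assoc] at h
  rwa [← mul_assoc, mul_assoc _ _ (star (shift k)), shift_mul_star, mul_one, ← mul_assoc,
    star_shift_mul, one_mul] at h

theorem star_shift_pow_mul_clock (j : ℕ) :
    star (shift k) ^ j * clock k = rootOfUnity k ^ j • (clock k * star (shift k) ^ j) := by
  induction j with
  | zero => simp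
  | succ j ih =>
    rw [pow_succ, mul_assoc, star_shift_mul_clock, mul_smul_comm, ← mul_assoc, ih, smul_mul_assoc,
      smul_smul, mul_assoc, ← pow_succ, pow_succ' (rootOfUnity k)]

end ShiftPow

/-! ### Controlled shifts and their infinite product -/

section Controlled

variable {k : ℕ} [NeZero k] {A : Type*} [CStarAlgebra A]

/-- The embedding `g ↦ ∑_j e_{jj} ⊗ g_j` into the tensor factors `i` and `i + 1`. -/
def ctrl (T : UHF k A) (i : ℕ) : (Fin k → Matrix (Fin k) (Fin k) ℂ) →⋆ₐ[ℂ] A where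
  toFun g := ∑ j, T.factor i (Matrix.single j j 1) * T.factor (i + 1) (g j)
  map_one' := by
    simp only [Pi.one_apply, map_one, mul_one]
    exact sum_map_single ((T.factor i).toAlgHom)
  map_mul' g g' := by
    rw [Finset.sum_mul]
    refine Finset.sum_congr rfl fun j _ => ?_
    rw [Finset.mul_sum, Finset.sum_eq_single j]
    · rw [Pi.mul_apply, map_mul, mul_assoc, ← mul_assoc (T.factor (i + 1) (g j)),
        (T.commute (i + 1) i (by omega) (g j) _).eq]
      simp only [← mul_assoc]
      rw [← map_mul]
      simp
    · intro l _ hl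
      rw [mul_assoc, ← mul_assoc (T.factor (i + 1) (g j)),
        (T.commute (i + 1) i (by omega) (g j) _).eq]
      simp only [← mul_assoc]
      rw [← map_mul]
      simp [Ne.symm hl]
    · simp
  map_zero' := by simp
  map_add' g g' := by simp [mul_add, Finset.sum_add_distrib]
  commutes' r := by
    have : ∀ j : Fin k, T.factor (i + 1) (algebraMap ℂ (Fin k → Matrix (Fin k) (Fin k) ℂ) r j) =
        algebraMap ℂ A r := fun j => AlgHomClass.commutes (T.factor (i + 1)) r
    simp only [this, ← Finset.sum_mul]
    rw [show ∑ j, T.factor i (Matrix.single j j 1) = 1 from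
      sum_map_single ((T.factor i).toAlgHom), one_mul]
  map_star' g := by
    rw [star_sum]
    refine Finset.sum_congr rfl fun j _ => ?_
    rw [star_mul, star_factor_single, Pi.star_apply, map_star,
      ← map_star, (T.commute (i + 1) i (by omega) _ _).eq]

variable (T : UHF k A)

theorem ctrl_apply (i : ℕ) (g : Fin k → Matrix (Fin k) (Fin k) ℂ) :
    ctrl T i g = ∑ j, T.factor i (Matrix.single j j 1) * T.factor (i + 1) (g j) := rfl

theorem ctrl_const (i : ℕ) (x : Matrix (Fin k) (Fin k) ℂ) :
    ctrl T i (fun _ => x) = T.factor (i + 1) x := by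
  rw [ctrl_apply, ← Finset.sum_mul, show ∑ j, T.factor i (Matrix.single j j 1) = 1 from
      sum_map_single ((T.factor i).toAlgHom), one_mul]

theorem ctrl_clock (i : ℕ) :
    ctrl T i (fun j => rootOfUnity k ^ (j : ℕ) • 1) = T.factor i (clock k) := by
  have h : clock k = ∑ j : Fin k, Matrix.single j j (rootOfUnity k ^ (j : ℕ)) := by
    rw [clock_eq]
    ext a b
    rw [Matrix.sum_apply, Matrix.diagonal_apply]
    simp only [Matrix.single_apply]
    split_ifs with hab
    · subst hab; simp
    · exact (Finset.sum_eq_zero fun j _ => if_neg fun h => hab (h.1.symm.trans h.2)).symm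
  rw [ctrl_apply, h, map_sum]
  refine Finset.sum_congr rfl fun j _ => ?_
  rw [map_smul, map_one, mul_smul_comm, mul_one, ← map_smul, Matrix.smul_single, smul_eq_mul,
    mul_one]

theorem commute_ctrl {i n : ℕ} (h : n ≠ i) (h' : n ≠ i + 1)
    (g : Fin k → Matrix (Fin k) (Fin k) ℂ) (x : Matrix (Fin k) (Fin k) ℂ) :
    Commute (ctrl T i g) (T.factor n x) := by
  rw [ctrl_apply]
  exact Commute.sum_left _ _ _ fun j _ =>
    (T.commute i n h.symm _ _).mul_left (T.commute (i + 1) n h'.symm _ _)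

/-- The unitary `c_i = ∑_j e_{jj} ⊗ w^{-j}` in the tensor factors `i` and `i + 1`. -/
def ctrlUnitary (i : ℕ) : unitary A :=
  ⟨ctrl T i fun j => star (shift k) ^ (j : ℕ), Unitary.map_mem (ctrl T i) ⟨by
    ext1 j
    simp only [Pi.mul_apply, Pi.star_apply, Pi.one_apply, star_pow, star_star]
    rw [← (Commute.pow_pow (show Commute (star (shift k)) (shift k) from
      (star_shift_mul k).trans (shift_mul_star k).symm) _ _).eq, ← (show Commute (star (shift k))
        (shift k) from (star_shift_mul k).trans (shift_mul_star k).symm).mul_pow,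
        star_shift_mul, one_pow], by
    ext1 j
    simp only [Pi.mul_apply, Pi.star_apply, Pi.one_apply, star_pow, star_star]
    rw [← (show Commute (star (shift k))
        (shift k) from (star_shift_mul k).trans (shift_mul_star k).symm).mul_pow,
        star_shift_mul, one_pow]⟩⟩

theorem coe_ctrlUnitary (i : ℕ) :
    (ctrlUnitary T i : A) = ctrl T i fun j => star (shift k) ^ (j : ℕ) := rfl

theorem ctrlUnitary_pow (i : ℕ) : ctrlUnitary T i ^ k = 1 := by
  refine Subtype.ext ?_
  rw [SubmonoidClass.coe_pow, coe_ctrlUnitary, ← map_pow]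
  have : (fun j : Fin k => star (shift k) ^ (j : ℕ)) ^ k = 1 := by
    ext1 j
    rw [Pi.pow_apply, ← pow_mul, mul_comm, pow_mul, star_shift_pow, one_pow, Pi.one_apply]
  rw [this, map_one]
  rfl

/-- On the block `e_{jj}` the relation is `w^{-j} v = ω^j v w^{-j}`; the scalars `ω^j` assemble to
the clock of factor `i`. -/
theorem ctrlUnitary_mul_clock_succ (i : ℕ) :
    (ctrlUnitary T i : A) * T.factor (i + 1) (clock k) =
      T.factor i (clock k) * T.factor (i + 1) (clock k) * (ctrlUnitary T i : A) := by
  rw [coe_ctrlUnitary, ← ctrl_const, ← ctrl_clock, ← map_mul, ← map_mul, ← map_mul]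
  congr 1
  ext1 j
  simp only [Pi.mul_apply, star_shift_pow_mul_clock, smul_mul_assoc, one_mul]

theorem commute_ctrlUnitary_clock (i : ℕ) :
    Commute (ctrlUnitary T i : A) (T.factor i (clock k)) := by
  rw [coe_ctrlUnitary, ← ctrl_clock]
  refine Commute.map (f := ctrl T i) ?_
  funext j
  simp

/-- The shift carries the block `e_{jj}` to the next one, where the controlled power contains one
more `w^{-1}`. The cyclic wrap-around is harmless because `w^k = 1`. -/
theorem ctrlUnitary_mul_shift (i : ℕ) :
    (ctrlUnitary T i : A) * T.factor i (shift k) =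
      T.factor i (shift k) * T.factor (i + 1) (star (shift k)) * (ctrlUnitary T i : A) := by
  rw [coe_ctrlUnitary, ctrl_apply, Finset.sum_mul, Finset.mul_sum,
    ← Equiv.sum_comp (Equiv.addRight (1 : Fin k))]
  refine Finset.sum_congr rfl fun j _ => ?_
  simp only [Equiv.coe_addRight]
  rw [star_shift_pow_val_add_one, mul_assoc, (T.commute (i + 1) i (by omega) _ (shift k)).eq,
    ← mul_assoc, ← map_mul, ← shift_mul_single_self, map_mul, map_mul, mul_assoc, mul_assoc]
  congr 1
  rw [← mul_assoc, ← mul_assoc, (T.commute (i + 1) i (by omega) _ _).eq]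

/-- The product `c_0 c_1 ⋯ c_{N-1}`. -/
def ctrlProd (N : ℕ) : unitary A := ((List.range N).map (ctrlUnitary T)).prod

theorem ctrlProd_succ (N : ℕ) : ctrlProd T (N + 1) = ctrlProd T N * ctrlUnitary T N := by
  simp [ctrlProd, List.range_succ]

theorem commute_ctrlProd_of {N : ℕ} {y : A} (h : ∀ i < N, Commute (ctrlUnitary T i : A) y) :
    Commute (ctrlProd T N : A) y := by
  induction N with
  | zero => exact Commute.one_left _
  | succ N ih =>
    rw [ctrlProd_succ, Submonoid.coe_mul]
    exact (ih fun i hi => h i (by omega)).mul_left (h N (by omega))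

/-- A `c_N` with `N > n` involves only factors beyond the `n`-th, so conjugation of the `n`-th
factor is stationary from `N = n + 1` on. -/
theorem ctrlProd_conj {n N : ℕ} (h : n + 1 ≤ N) (x : Matrix (Fin k) (Fin k) ℂ) :
    (ctrlProd T N : A) * T.factor n x * star (ctrlProd T N : A) =
      (ctrlProd T (n + 1) : A) * T.factor n x * star (ctrlProd T (n + 1) : A) := by
  induction N, h using Nat.le_induction with
  | base => rfl
  | succ N h ih =>
    rw [← ih, ctrlProd_succ]
    have := conj_eq_of_commute (ctrlUnitary T N) (y := T.factor n x)
      (commute_ctrl T (by omega) (by omega) _ _)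
    conv_rhs => rw [← this]
    simp only [Submonoid.coe_mul, star_mul, mul_assoc]

/-- The endomorphism `γ x = lim_N Ad (c_0 ⋯ c_{N-1}) x`. -/
theorem exists_ctrlEndo [Nontrivial A] : ∃ γ : A →⋆ₐ[ℂ] A, ∀ n x, γ (T.factor n x) =
    (ctrlProd T (n + 1) : A) * T.factor n x * star (ctrlProd T (n + 1) : A) := by
  refine T.exists_hom (fun n => ((Unitary.conjStarAlgAut ℂ A (ctrlProd T (n + 1)) :
    A ≃⋆ₐ[ℂ] A) : A →⋆ₐ[ℂ] A).comp (T.factor n)) fun m n h x y => ?_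
  have key : ∀ l z, l + 1 ≤ max m n + 1 →
      ((Unitary.conjStarAlgAut ℂ A (ctrlProd T (l + 1)) : A ≃⋆ₐ[ℂ] A) : A →⋆ₐ[ℂ] A)
        (T.factor l z) = Unitary.conjStarAlgAut ℂ A (ctrlProd T (max m n + 1)) (T.factor l z) :=
    fun l z hl => (ctrlProd_conj T hl z).symm
  rw [StarAlgHom.comp_apply, StarAlgHom.comp_apply, key m x (by omega), key n y (by omega)]
  exact (T.commute m n h x y).map _

end Controlled

/-! ### The limit endomorphism: path, levels and images of generators -/

section CtrlEndo

variable {k : ℕ} [NeZero k] {A : Type*} [CStarAlgebra A] {T : UHF k A} {γ : A →⋆ₐ[ℂ] A}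

/-- `γ` is the endomorphism `lim_N Ad (c_0 ⋯ c_{N-1})`. -/
structure IsCtrlEndo (T : UHF k A) (γ : A →⋆ₐ[ℂ] A) : Prop where
  map_factor : ∀ n x, γ (T.factor n x) =
    (ctrlProd T (n + 1) : A) * T.factor n x * star (ctrlProd T (n + 1) : A)

namespace IsCtrlEndo

theorem map_factor_of_le (h : IsCtrlEndo T γ) {n N : ℕ} (hN : n + 1 ≤ N)
    (x : Matrix (Fin k) (Fin k) ℂ) :
    γ (T.factor n x) = (ctrlProd T N : A) * T.factor n x * star (ctrlProd T N : A) := by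
  rw [h.map_factor, ctrlProd_conj T hN]

theorem map_tprod (h : IsCtrlEndo T γ) (n : ℕ) (x : ℕ → Matrix (Fin k) (Fin k) ℂ) :
    γ (T.tprod n x) = (ctrlProd T n : A) * T.tprod n x * star (ctrlProd T n : A) := by
  have h1 := T.map_tprod ((Unitary.conjStarAlgAut ℂ A (ctrlProd T n) : A ≃⋆ₐ[ℂ] A) : A →⋆ₐ[ℂ] A)
    n x
  refine (T.map_tprod γ n x).trans (Eq.trans ?_ h1.symm)
  congr 1
  refine List.map_congr_left fun i hi => ?_
  exact h.map_factor_of_le (Nat.succ_le_of_lt (List.mem_range.mp hi)) _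

theorem isAsymptoticallyInner (h : IsCtrlEndo T γ) : IsAsymptoticallyInner γ := by
  choose a ha ha0 ha1 hac using fun i => exists_unitary_path (NeZero.ne k) (ctrlUnitary_pow T i)
  -- `c_i` is switched on during `[i, i + 1]`. From time `n + 1` on, `c_0, …, c_n` are complete, and
  -- the partial later ones commute with factor `n` because the paths stay in bicommutants.
  let b : ℕ → ℝ → unitary A := fun i τ => a i (max 0 (min 1 (τ - i)))
  refine isAsymptoticallyInner_of_pathProd T (b := b)
    (fun i => (ha i).comp (by fun_prop)) (fun i τ hτ => ?_) fun n x => ?_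
  · have : max 0 (min 1 (τ - i)) = 0 := max_eq_left ((min_le_right _ _).trans (by linarith))
    simp only [b, this, ha0]
  · refine tendsto_const_nhds.congr' ?_
    filter_upwards [eventually_ge_atTop ((n + 1 : ℕ) : ℝ)] with τ hτ
    have hb1 : ∀ i ≤ n, b i τ = ctrlUnitary T i := by
      intro i hi
      have : max 0 (min 1 (τ - i)) = 1 := by
        have : (1 : ℝ) ≤ τ - i := by
          have : (i : ℝ) ≤ n := Nat.cast_le.mpr hi
          push_cast at hτ
          linarith
        rw [min_eq_left this, max_eq_right zero_le_one]
      simp only [b, this, ha1]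
    have hbase : pathProd b (n + 1) τ = ctrlProd T (n + 1) := by
      rw [pathProd, ctrlProd]
      congr 1
      exact List.map_congr_left fun i hi => hb1 i (by have := List.mem_range.mp hi; omega)
    have hN : n + 1 ≤ ⌈τ⌉₊ := Nat.cast_le.mp (hτ.trans (Nat.le_ceil τ))
    generalize ⌈τ⌉₊ = N at hN
    induction N, hN using Nat.le_induction with
    | base => rw [hbase, h.map_factor]
    | succ N hN ih =>
      rw [ih, pathProd_succ]
      have := conj_eq_of_commute (b N τ) (y := T.factor n x)
        (hac N _ _ (commute_ctrl T (by omega) (by omega) _ _))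
      conv_lhs => rw [← this]
      simp only [Submonoid.coe_mul, star_mul, mul_assoc]

theorem level_mono {m n : ℕ} (h : m ≤ n) : T.level m ≤ T.level n := by
  refine StarAlgebra.adjoin_mono ?_
  exact Set.biUnion_subset_biUnion_left fun i hi => lt_of_lt_of_le hi h

theorem factor_mem_level {i n : ℕ} (h : i < n) (x : Matrix (Fin k) (Fin k) ℂ) :
    T.factor i x ∈ T.level n :=
  StarAlgebra.subset_adjoin ℂ _ (Set.mem_iUnion₂.mpr ⟨i, h, x, rfl⟩)

theorem ctrlProd_mem_level (N : ℕ) : (ctrlProd T N : A) ∈ T.level (N + 1) := by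
  induction N with
  | zero => exact one_mem _
  | succ N ih =>
    rw [ctrlProd_succ, Submonoid.coe_mul]
    refine mul_mem (level_mono (by omega) ih) ?_
    rw [coe_ctrlUnitary, ctrl_apply]
    exact sum_mem fun j _ => mul_mem (factor_mem_level (by omega) _)
      (factor_mem_level (by omega) _)

theorem map_mem_level (h : IsCtrlEndo T γ) (n : ℕ) (x : A) (hx : x ∈ T.level n) :
    γ x ∈ T.level (n + 1) := by
  have : T.level n ≤ (T.level (n + 1)).comap γ := by
    refine StarAlgebra.adjoin_le ?_
    rintro _ hy
    obtain ⟨i, hi, x, rfl⟩ := Set.mem_iUnion₂.mp hy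
    change γ _ ∈ T.level (n + 1)
    rw [h.map_factor]
    have := level_mono (T := T) (show i + 1 + 1 ≤ n + 1 by omega) (ctrlProd_mem_level (i + 1))
    exact mul_mem (mul_mem this (factor_mem_level (by omega) _)) (star_mem this)
  exact this hx

/-! ### The range of `γ` -/

theorem map_clock_zero (h : IsCtrlEndo T γ) : γ (T.factor 0 (clock k)) = T.factor 0 (clock k) := by
  rw [h.map_factor]
  exact conj_eq_of_commute _ (commute_ctrlProd_of T fun i hi => by
    obtain rfl : i = 0 := by omega
    exact commute_ctrlUnitary_clock T 0)

/-- `c_{n+1}` commutes with `v_{n+1}`, then `c_n` creates `v_n v_{n+1}`, and the earlier unitaries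
see only `v_n`, on which they act as `γ` does because `c_n` commutes with `v_n`. -/
theorem map_clock_succ (h : IsCtrlEndo T γ) (n : ℕ) :
    γ (T.factor (n + 1) (clock k)) = γ (T.factor n (clock k)) * T.factor (n + 1) (clock k) := by
  have h1 := conj_eq_of_commute _ (commute_ctrlUnitary_clock T (n + 1))
  have h2 : (ctrlUnitary T n : A) * T.factor (n + 1) (clock k) * star (ctrlUnitary T n : A) =
      T.factor n (clock k) * T.factor (n + 1) (clock k) := by
    rw [ctrlUnitary_mul_clock_succ, mul_assoc, Unitary.mul_star_self_of_mem (ctrlUnitary T n).2,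
      mul_one]
  have h3 := conj_eq_of_commute (ctrlUnitary T n) (commute_ctrlUnitary_clock T n)
  have h4 := conj_eq_of_commute (ctrlProd T n) (y := T.factor (n + 1) (clock k))
    (commute_ctrlProd_of T fun i hi => commute_ctrl T (by omega) (by omega) _ _)
  have h5 := Unitary.star_mul_self_of_mem (ctrlProd T n).2
  rw [h.map_factor, h.map_factor, ctrlProd_succ T (n + 1), ctrlProd_succ T n]
  calc _ = (ctrlProd T n : A) * ((ctrlUnitary T n : A) * ((ctrlUnitary T (n + 1) : A) *
        T.factor (n + 1) (clock k) * star (ctrlUnitary T (n + 1) : A)) *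
          star (ctrlUnitary T n : A)) * star (ctrlProd T n : A) := by
        simp only [Submonoid.coe_mul, star_mul, mul_assoc]
    _ = (ctrlProd T n : A) * (T.factor n (clock k) * T.factor (n + 1) (clock k)) *
        star (ctrlProd T n : A) := by rw [h1, h2]
    _ = (ctrlProd T n : A) * T.factor n (clock k) * star (ctrlProd T n : A) *
        ((ctrlProd T n : A) * T.factor (n + 1) (clock k) * star (ctrlProd T n : A)) := by
        simp only [mul_assoc]
        rw [← mul_assoc (star (ctrlProd T n : A)) (ctrlProd T n : A), h5, one_mul]
    _ = (ctrlProd T n : A) * ((ctrlUnitary T n : A) * T.factor n (clock k) *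
        star (ctrlUnitary T n : A)) * star (ctrlProd T n : A) *
        T.factor (n + 1) (clock k) := by rw [h4, h3]
    _ = _ := by simp only [Submonoid.coe_mul, star_mul, mul_assoc]

/-- Once `c_n` has produced `w_n w_{n+1}^{-1}`, the remaining unitaries commute with it: they touch
factor `n` at most through powers of the shift. -/
theorem map_shift (h : IsCtrlEndo T γ) (n : ℕ) :
    γ (T.factor n (shift k)) = T.factor n (shift k) * star (T.factor (n + 1) (shift k)) := by
  rw [h.map_factor, ctrlProd_succ, Submonoid.coe_mul, star_mul, mul_assoc (ctrlProd T n : A),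
    ctrlUnitary_mul_shift, ← map_star]
  have h1 : Commute (ctrlProd T n : A)
      (T.factor n (shift k) * T.factor (n + 1) (star (shift k))) := by
    refine commute_ctrlProd_of T fun i hi => Commute.mul_right ?_
      (commute_ctrl T (by omega) (by omega) _ _)
    rcases eq_or_ne n (i + 1) with rfl | hne
    · rw [coe_ctrlUnitary, ← ctrl_const]
      refine Commute.map (f := ctrl T i) ?_
      funext j
      exact ((show Commute (star (shift k)) (shift k) from
        (star_shift_mul k).trans (shift_mul_star k).symm).pow_left _).eq
    · exact commute_ctrl T (by omega) hne _ _
  have h2 := Unitary.mul_star_self_of_mem (ctrlUnitary T n).2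
  have h3 := conj_eq_of_commute _ h1
  calc _ = (ctrlProd T n : A) * (T.factor n (shift k) * T.factor (n + 1) (star (shift k)) *
        ((ctrlUnitary T n : A) * star (ctrlUnitary T n : A))) * star (ctrlProd T n : A) := by
        simp only [mul_assoc]
    _ = _ := by rw [h2, mul_one, h3]

theorem clock_mem_range (h : IsCtrlEndo T γ) (n : ℕ) : T.factor n (clock k) ∈ γ.range := by
  cases n with
  | zero => exact ⟨_, h.map_clock_zero⟩
  | succ n =>
    refine ⟨star (T.factor n (clock k)) * T.factor (n + 1) (clock k), ?_⟩
    change γ _ = _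
    rw [map_mul, h.map_clock_succ, ← mul_assoc, ← map_mul, ← map_star (T.factor n), ← map_mul,
      star_clock_mul, map_one, map_one, one_mul]

theorem shift_mul_star_shift_zero_mem_range (h : IsCtrlEndo T γ) (n : ℕ) :
    T.factor n (shift k) * star (T.factor 0 (shift k)) ∈ γ.range := by
  induction n with
  | zero =>
    rw [Unitary.mul_star_self_of_mem (factor_shift_mem_unitary 0)]
    exact one_mem _
  | succ n ih =>
    have h1 : γ (T.factor n (shift k)) ∈ γ.range := ⟨_, rfl⟩
    rw [h.map_shift] at h1
    -- The product telescopes: `(w_n w_{n+1}^{-1})^{-1} (w_n w_0^{-1}) = w_{n+1} w_0^{-1}`.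
    have := mul_mem (star_mem h1) ih
    rw [star_mul, star_star, mul_assoc, ← mul_assoc (star (T.factor n (shift k))),
      Unitary.star_mul_self_of_mem (factor_shift_mem_unitary n), one_mul] at this
    exact this

end IsCtrlEndo

end CtrlEndo

/-! ### The range of the limit endomorphism, and its implementation in `π_χ` -/

section CtrlEndoRange

variable {k : ℕ} [NeZero k] {A : Type*} [CStarAlgebra A] {T : UHF k A} {γ : A →⋆ₐ[ℂ] A}
  {σ : A ≃⋆ₐ[ℂ] A}

theorem shift_mul_clock_mul_star :
    shift k * clock k * star (shift k) = (rootOfUnity k)⁻¹ • clock k := by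
  rw [eq_inv_smul_iff₀ (rootOfUnity_ne_zero k), ← smul_mul_assoc, ← clock_mul_shift, mul_assoc,
    shift_mul_star, mul_one]

theorem eigComp_add (j : ℕ) (x y : A) :
    eigComp k σ j (x + y) = eigComp k σ j x + eigComp k σ j y := by
  simp [eigComp, Finset.sum_add_distrib]

theorem eigComp_smul (j : ℕ) (c : ℂ) (x : A) :
    eigComp k σ j (c • x) = c • eigComp k σ j x := by
  simp only [eigComp, map_smul, smul_comm _ c, Finset.smul_sum]

theorem star_mul_cancel_factor_shift (n : ℕ) (y : A) :
    star (T.factor n (shift k)) * (T.factor n (shift k) * y) = y := by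
  rw [← mul_assoc, Unitary.star_mul_self_of_mem (factor_shift_mem_unitary n), one_mul]

theorem commute_factor_shift (m n : ℕ) :
    Commute (T.factor m (shift k)) (T.factor n (shift k)) := by
  rcases eq_or_ne m n with rfl | h
  · exact Commute.refl _
  · exact T.commute m n h _ _

theorem commute_factor_shift_star (m n : ℕ) :
    Commute (T.factor m (shift k)) (star (T.factor n (shift k))) := by
  rcases eq_or_ne m n with rfl | h
  · have h := factor_shift_mem_unitary (T := T) m
    exact (Unitary.mul_star_self_of_mem h).trans (Unitary.star_mul_self_of_mem h).symm
  · rw [← map_star]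
    exact T.commute m n h _ _

namespace IsCtrlEndo

theorem gauge_map (h : IsCtrlEndo T γ) (hσ : IsGauge T σ) (a : A) : σ (γ a) = γ a := by
  have hv : ∀ n, σ (T.factor n (clock k)) = T.factor n (clock k) := fun n => by
    rw [hσ.map_factor, mul_assoc, clock_mul_star, mul_one]
  have : (σ : A →⋆ₐ[ℂ] A).comp γ = γ := T.starAlgHom_ext fun n x => by
    refine mem_of_clock_shift k (R := AlgHom.equalizer
      ((((σ : A →⋆ₐ[ℂ] A).comp γ).comp (T.factor n)).toAlgHom)
      ((γ.comp (T.factor n)).toAlgHom)) ?_ ?_ x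
    · change σ (γ (T.factor n (clock k))) = γ (T.factor n (clock k))
      induction n with
      | zero => rw [h.map_clock_zero, hv]
      | succ n ih => rw [h.map_clock_succ, map_mul, ih, hv]
    · change σ (γ (T.factor n (shift k))) = γ (T.factor n (shift k))
      rw [h.map_shift, map_mul, map_star, gauge_shift hσ.map_factor, gauge_shift hσ.map_factor,
        star_smul, star_rootOfUnity, smul_mul_smul_comm, mul_inv_cancel₀ (rootOfUnity_ne_zero k),
        one_smul]
  exact DFunLike.congr_fun this a

variable [Nontrivial A]

theorem isClosed_range (γ : A →⋆ₐ[ℂ] A) (T : UHF k A) : IsClosed (γ.range : Set A) := by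
  have := T.isClosed_range γ
  exact this

/-- The unitary `w_0` normalizes the range: among the generators involved it changes only `v_0`, and
that by a scalar. -/
theorem conj_shift_mem_range (h : IsCtrlEndo T γ) (a : A) :
    T.factor 0 (shift k) * γ a * star (T.factor 0 (shift k)) ∈ γ.range := by
  let w : unitary A := ⟨T.factor 0 (shift k), factor_shift_mem_unitary 0⟩
  let κ : A →⋆ₐ[ℂ] A := ((Unitary.conjStarAlgAut ℂ A w : A ≃⋆ₐ[ℂ] A) : A →⋆ₐ[ℂ] A)
  have hκ : ∀ y, κ y = T.factor 0 (shift k) * y * star (T.factor 0 (shift k)) := fun _ => rfl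
  have hv : ∀ n, κ (T.factor n (clock k)) ∈ γ.range := by
    intro n
    cases n with
    | zero =>
      rw [hκ, ← map_star, ← map_mul, ← map_mul, shift_mul_clock_mul_star, map_smul]
      exact SMulMemClass.smul_mem _ (h.clock_mem_range 0)
    | succ n =>
      have : κ (T.factor (n + 1) (clock k)) = _ :=
        conj_eq_of_commute w (T.commute 0 (n + 1) (by omega) _ _)
      rw [this]
      exact h.clock_mem_range _
  rw [← hκ]
  refine T.mem_of_isClosed (R := γ.range.comap (κ.comp γ)) ?_ ?_ a
  · exact (isClosed_range γ T).preimage (continuous_starAlgHom (κ.comp γ))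
  · intro n x
    refine mem_of_clock_shift k (R := γ.range.toSubalgebra.comap
      ((κ.comp γ).comp (T.factor n)).toAlgHom) ?_ ?_ x
    · change κ (γ (T.factor n (clock k))) ∈ γ.range
      induction n with
      | zero => rw [h.map_clock_zero]; exact hv 0
      | succ n ih => rw [h.map_clock_succ, map_mul]; exact mul_mem ih (hv _)
    · change κ (γ (T.factor n (shift k))) ∈ γ.range
      have h1 : κ (γ (T.factor n (shift k))) = γ (T.factor n (shift k)) := by
        refine conj_eq_of_commute w ?_
        rw [h.map_shift]
        exact (commute_factor_shift 0 n).mul_right (commute_factor_shift_star 0 (n + 1))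
      rw [h1]
      exact ⟨_, rfl⟩

/-- The closed span is a left ideal containing `1`. It is stable under the clocks, which lie in the
range, and under `w_n = (w_n w_0^{-1}) w_0`, because `w_0` moves past `γ a` by
`conj_shift_mem_range`. -/
theorem mem_closure_span (h : IsCtrlEndo T γ) (y : A) :
    y ∈ (Submodule.span ℂ {z | ∃ a, ∃ l : ℕ, z = γ a * T.factor 0 (shift k) ^ l}).topologicalClosure
    := by
  set M := Submodule.span ℂ {z | ∃ a, ∃ l : ℕ, z = γ a * T.factor 0 (shift k) ^ l}
  have hcl := M.isClosed_topologicalClosure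
  have hgen : ∀ y, (∀ a (l : ℕ), y * (γ a * T.factor 0 (shift k) ^ l) ∈ M.topologicalClosure) →
      ∀ r ∈ M.topologicalClosure, y * r ∈ M.topologicalClosure := by
    intro y hy
    have : M.topologicalClosure ≤ M.topologicalClosure.comap (LinearMap.mulLeft ℂ y) := by
      refine Submodule.topologicalClosure_minimal _ (Submodule.span_le.mpr ?_)
        (hcl.preimage (continuous_const_mul y))
      rintro _ ⟨a, l, rfl⟩
      exact hy a l
    exact this
  have key : ∀ y, ∀ r ∈ M.topologicalClosure, y * r ∈ M.topologicalClosure := by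
    intro y
    refine T.factor_induction
      (P := fun y => ∀ r ∈ M.topologicalClosure, y * r ∈ M.topologicalClosure) ?_ ?_ ?_ ?_ ?_ y
    · simp only [Set.ofPred_forall]
      exact isClosed_iInter fun r => isClosed_iInter fun _ => hcl.preimage (continuous_mul_const r)
    · intro n x
      let R : Subalgebra ℂ (Matrix (Fin k) (Fin k) ℂ) :=
        { carrier := {x | ∀ r ∈ M.topologicalClosure, T.factor n x * r ∈ M.topologicalClosure}
          mul_mem' := fun {x y} hx hy r hr => by
            rw [map_mul, mul_assoc]; exact hx _ (hy r hr)
          add_mem' := fun {x y} hx hy r hr => by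
            rw [map_add, add_mul]; exact add_mem (hx r hr) (hy r hr)
          algebraMap_mem' := fun c r hr => by
            rw [AlgHomClass.commutes, ← Algebra.smul_def]; exact Submodule.smul_mem _ _ hr }
      refine mem_of_clock_shift k (R := R) (hgen _ fun a l => ?_) (hgen _ fun a l => ?_) x
      · obtain ⟨b, hb⟩ := h.clock_mem_range n
        refine M.le_topologicalClosure (Submodule.subset_span ⟨b * a, l, ?_⟩)
        rw [map_mul, ← mul_assoc]
        exact congrArg (fun z => z * γ a * T.factor 0 (shift k) ^ l) hb.symm
      · obtain ⟨b, hb⟩ := mul_mem (h.shift_mul_star_shift_zero_mem_range n)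
          (h.conj_shift_mem_range a)
        have hb' : γ b = _ := hb
        refine M.le_topologicalClosure (Submodule.subset_span ⟨b, l + 1, ?_⟩)
        rw [hb', pow_succ']
        simp only [mul_assoc, star_mul_cancel_factor_shift]
    · intro c r hr
      rw [← Algebra.smul_def]
      exact Submodule.smul_mem _ _ hr
    · intro x y hx hy r hr
      rw [add_mul]
      exact add_mem (hx r hr) (hy r hr)
    · intro x y hx hy r hr
      rw [mul_assoc]
      exact hx _ (hy r hr)
  have h1 : (1 : A) ∈ M.topologicalClosure :=
    M.le_topologicalClosure (Submodule.subset_span ⟨1, 0, by simp⟩)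
  simpa using key y 1 h1

/-- The element has degree `l`. Its average vanishes unless `k` divides `l`, in which case the power
of the shift is `1`. -/
theorem eigComp_mem_range (h : IsCtrlEndo T γ) (hσ : IsGauge T σ) (a : A) (l : ℕ) :
    eigComp k σ 0 (γ a * T.factor 0 (shift k) ^ l) ∈ γ.range := by
  have h1 : ∀ m : ℕ, (σ ^ m) (γ a * T.factor 0 (shift k) ^ l) =
      (rootOfUnity k ^ l) ^ m • (γ a * T.factor 0 (shift k) ^ l) := by
    intro m
    have : (σ ^ m) (γ a) = γ a := by
      induction m with
      | zero => rfl
      | succ m ih => rw [pow_succ, StarAlgEquiv.mul_apply, h.gauge_map hσ, ih]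
    rw [map_mul, map_pow, this, pow_gauge_shift hσ, smul_pow, mul_smul_comm, ← pow_mul, ← pow_mul,
      mul_comm]
  simp only [eigComp, h1, zero_mul, pow_zero, inv_one, one_smul, ← Finset.sum_smul]
  by_cases hl : rootOfUnity k ^ l = 1
  · obtain ⟨d, rfl⟩ := ((isPrimitiveRoot_rootOfUnity k).pow_eq_one_iff_dvd l).mp hl
    rw [← map_pow, pow_mul (shift k), shift_pow, one_pow, map_one, mul_one]
    exact SMulMemClass.smul_mem _ (SMulMemClass.smul_mem _ ⟨a, rfl⟩)
  · rw [geom_sum_eq hl, ← pow_mul, mul_comm, pow_mul, rootOfUnity_pow, one_pow, sub_self, zero_div,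
      zero_smul, smul_zero]
    exact zero_mem _

theorem range_eq (h : IsCtrlEndo T γ) (hσ : IsGauge T σ) : Set.range γ = {x | σ x = x} := by
  refine Set.Subset.antisymm ?_ fun y hy => ?_
  · rintro _ ⟨a, rfl⟩
    exact h.gauge_map hσ a
  -- Averaging over `σ` fixes `y` and maps the dense span into the closed range of `γ`.
  · have hcl : IsClosed {r | eigComp k σ 0 r ∈ γ.range} :=
      (isClosed_range γ T).preimage (continuous_eigComp 0)
    have hsub : ∀ r ∈ Submodule.span ℂ {z | ∃ a, ∃ l : ℕ, z = γ a * T.factor 0 (shift k) ^ l},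
        eigComp k σ 0 r ∈ γ.range := by
      intro r hr
      induction hr using Submodule.span_induction with
      | mem r hr =>
        obtain ⟨a, l, rfl⟩ := hr
        exact h.eigComp_mem_range hσ a l
      | zero => simp [eigComp]
      | add x y _ _ hx hy => rw [eigComp_add]; exact add_mem hx hy
      | smul c x _ hx => rw [eigComp_smul]; exact SMulMemClass.smul_mem _ hx
    have h1 := hcl.closure_subset_iff.mpr hsub (h.mem_closure_span y)
    have h2 : eigComp k σ 0 y ∈ γ.range := h1
    rw [eigComp_zero_of_fixed hy] at h2
    exact h2

variable [PartialOrder A] [StarOrderedRing A] {χ : A →ₚ[ℂ] ℂ}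

/-- Every controlled power `w^{-j}` fixes `Ω_χ`, so the sum collapses to `∑_j e_{jj} = 1`. -/
theorem gns_ctrlUnitary (hχ : IsFlat T σ χ) (i : ℕ) :
    χ.gnsStarAlgHom (ctrlUnitary T i) (cyclicVector χ) = cyclicVector χ := by
  rw [coe_ctrlUnitary, ctrl_apply, map_sum, sum_apply]
  simp only [gns_mul_apply, hχ.gns_star_shift_pow]
  rw [← sum_apply, ← map_sum, show ∑ j, T.factor i (Matrix.single j j 1) = 1 from
    sum_map_single ((T.factor i).toAlgHom), gns_one_apply]

theorem gns_star_ctrlProd (hχ : IsFlat T σ χ) (N : ℕ) :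
    χ.gnsStarAlgHom (star (ctrlProd T N : A)) (cyclicVector χ) = cyclicVector χ := by
  have h1 : χ.gnsStarAlgHom (ctrlProd T N : A) (cyclicVector χ) = cyclicVector χ := by
    induction N with
    | zero => exact gns_one_apply χ _
    | succ N ih => rw [ctrlProd_succ, Submonoid.coe_mul, gns_mul_apply, gns_ctrlUnitary hχ, ih]
  nth_rw 1 [← h1]
  rw [← gns_mul_apply, Unitary.star_mul_self_of_mem (ctrlProd T N).2, gns_one_apply]

theorem flatState_map (h : IsCtrlEndo T γ) (hχ : IsFlat T σ χ) (x : A) : χ (γ x) = χ x := by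
  have hc := continuous_of_map_one hχ.map_one
  refine T.tprod_induction (P := fun x => χ (γ x) = χ x) ?_ ?_ ?_ ?_ x
  · exact isClosed_eq (hc.comp (continuous_starAlgHom γ)) hc
  · intro n x
    rw [h.map_tprod, ← inner_cyclicVector_gns, gns_mul_apply, gns_mul_apply,
      gns_star_ctrlProd hχ, ← star_star (ctrlProd T n : A), ← inner_gns_left,
      gns_star_ctrlProd hχ, inner_cyclicVector_gns]
  · intro x y hx hy; rw [map_add, map_add, map_add, hx, hy]
  · intro c x hx; rw [map_smul, map_smul, map_smul, hx]

theorem exists_implements (h : IsCtrlEndo T γ) (hχ : IsFlat T σ χ) : ∃ W, Implements χ W γ := by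
  have hγ := h.range_eq hχ.gauge
  obtain ⟨W, hW, -⟩ := UHFEndo.exists_implements (f := χ) γ (cyclicVector χ)
    (fun x => by rw [inner_cyclicVector_gns, h.flatState_map hχ]) (by
      refine (denseRange_gns χ).mono ?_
      rintro _ ⟨y, rfl⟩
      -- The flat projection `q` fixes `Ω_χ` and absorbs the shift. Hence `yΩ = y q Ω = b q Ω = bΩ`
      -- with `b` in the range of `γ`, and `Ω` stays cyclic.
      obtain ⟨b, hb, hyb⟩ := exists_fixed_mul_eq hχ.gauge.pow_eq_one hχ.gauge.map_factor 0
        (q := T.factor 0 (flatProj k)) (by rw [← map_mul, shift_mul_flatProj]) y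
      obtain ⟨x, rfl⟩ := exists_of_fixed hγ hb
      have hq : χ.gnsStarAlgHom (T.factor 0 (flatProj k)) (cyclicVector χ) = cyclicVector χ := by
        refine gns_fix hχ.map_one (IsStarProjection.norm_le _ ?_) ?_
        · exact IsStarProjection.map isStarProjection_flatProj (T.factor 0)
        · rw [hχ.map_factor]
          have hk : (k : ℂ) ≠ 0 := Nat.cast_ne_zero.mpr (NeZero.ne k)
          simp [flatProj, hk]
      refine ⟨x, ?_⟩
      change χ.gnsStarAlgHom (γ x) (cyclicVector χ) = χ.gnsStarAlgHom y (cyclicVector χ)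
      rw [← hq, ← gns_mul_apply, ← gns_mul_apply, hyb])
  exact ⟨W, hW⟩

end IsCtrlEndo

end CtrlEndoRange

theorem continuous_gns_apply {A : Type*} [CStarAlgebra A] [PartialOrder A] [StarOrderedRing A]
    (f : A →ₚ[ℂ] ℂ) (ζ : f.GNS) : Continuous fun x => f.gnsStarAlgHom x ζ :=
  ((ContinuousLinearMap.apply ℂ f.GNS ζ).continuous).comp (continuous_starAlgHom f.gnsStarAlgHom)

/-! ### The infinite tensor power of `γ` -/

section TensorEndo

variable {k : ℕ} {A : Type*} [CStarAlgebra A] {T : UHF k A} {σ : A ≃⋆ₐ[ℂ] A}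
  {γ γS : A →⋆ₐ[ℂ] A} {S : InfTensorPower A A}

/-- `γS = γ ⊗ γ ⊗ ⋯`, where the range of `γ` is the fixed point algebra of the gauge
automorphism. -/
structure IsTensorEndo (T : UHF k A) (σ : A ≃⋆ₐ[ℂ] A) (γ : A →⋆ₐ[ℂ] A) (S : InfTensorPower A A)
    (γS : A →⋆ₐ[ℂ] A) : Prop where
  gauge : IsGauge T σ
  range_eq : Set.range γ = {x | σ x = x}
  map_factor : ∀ n x, γS (S.factor n x) = S.factor n (γ x)

namespace IsTensorEndo

theorem map_tprod (h : IsTensorEndo T σ γ S γS) (n : ℕ) (x : ℕ → A) :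
    γS (S.tprod n x) = S.tprod n fun i => γ (x i) := by
  rw [S.map_tprod, InfTensorPower.tprod]
  simp only [h.map_factor]

theorem exists_tprod (h : IsTensorEndo T σ γ S γS) {n : ℕ} {b : ℕ → A} (hb : ∀ i, σ (b i) = b i) :
    ∃ x, γS x = S.tprod n b := by
  choose x hx using fun i => exists_of_fixed h.range_eq (hb i)
  exact ⟨S.tprod n x, by rw [h.map_tprod]; simp only [hx]⟩

end IsTensorEndo

end TensorEndo

/-! ### The representation of `φ^∞` -/

section VacuumTensor

variable {k : ℕ} [NeZero k] {A : Type*} [CStarAlgebra A] [PartialOrder A] [StarOrderedRing A]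
  {T : UHF k A} {σ : A ≃⋆ₐ[ℂ] A} {γ γS : A →⋆ₐ[ℂ] A} {S : InfTensorPower A A} {φ φS : A →ₚ[ℂ] ℂ}

/-- `φS` is the infinite tensor power of the vacuum state. -/
structure IsVacuumTensor (T : UHF k A) (σ : A ≃⋆ₐ[ℂ] A) (φ : A →ₚ[ℂ] ℂ) (S : InfTensorPower A A)
    (φS : A →ₚ[ℂ] ℂ) : Prop where
  vacuum : IsVacuum T σ φ
  isProduct : S.IsProduct φS φ
  excised : Excised φS fun n => S.tprod n fun _ => vacProj T n

theorem exists_isVacuumTensor [Nontrivial A] (h : IsVacuum T σ φ) (S : InfTensorPower A A) :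
    ∃ φS, IsVacuumTensor T σ φ S φS := by
  obtain ⟨φS, h1, h2⟩ := S.exists_product_of_excised (isProjSeq_vacProj T) h.excised
  exact ⟨φS, h, h1, h2⟩

/-- The elements `e_{s(0) 0} ⊗ ⋯ ⊗ e_{s(n-1) 0}` of the tensor power. -/
def columnTensor (T : UHF k A) (S : InfTensorPower A A) (n : ℕ) (s : ℕ → Fin k) : A :=
  S.tprod n fun i => T.factor 0 (Matrix.single (s i) 0 1)

/-- An upper bound for the support of `s`. -/
def suppBound (s : ℕ →₀ Fin k) : ℕ := s.support.sup Nat.succ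

theorem apply_eq_zero_of_suppBound_le (s : ℕ →₀ Fin k) {i : ℕ} (h : suppBound s ≤ i) : s i = 0 := by
  by_contra hi
  have := Finset.le_sup (f := Nat.succ) (Finsupp.mem_support_iff.mpr hi)
  exact absurd (this.trans h) (by omega)

/-- The vectors `(e_{s(0) 0} ⊗ e_{s(1) 0} ⊗ ⋯) Ω` for finitely supported `s`. -/
def vacTensorVector (T : UHF k A) (S : InfTensorPower A A) (φS : A →ₚ[ℂ] ℂ) (s : ℕ →₀ Fin k) :
    φS.GNS :=
  φS.gnsStarAlgHom (columnTensor T S (suppBound s) s) (cyclicVector φS)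

namespace IsVacuumTensor

theorem map_factor (h : IsVacuumTensor T σ φ S φS) (n : ℕ) (x : A) : φS (S.factor n x) = φ x :=
  h.isProduct.map_factor h.vacuum.excised.map_one n x

theorem isStarProjection_factor_single (n : ℕ) :
    IsStarProjection (S.factor n (T.factor 0 (Matrix.single 0 0 1))) :=
  IsStarProjection.map (IsStarProjection.map (isStarProjection_single 0) (T.factor 0)) (S.factor n)

theorem gns_factor_single (h : IsVacuumTensor T σ φ S φS) (n : ℕ) :
    φS.gnsStarAlgHom (S.factor n (T.factor 0 (Matrix.single 0 0 1))) (cyclicVector φS) =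
      cyclicVector φS := by
  refine gns_fix h.excised.map_one
    (IsStarProjection.norm_le _ (isStarProjection_factor_single n)) ?_
  rw [h.map_factor, h.vacuum.isProduct.map_factor (by simp)]
  simp

theorem gns_tprod_single (h : IsVacuumTensor T σ φ S φS) (n : ℕ) :
    φS.gnsStarAlgHom (S.tprod n fun _ => T.factor 0 (Matrix.single 0 0 1)) (cyclicVector φS) =
      cyclicVector φS := by
  induction n with
  | zero => rw [S.tprod_zero, gns_one_apply]
  | succ n ih => rw [S.tprod_succ, gns_mul_apply, h.gns_factor_single, ih]

theorem star_columnTensor_mul (n : ℕ) (s : ℕ → Fin k) :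
    star (columnTensor T S n s) * columnTensor T S n s =
      S.tprod n fun _ => T.factor 0 (Matrix.single 0 0 1) := by
  rw [columnTensor, S.star_tprod, S.tprod_mul]
  refine S.tprod_congr fun i _ => ?_
  rw [Pi.mul_apply, Pi.star_apply, star_factor_single, ← map_mul]
  simp

/-- Outside the support of `s` the extra entries are `e_{00}`, which fix `Ω`; so different vectors
can be compared at a common length. -/
theorem gns_columnTensor (h : IsVacuumTensor T σ φ S φS) (s : ℕ →₀ Fin k) {n : ℕ}
    (hn : suppBound s ≤ n) :
    φS.gnsStarAlgHom (columnTensor T S n s) (cyclicVector φS) = vacTensorVector T S φS s := by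
  induction n, hn using Nat.le_induction with
  | base => rfl
  | succ n hn ih =>
    rw [columnTensor, S.tprod_succ, gns_mul_apply, apply_eq_zero_of_suppBound_le s hn,
      h.gns_factor_single]
    exact ih

theorem norm_vacTensorVector (h : IsVacuumTensor T σ φ S φS) (s : ℕ →₀ Fin k) :
    ‖vacTensorVector T S φS s‖ = 1 := by
  have h1 : inner ℂ (vacTensorVector T S φS s) (vacTensorVector T S φS s) = (1 : ℂ) := by
    rw [vacTensorVector, inner_gns_gns, star_columnTensor_mul, h.isProduct.map_tprod]
    refine Finset.prod_eq_one fun i _ => ?_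
    rw [h.vacuum.isProduct.map_factor (by simp)]
    simp
  rw [inner_self_eq_norm_sq_to_K] at h1
  have h2 : ‖vacTensorVector T S φS s‖ ^ 2 = 1 := Complex.ofReal_injective (by push_cast; exact h1)
  nlinarith [norm_nonneg (vacTensorVector T S φS s)]

theorem vacTensorVector_eigen (h : IsVacuumTensor T σ φ S φS) (hγ : IsTensorEndo T σ γ S γS)
    (R : φS.GNS →L[ℂ] φS.GNS) (hR : ∀ x, Commute R ((φS.gnsStarAlgHom.comp γS) x))
    (s : ℕ →₀ Fin k) :
    ∃ c : ℂ, R (vacTensorVector T S φS s) = c • vacTensorVector T S φS s := by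
  refine h.excised.exists_eq_smul _ ?_ R ?_
  · rw [star_columnTensor_mul, h.gns_tprod_single]
  -- Beyond the support, `X p_n X*` is an elementary tensor with entries fixed by `σ`, hence in the
  -- range of `γS`.
  · filter_upwards [eventually_ge_atTop (suppBound s)] with n hn
    rw [columnTensor, ← S.tprod_extend hn, S.star_tprod, S.tprod_mul, S.tprod_mul]
    obtain ⟨x, hx⟩ := hγ.exists_tprod (n := n) (b := ((fun i => if i < suppBound s then
        T.factor 0 (Matrix.single (s i) 0 1) else 1) * fun _ => vacProj T n) *
        star fun i => if i < suppBound s then T.factor 0 (Matrix.single (s i) 0 1) else 1)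
      fun i => by
        simp only [Pi.mul_apply, Pi.star_apply]
        split_ifs
        · rw [star_factor_single, map_mul, map_mul, gauge_vacProj h.vacuum.gauge,
            gauge_single hγ.gauge.map_factor, gauge_single hγ.gauge.map_factor, smul_mul_assoc,
            smul_mul_smul_comm]
          simp [rootOfUnity_ne_zero]
        · rw [star_one, one_mul, mul_one, gauge_vacProj h.vacuum.gauge]
    rw [← hx]
    exact hR x

/-- For elementary tensors `x` the inner product factorizes, and a position where `s` and `t` differ
contributes zero by `IsVacuum.offDiag`. -/
theorem vacTensorVector_orth (h : IsVacuumTensor T σ φ S φS) (hγ : IsTensorEndo T σ γ S γS)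
    (x : A) (s t : ℕ →₀ Fin k) (hst : s ≠ t) :
    inner ℂ ((φS.gnsStarAlgHom.comp γS) x (vacTensorVector T S φS s))
      (vacTensorVector T S φS t) = 0 := by
  refine S.tprod_induction (P := fun x => inner ℂ ((φS.gnsStarAlgHom.comp γS) x
    (vacTensorVector T S φS s)) (vacTensorVector T S φS t) = 0) ?_ ?_ ?_ ?_ x
  · have h1 : Continuous fun x => φS.gnsStarAlgHom (γS x) (vacTensorVector T S φS s) :=
      (continuous_gns_apply φS _).comp (continuous_starAlgHom γS)
    have h2 : Continuous fun x => inner ℂ (φS.gnsStarAlgHom (γS x) (vacTensorVector T S φS s))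
      (vacTensorVector T S φS t) := h1.inner continuous_const
    exact isClosed_singleton.preimage h2
  · intro n z
    set N := max n (max (suppBound s) (suppBound t)) with hN
    change inner ℂ (φS.gnsStarAlgHom (γS (S.tprod n z)) (vacTensorVector T S φS s))
      (vacTensorVector T S φS t) = 0
    rw [← h.gns_columnTensor s (n := N) (by omega), ← h.gns_columnTensor t (n := N) (by omega),
      ← S.tprod_extend (show n ≤ N by omega), hγ.map_tprod, ← gns_mul_apply, inner_gns_gns,
      columnTensor, columnTensor, S.tprod_mul, S.star_tprod, S.tprod_mul, h.isProduct.map_tprod]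
    obtain ⟨i, hi⟩ : ∃ i, s i ≠ t i := by
      by_contra! h'
      exact hst (Finsupp.ext h')
    have hiN : i < N := by
      by_contra! h'
      exact hi ((apply_eq_zero_of_suppBound_le s (by omega)).trans
        (apply_eq_zero_of_suppBound_le t (by omega)).symm)
    refine Finset.prod_eq_zero (Finset.mem_range.mpr hiN) ?_
    simp only [Pi.mul_apply, Pi.star_apply, star_mul, star_factor_single]
    refine h.vacuum.offDiag ?_ hi
    rw [← map_star]
    exact fixed_of_range hγ.range_eq _
  · intro x y hx hy
    rw [map_add, add_apply, inner_add_left, hx, hy, add_zero]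
  · intro c x hx
    rw [map_smul, smul_apply, inner_smul_left, hx, mul_zero]

theorem gns_tprod_mul_single (h : IsVacuumTensor T σ φ S φS) (n : ℕ) (y : ℕ → A) :
    φS.gnsStarAlgHom (S.tprod n fun i => y i * T.factor 0 (Matrix.single 0 0 1))
      (cyclicVector φS) = φS.gnsStarAlgHom (S.tprod n y) (cyclicVector φS) := by
  have : (S.tprod n fun i => y i * T.factor 0 (Matrix.single 0 0 1)) =
      S.tprod n y * S.tprod n fun _ => T.factor 0 (Matrix.single 0 0 1) := (S.tprod_mul n _ _).symm
  rw [this, gns_mul_apply, h.gns_tprod_single]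

theorem vacTensorVector_total (h : IsVacuumTensor T σ φ S φS) (hγ : IsTensorEndo T σ γ S γS) :
    Dense (Submodule.span ℂ {v | ∃ x s,
      v = (φS.gnsStarAlgHom.comp γS) x (vacTensorVector T S φS s)} : Set φS.GNS) := by
  classical
  set M := Submodule.span ℂ {v | ∃ x s,
    v = (φS.gnsStarAlgHom.comp γS) x (vacTensorVector T S φS s)} with hM
  let e : A →ₗ[ℂ] φS.GNS := (ContinuousLinearMap.apply ℂ φS.GNS (cyclicVector φS)).toLinearMap ∘ₗ
    φS.gnsStarAlgHom.toAlgHom.toLinearMap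
  have he : ∀ x, e x = φS.gnsStarAlgHom x (cyclicVector φS) := fun _ => rfl
  have htp : ∀ n y, e (S.tprod n y) ∈ M := by
    intro n y
    have h1 := S.tprod_mem_span (n := n)
      (fun i _ => mul_single_mem_span hγ.gauge.pow_eq_one hγ.gauge.map_factor (y i))
      ⟨_, 1, map_one σ, 0, rfl⟩
    have h2 := Submodule.mem_map_of_mem (f := e) h1
    rw [he, h.gns_tprod_mul_single, Submodule.map_span] at h2
    refine Submodule.span_le.mpr ?_ h2
    rintro _ ⟨_, ⟨z, hz, rfl⟩, rfl⟩
    choose b hb j hj using hz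
    obtain ⟨x, hx⟩ := hγ.exists_tprod (n := n) hb
    -- The indices `j i` are arbitrary beyond position `n`; cutting them off makes the sequence
    -- finitely supported.
    let s : ℕ →₀ Fin k := Finsupp.onFinset (Finset.range n) (fun i => if i < n then j i else 0)
      fun i hi => by
        by_contra h'
        exact hi (if_neg fun h'' => h' (Finset.mem_range.mpr h''))
    have hs : suppBound s ≤ n := Finset.sup_le fun i hi => by
      have := Finsupp.support_onFinset_subset hi
      exact Nat.succ_le_of_lt (Finset.mem_range.mp this)
    refine Submodule.subset_span ⟨x, s, ?_⟩
    change e (S.tprod n z) = φS.gnsStarAlgHom (γS x) (vacTensorVector T S φS s)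
    rw [he, hx, ← h.gns_columnTensor s hs, ← gns_mul_apply, columnTensor, S.tprod_mul]
    congr 2
    refine S.tprod_congr fun i hi => ?_
    rw [hj, Pi.mul_apply]
    simp [s, hi]
  have hcl : ∀ y, e y ∈ closure (M : Set φS.GNS) := fun y =>
    S.tprod_induction (P := fun y => e y ∈ M.topologicalClosure)
      (M.isClosed_topologicalClosure.preimage (continuous_gns_apply φS _))
      (fun n y => M.le_topologicalClosure (htp n y))
      (fun x y hx hy => by rw [map_add]; exact add_mem hx hy)
      (fun c x hx => by rw [map_smul]; exact Submodule.smul_mem _ _ hx) y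
  refine dense_closure.mp ((denseRange_gns φS).mono ?_)
  rintro _ ⟨y, rfl⟩
  exact hcl y

theorem commutant_equiv (h : IsVacuumTensor T σ φ S φS) (hγ : IsTensorEndo T σ γ S γS)
    (hk : 1 < k) : Nonempty (gnsCommutant φS γS ≃⋆ₐ[ℂ] lp (fun _ : ℕ => ℂ) ∞) := by
  have : Nontrivial (Fin k) := Fin.nontrivial_iff_two_le.mpr hk
  -- For `k > 1` the index set is countably infinite, which yields `ℓ^∞(ℕ)`.
  obtain ⟨_⟩ := nonempty_denumerable (ℕ →₀ Fin k)
  let ε : ℕ ≃ (ℕ →₀ Fin k) := (Denumerable.eqv _).symm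
  have := nonempty_starAlgEquiv_lp (ρ := φS.gnsStarAlgHom.comp γS)
    (ζ := fun n => vacTensorVector T S φS (ε n)) (fun n => h.norm_vacTensorVector _)
    (fun R hR n => h.vacTensorVector_eigen hγ R hR _)
    (fun x m n hmn => h.vacTensorVector_orth hγ x _ _ (ε.injective.ne hmn)) (by
      have hset : {v | ∃ x n, v = (φS.gnsStarAlgHom.comp γS) x (vacTensorVector T S φS (ε n))} =
          {v | ∃ x s, v = (φS.gnsStarAlgHom.comp γS) x (vacTensorVector T S φS s)} := by
        ext v
        exact exists_congr fun x => ⟨fun ⟨n, hn⟩ => ⟨ε n, hn⟩, fun ⟨s, hs⟩ =>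
          ⟨ε.symm s, by rw [hs, Equiv.apply_symm_apply]⟩⟩
      rw [hset]
      exact h.vacTensorVector_total hγ)
  rwa [← gnsCommutant_eq] at this

theorem isPureState_restrict [Nontrivial A] (h : IsVacuumTensor T σ φ S φS)
    (hγ : IsTensorEndo T σ γ S γS) :
    IsPureState (φS.toLinearMap ∘ₗ γS.range.subtype.toAlgHom.toLinearMap) :=
  h.excised.isPureState_restrict γS (T.norm_map_eq γS) fun n =>
    hγ.exists_tprod fun _ => gauge_vacProj hγ.gauge n

end IsVacuumTensor

end VacuumTensor

/-! ### Multiplication by bounded functions on `L²` -/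

section MulOperators

variable {G : Type*} [MeasurableSpace G] {μ : Measure G}

/-- The operator of multiplication by a bounded function on `L²`. -/
def mulL (f : Lp ℂ ∞ μ) : Lp ℂ 2 μ →L[ℂ] Lp ℂ 2 μ :=
  LinearMap.mkContinuous
    { toFun := fun g => f • g
      map_add' := Lp.add_smul f
      map_smul' := fun c g => (Lp.smul_comm c f g).symm } ‖f‖ (Lp.norm_smul_le f)

theorem coeFn_mulL (f : Lp ℂ ∞ μ) (g : Lp ℂ 2 μ) : mulL f g =ᵐ[μ] fun x => f x * g x :=
  Lp.coeFn_lpSMul f g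

theorem mulL_add (f f' : Lp ℂ ∞ μ) (g : Lp ℂ 2 μ) : mulL (f + f') g = mulL f g + mulL f' g :=
  Lp.smul_add f f' g

theorem mulL_smul (c : ℂ) (f : Lp ℂ ∞ μ) (g : Lp ℂ 2 μ) : mulL (c • f) g = c • mulL f g :=
  Lp.smul_assoc c f g

theorem mulL_mulL (f f' : Lp ℂ ∞ μ) (g : Lp ℂ 2 μ) :
    mulL (f • f' : Lp ℂ ∞ μ) g = mulL f (mulL f' g) := by
  refine Lp.ext ?_
  filter_upwards [coeFn_mulL (f • f' : Lp ℂ ∞ μ) g, coeFn_mulL f (mulL f' g), coeFn_mulL f' g,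
    Lp.coeFn_lpSMul (r := ∞) f f'] with x h1 h2 h3 h4
  rw [h1, h2, h3, h4, Pi.smul_apply', smul_eq_mul, mul_assoc]

theorem mulL_comm (f f' : Lp ℂ ∞ μ) (g : Lp ℂ 2 μ) : mulL f (mulL f' g) = mulL f' (mulL f g) := by
  refine Lp.ext ?_
  filter_upwards [coeFn_mulL f (mulL f' g), coeFn_mulL f' g, coeFn_mulL f' (mulL f g),
    coeFn_mulL f g] with x h1 h2 h3 h4
  rw [h1, h2, h3, h4]
  ring

theorem inner_mulL_left (f : Lp ℂ ∞ μ) (g g' : Lp ℂ 2 μ) :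
    inner ℂ (mulL f g) g' = inner ℂ g (mulL (star f) g') := by
  rw [L2.inner_def, L2.inner_def]
  refine integral_congr_ae ?_
  filter_upwards [coeFn_mulL f g, coeFn_mulL (star f) g', Lp.coeFn_star f] with x h1 h2 h3
  rw [h1, h2, h3]
  simp only [RCLike.inner_apply, map_mul, Pi.star_apply, RCLike.star_def]
  ring

variable [TopologicalSpace G] [CompactSpace G] [BorelSpace G] [IsFiniteMeasure μ]

variable (μ) in
/-- The constant function `1` in `L²`. -/
def oneL : Lp ℂ 2 μ := ContinuousMap.toLp 2 μ ℂ (1 : C(G, ℂ))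

theorem coeFn_oneL : oneL μ =ᵐ[μ] fun _ => 1 := ContinuousMap.coeFn_toLp (𝕜 := ℂ) μ (1 : C(G, ℂ))

theorem coeFn_mulL_oneL (f : Lp ℂ ∞ μ) : mulL f (oneL μ) =ᵐ[μ] f := by
  filter_upwards [coeFn_mulL f (oneL μ), coeFn_oneL (μ := μ)] with x h1 h2
  rw [h1, h2, mul_one]

theorem mulL_toLp_oneL (F : C(G, ℂ)) :
    mulL (ContinuousMap.toLp ∞ μ ℂ F) (oneL μ) = ContinuousMap.toLp 2 μ ℂ F := by
  refine Lp.ext ?_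
  filter_upwards [coeFn_mulL_oneL (ContinuousMap.toLp ∞ μ ℂ F),
    ContinuousMap.coeFn_toLp (p := ∞) (𝕜 := ℂ) μ F,
    ContinuousMap.coeFn_toLp (p := 2) (𝕜 := ℂ) μ F] with x h1 h2 h3
  rw [h1, h2, h3]

theorem mulL_toLp_toLp (F F' : C(G, ℂ)) :
    mulL (ContinuousMap.toLp ∞ μ ℂ F) (ContinuousMap.toLp 2 μ ℂ F') =
      ContinuousMap.toLp 2 μ ℂ (F * F') := by
  refine Lp.ext ?_
  filter_upwards [coeFn_mulL (ContinuousMap.toLp ∞ μ ℂ F) (ContinuousMap.toLp 2 μ ℂ F'),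
    ContinuousMap.coeFn_toLp (p := ∞) (𝕜 := ℂ) μ F,
    ContinuousMap.coeFn_toLp (p := 2) (𝕜 := ℂ) μ F',
    ContinuousMap.coeFn_toLp (p := 2) (𝕜 := ℂ) μ (F * F')] with x h1 h2 h3 h4
  rw [h1, h2, h3, h4]
  rfl

/-- The retraction of `ℂ` onto the square of radius `K`. -/
def clamp (K : ℝ) (z : ℂ) : ℂ := ⟨max (-K) (min K z.re), max (-K) (min K z.im)⟩

theorem lipschitzWith_clamp (K : ℝ) : LipschitzWith 2 (clamp K) := by
  refine LipschitzWith.of_dist_le_mul fun z w => ?_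
  have key : ∀ a b : ℝ, |max (-K) (min K a) - max (-K) (min K b)| ≤ |a - b| := by
    intro a b
    have h1 := abs_max_sub_max_le_max (-K) (min K a) (-K) (min K b)
    have h2 := abs_min_sub_min_le_max K a K b
    rw [sub_self, abs_zero, max_eq_right (abs_nonneg (min K a - min K b))] at h1
    rw [sub_self, abs_zero, max_eq_right (abs_nonneg (a - b))] at h2
    exact h1.trans h2
  rw [dist_eq_norm, dist_eq_norm]
  refine (Complex.norm_le_abs_re_add_abs_im _).trans ?_
  have h1 := (key z.re w.re).trans (by simpa using Complex.abs_re_le_norm (z - w))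
  have h2 := (key z.im w.im).trans (by simpa using Complex.abs_im_le_norm (z - w))
  have h3 : (clamp K z - clamp K w).re = max (-K) (min K z.re) - max (-K) (min K w.re) := rfl
  have h4 : (clamp K z - clamp K w).im = max (-K) (min K z.im) - max (-K) (min K w.im) := rfl
  rw [h3, h4]
  push_cast
  linarith

/-- The factor `2` is lost by truncating real and imaginary parts separately. It is harmless, since
only some uniform bound is needed to extend operators. -/
theorem norm_clamp_le {K : ℝ} (hK : 0 ≤ K) (z : ℂ) : ‖clamp K z‖ ≤ 2 * K := by
  refine (Complex.norm_le_abs_re_add_abs_im _).trans ?_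
  have key : ∀ a : ℝ, |max (-K) (min K a)| ≤ K := fun a =>
    abs_le.mpr ⟨le_max_left _ _, max_le (by linarith) (min_le_left _ _)⟩
  have h1 := key z.re
  have h2 := key z.im
  change |max (-K) (min K z.re)| + |max (-K) (min K z.im)| ≤ 2 * K
  linarith

theorem clamp_of_norm_le {K : ℝ} {z : ℂ} (h : ‖z‖ ≤ K) : clamp K z = z := by
  have h1 := abs_le.mp ((Complex.abs_re_le_norm z).trans h)
  have h2 := abs_le.mp ((Complex.abs_im_le_norm z).trans h)
  refine Complex.ext ?_ ?_
  · change max (-K) (min K z.re) = z.re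
    rw [min_eq_right h1.2, max_eq_right h1.1]
  · change max (-K) (min K z.im) = z.im
    rw [min_eq_right h2.2, max_eq_right h2.1]

/-- Bounded functions are `L²` limits of uniformly bounded functions from any dense family of
continuous functions that is stable under composition. -/
theorem exists_seq_tendsto_mulL_oneL {𝒞 : Set C(G, ℂ)}
    (dense : Dense (ContinuousMap.toLp 2 μ ℂ '' 𝒞))
    (comp : ∀ F ∈ 𝒞, ∀ c : C(ℂ, ℂ), c.comp F ∈ 𝒞) (h : Lp ℂ ∞ μ) :
    ∃ F : ℕ → C(G, ℂ), (∀ n, F n ∈ 𝒞) ∧ (∀ n, ‖F n‖ ≤ 2 * ‖h‖) ∧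
      Tendsto (fun n => ContinuousMap.toLp 2 μ ℂ (F n)) atTop (𝓝 (mulL h (oneL μ))) := by
  set K := ‖h‖
  have hK : 0 ≤ K := norm_nonneg h
  obtain ⟨f, hf, hlim⟩ := mem_closure_iff_seq_limit.mp (dense (mulL h (oneL μ)))
  choose F hF hFf using hf
  have h0 : clamp K 0 = 0 := clamp_of_norm_le (by simpa using hK)
  let c : C(ℂ, ℂ) := ⟨clamp K, (lipschitzWith_clamp K).continuous⟩
  have hc : ∀ F : C(G, ℂ), ContinuousMap.toLp 2 μ ℂ (c.comp F) =
      (lipschitzWith_clamp K).compLp h0 (ContinuousMap.toLp 2 μ ℂ F) := by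
    intro F
    refine Lp.ext ?_
    filter_upwards [ContinuousMap.coeFn_toLp (p := 2) (𝕜 := ℂ) μ (c.comp F),
      (lipschitzWith_clamp K).coeFn_compLp h0 (ContinuousMap.toLp 2 μ ℂ F),
      ContinuousMap.coeFn_toLp (p := 2) (𝕜 := ℂ) μ F] with x h1 h2 h3
    rw [h1, h2, Function.comp_apply, h3]
    rfl
  -- The limit is bounded by `K` almost everywhere and so is not changed by truncation; Lipschitz
  -- continuity preserves the convergence.
  have hg : (lipschitzWith_clamp K).compLp h0 (mulL h (oneL μ)) = mulL h (oneL μ) := by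
    refine Lp.ext ?_
    filter_upwards [(lipschitzWith_clamp K).coeFn_compLp h0 (mulL h (oneL μ)),
      coeFn_mulL_oneL h, ae_le_eLpNormEssSup (f := h) (μ := μ)] with x h1 h2 h3
    rw [h1, Function.comp_apply, h2]
    refine clamp_of_norm_le ?_
    rw [← eLpNorm_exponent_top] at h3
    have := ENNReal.toReal_mono (Lp.eLpNorm_ne_top h) h3
    rwa [toReal_enorm, ← Lp.norm_def] at this
  refine ⟨fun n => c.comp (F n), fun n => comp _ (hF n) c, fun n => ?_, ?_⟩
  · exact (ContinuousMap.norm_le _ (by positivity)).mpr fun x => norm_clamp_le hK _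
  · rw [tendsto_iff_norm_sub_tendsto_zero]
    have h1 := (tendsto_iff_norm_sub_tendsto_zero.mp hlim).const_mul 2
    rw [mul_zero] at h1
    refine squeeze_zero (fun _ => norm_nonneg _) (fun n => ?_) h1
    rw [hc, ← hFf]
    nth_rw 1 [← hg]
    exact (lipschitzWith_clamp K).norm_compLp_sub_le h0 _ _

/-- A function in `L²` whose multiplication operator is bounded is bounded. -/
theorem exists_mulL_eq_of_bound {𝒞 : Set C(G, ℂ)}
    (dense : Dense (ContinuousMap.toLp 2 μ ℂ '' 𝒞)) {h : Lp ℂ 2 μ} {K : ℝ} (hK : 0 ≤ K)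
    (hb : ∀ F ∈ 𝒞, ‖mulL (ContinuousMap.toLp ∞ μ ℂ F) h‖ ≤ K * ‖ContinuousMap.toLp 2 μ ℂ F‖) :
    ∃ f : Lp ℂ ∞ μ, mulL f (oneL μ) = h := by
  -- The margin `+ 1` forces `s` to be null: `(K + 1) ‖1_s‖ ≤ ‖1_s h‖ ≤ K ‖1_s‖`.
  set s : Set G := {x | K + 1 ≤ ‖h x‖} with hs
  have hsm : MeasurableSet s :=
    measurableSet_le measurable_const (Lp.stronglyMeasurable h).measurable.norm
  let ind : Lp ℂ 2 μ := indicatorConstLp 2 hsm (measure_ne_top μ s) (1 : ℂ)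
  have hind : ind =ᵐ[μ] s.indicator fun _ => 1 := indicatorConstLp_coeFn
  obtain ⟨f, hf, hlim⟩ := mem_closure_iff_seq_limit.mp (dense ind)
  choose F hF hFf using hf
  obtain ⟨ns, hns, hae⟩ := (tendstoInMeasure_of_tendsto_Lp hlim).exists_seq_tendsto_ae
  have hlim' := hlim.comp hns.tendsto_atTop
  have h1 : ∀ᵐ x ∂μ, Tendsto (fun n => F (ns n) x * h x) atTop (𝓝 (ind x * h x)) := by
    have : ∀ᵐ x ∂μ, ∀ n, f (ns n) x = F (ns n) x := by
      rw [ae_all_iff]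
      intro n
      rw [← hFf]
      exact ContinuousMap.coeFn_toLp (p := 2) (𝕜 := ℂ) μ (F (ns n))
    filter_upwards [hae, this] with x h1 h2
    exact ((h1.congr h2).mul_const _)
  -- The bound is known only for multipliers in `𝒞`. Fatou's lemma along an almost everywhere
  -- convergent subsequence carries it to the indicator of `s`.
  have h2 := Lp.eLpNorm_lim_le_liminf_eLpNorm (p := 2)
    (f := fun n x => F (ns n) x * h x)
    (fun n => (F (ns n)).continuous.aestronglyMeasurable.mul (Lp.aestronglyMeasurable h)) _ h1
  have h3 : ∀ n, eLpNorm (fun x => F (ns n) x * h x) 2 μ ≤ ENNReal.ofReal (K * ‖f (ns n)‖) := by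
    intro n
    have h4 : eLpNorm (fun x => F (ns n) x * h x) 2 μ =
        eLpNorm (mulL (ContinuousMap.toLp ∞ μ ℂ (F (ns n))) h) 2 μ := by
      refine eLpNorm_congr_ae ?_
      filter_upwards [coeFn_mulL (ContinuousMap.toLp ∞ μ ℂ (F (ns n))) h,
        ContinuousMap.coeFn_toLp (p := ∞) (𝕜 := ℂ) μ (F (ns n))] with x h5 h6
      rw [h5, h6]
    rw [h4, ← Lp.enorm_def, ← ofReal_norm, ← hFf]
    exact ENNReal.ofReal_le_ofReal (hb _ (hF _))
  have h4 : eLpNorm (fun x => ind x * h x) 2 μ ≤ ENNReal.ofReal (K * ‖ind‖) := by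
    refine h2.trans ((liminf_le_liminf (Eventually.of_forall h3)).trans_eq ?_)
    exact (((ENNReal.continuous_ofReal.tendsto _).comp (hlim'.norm.const_mul K))).liminf_eq
  have h5 : ENNReal.ofReal ((K + 1) * ‖ind‖) ≤ eLpNorm (fun x => ind x * h x) 2 μ := by
    have : (K + 1) * ‖ind‖ = ‖((K + 1 : ℝ) : ℂ) • ind‖ := by
      rw [norm_smul, Complex.norm_real, Real.norm_of_nonneg (by positivity)]
    rw [this, ofReal_norm, Lp.enorm_def]
    refine eLpNorm_mono_ae ?_
    filter_upwards [hind, Lp.coeFn_smul ((K + 1 : ℝ) : ℂ) ind] with x h6 h7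
    rw [h7, Pi.smul_apply, h6]
    by_cases hx : x ∈ s
    · rw [Set.indicator_of_mem hx, smul_eq_mul, mul_one, one_mul, Complex.norm_real,
        Real.norm_of_nonneg (by positivity)]
      exact hx
    · rw [Set.indicator_of_notMem hx]
      simp
  have h6 : ‖ind‖ = 0 := by
    have := (ENNReal.ofReal_le_ofReal_iff (by positivity)).mp (h5.trans h4)
    nlinarith [norm_nonneg ind]
  have h7 : μ s = 0 := by
    rw [norm_indicatorConstLp (by norm_num) (by norm_num), norm_one, one_mul] at h6
    have := (Real.rpow_eq_zero measureReal_nonneg (by norm_num)).mp h6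
    exact (measureReal_eq_zero_iff).mp this
  have h8 : ∀ᵐ x ∂μ, ‖h x‖ ≤ K + 1 := by
    filter_upwards [measure_eq_zero_iff_ae_notMem.mp h7] with x hx
    exact (not_le.mp hx).le
  refine ⟨(memLp_top_of_bound (Lp.aestronglyMeasurable h) (K + 1) h8).toLp h, Lp.ext ?_⟩
  exact (coeFn_mulL_oneL _).trans (MemLp.coeFn_toLp _)

end MulOperators

/-! ### Recognising a commutant as `L^∞` -/

section Model

variable {G : Type*} [MeasurableSpace G] {μ : Measure G} [TopologicalSpace G] [CompactSpace G]
  [BorelSpace G] [IsFiniteMeasure μ] {C : Type*} [CStarAlgebra C] {H : Type*}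
  [NormedAddCommGroup H] [InnerProductSpace ℂ H] [CompleteSpace H]

/-- An embedding of `L²(μ)` into the space of a representation `ρ`, through which bounded functions
act in the commutant of `ρ`. -/
structure LInftyModel (ρ : C →⋆ₐ[ℂ] (H →L[ℂ] H)) (V : Lp ℂ 2 μ →ₗᵢ[ℂ] H)
    (𝒞 : Set C(G, ℂ)) : Prop where
  dense : Dense (ContinuousMap.toLp 2 μ ℂ '' 𝒞)
  comp : ∀ F ∈ 𝒞, ∀ c : C(ℂ, ℂ), c.comp F ∈ 𝒞
  mul : ∀ F ∈ 𝒞, ∃ x, ∀ g, ρ x (V g) = V (mulL (ContinuousMap.toLp ∞ μ ℂ F) g)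
  bound : ∀ F ∈ 𝒞, ∀ x, ‖ρ x (V (ContinuousMap.toLp 2 μ ℂ F))‖ ≤ ‖F‖ * ‖ρ x (V (oneL μ))‖
  cyclic : DenseRange fun x => ρ x (V (oneL μ))
  range : ∀ R : H →L[ℂ] H, (∀ x, Commute R (ρ x)) → ∃ h, R (V (oneL μ)) = V h

namespace LInftyModel

variable {ρ : C →⋆ₐ[ℂ] (H →L[ℂ] H)} {V : Lp ℂ 2 μ →ₗᵢ[ℂ] H} {𝒞 : Set C(G, ℂ)}

theorem ext (m : LInftyModel ρ V 𝒞) {R R' : H →L[ℂ] H} (hR : ∀ x, Commute R (ρ x))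
    (hR' : ∀ x, Commute R' (ρ x)) (h : R (V (oneL μ)) = R' (V (oneL μ))) : R = R' := by
  refine DFunLike.coe_injective (m.cyclic.equalizer R.continuous R'.continuous (funext fun x => ?_))
  change R (ρ x _) = R' (ρ x _)
  rw [commutant_apply hR, commutant_apply hR', h]

theorem bound_mulL (m : LInftyModel ρ V 𝒞) (h : Lp ℂ ∞ μ) (x : C) :
    ‖ρ x (V (mulL h (oneL μ)))‖ ≤ 2 * ‖h‖ * ‖ρ x (V (oneL μ))‖ := by
  obtain ⟨F, hF, hFb, hlim⟩ := exists_seq_tendsto_mulL_oneL m.dense m.comp h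
  have h1 := (((ρ x).continuous.comp V.continuous).tendsto _).comp hlim
  refine le_of_tendsto h1.norm (Eventually.of_forall fun n => ?_)
  exact (m.bound _ (hF n) x).trans (mul_le_mul_of_nonneg_right (hFb n) (norm_nonneg _))

/-- The assignment `ρ x (V 1) ↦ ρ x (V h)` is bounded by `bound_mulL`, is densely defined, and
commutes with `ρ` by construction. -/
theorem exists_op (m : LInftyModel ρ V 𝒞) (h : Lp ℂ ∞ μ) :
    ∃ R : H →L[ℂ] H, (∀ x, Commute R (ρ x)) ∧ R (V (oneL μ)) = V (mulL h (oneL μ)) := by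
  let e : H → C →ₗ[ℂ] H := fun ζ =>
    (ContinuousLinearMap.apply ℂ H ζ).toLinearMap ∘ₗ ρ.toAlgHom.toLinearMap
  have he : ∀ ζ x, e ζ x = ρ x ζ := fun _ _ => rfl
  let R := (e (V (mulL h (oneL μ)))).extendOfNorm (e (V (oneL μ)))
  have hR : ∀ x, R (ρ x (V (oneL μ))) = ρ x (V (mulL h (oneL μ))) := fun x =>
    LinearMap.extendOfNorm_eq m.cyclic ⟨_, m.bound_mulL h⟩ x
  have h1 : R (V (oneL μ)) = V (mulL h (oneL μ)) := by
    have := hR 1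
    rwa [map_one] at this
  refine ⟨R, fun x => ?_, h1⟩
  refine DFunLike.coe_injective (m.cyclic.equalizer (R * ρ x).continuous (ρ x * R).continuous
    (funext fun y => ?_))
  change R (ρ x (ρ y _)) = ρ x (R (ρ y _))
  have : ∀ ζ, ρ x (ρ y ζ) = ρ (x * y) ζ := fun ζ => by rw [map_mul]; rfl
  rw [this, hR, hR, this]

theorem apply_toLp (m : LInftyModel ρ V 𝒞) {R : H →L[ℂ] H} (hR : ∀ x, Commute R (ρ x))
    {h : Lp ℂ 2 μ} (hh : R (V (oneL μ)) = V h) {F : C(G, ℂ)} (hF : F ∈ 𝒞) :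
    R (V (ContinuousMap.toLp 2 μ ℂ F)) = V (mulL (ContinuousMap.toLp ∞ μ ℂ F) h) := by
  obtain ⟨x, hx⟩ := m.mul F hF
  rw [← mulL_toLp_oneL, ← hx, commutant_apply hR, hh, hx]

theorem apply_eq (m : LInftyModel ρ V 𝒞) {R : H →L[ℂ] H} (hR : ∀ x, Commute R (ρ x))
    {f : Lp ℂ ∞ μ} (hf : R (V (oneL μ)) = V (mulL f (oneL μ))) (g : Lp ℂ 2 μ) :
    R (V g) = V (mulL f g) := by
  refine congrFun (Continuous.ext_on m.dense (R.continuous.comp V.continuous)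
    (V.continuous.comp (mulL f).continuous) ?_) g
  rintro _ ⟨F, hF, rfl⟩
  change R (V _) = V (mulL f _)
  rw [m.apply_toLp hR hf hF, mulL_comm, mulL_toLp_oneL]

/-- Because `R` commutes with the continuous multipliers, multiplication by the function
representing `R (V 1)` is bounded by `‖R‖` on a dense set, so this function is essentially bounded.
-/
theorem exists_symbol (m : LInftyModel ρ V 𝒞) {R : H →L[ℂ] H} (hR : ∀ x, Commute R (ρ x)) :
    ∃ f : Lp ℂ ∞ μ, R (V (oneL μ)) = V (mulL f (oneL μ)) := by
  obtain ⟨h, hh⟩ := m.range R hR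
  obtain ⟨f, hf⟩ := exists_mulL_eq_of_bound m.dense (h := h) (norm_nonneg R) fun F hF => by
    rw [← V.norm_map, ← m.apply_toLp hR hh hF, ← V.norm_map (ContinuousMap.toLp 2 μ ℂ F)]
    exact R.le_opNorm _
  exact ⟨f, by rw [hf, hh]⟩

theorem isoLInfty (m : LInftyModel ρ V 𝒞) :
    IsoLInfty (StarSubalgebra.centralizer ℂ (Set.range ρ)) μ := by
  choose Φ hΦ hΦ1 using m.exists_op
  have hmem := fun f => (mem_centralizer_range ρ).mpr (hΦ f)
  have hadd : ∀ f g, Φ (f + g) = Φ f + Φ g := fun f g =>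
    m.ext (hΦ _) (fun x => (hΦ f x).add_left (hΦ g x)) (by
      rw [add_apply, hΦ1, hΦ1, hΦ1, mulL_add, map_add])
  have hsmul : ∀ (c : ℂ) f, Φ (c • f) = c • Φ f := fun c f =>
    m.ext (hΦ _) (fun x => (hΦ f x).smul_left c) (by
      rw [smul_apply, hΦ1, hΦ1, mulL_smul, map_smul])
  let L : Lp ℂ ∞ μ →ₗ[ℂ] StarSubalgebra.centralizer ℂ (Set.range ρ) :=
    { toFun := fun f => ⟨Φ f, hmem f⟩
      map_add' := fun f g => Subtype.ext (hadd f g)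
      map_smul' := fun c f => Subtype.ext (hsmul c f) }
  have hL : Function.Bijective L := by
    constructor
    · intro f g hfg
      have h1 : Φ f = Φ g := congrArg Subtype.val hfg
      have h2 : mulL f (oneL μ) = mulL g (oneL μ) := V.injective (by rw [← hΦ1, ← hΦ1, h1])
      refine Lp.ext ((coeFn_mulL_oneL f).symm.trans ?_)
      rw [h2]
      exact coeFn_mulL_oneL g
    · rintro ⟨R, hR⟩
      have hR' := (mem_centralizer_range ρ).mp hR
      obtain ⟨f, hf⟩ := m.exists_symbol hR'
      exact ⟨f, Subtype.ext (m.ext (hΦ f) hR' ((hΦ1 f).trans hf.symm))⟩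
  refine ⟨LinearEquiv.ofBijective L hL, fun f g => Subtype.ext ?_, fun f => Subtype.ext ?_⟩
  · change Φ (f • g : Lp ℂ ∞ μ) = Φ f * Φ g
    refine m.ext (hΦ _) (fun x => (hΦ f x).mul_left (hΦ g x)) ?_
    change _ = Φ f (Φ g _)
    rw [hΦ1, hΦ1, m.apply_eq (hΦ f) (hΦ1 f), mulL_mulL]
  · change Φ (star f) = star (Φ f)
    have hstar := (mem_centralizer_range ρ).mp (star_mem (hmem f))
    refine m.ext (hΦ _) hstar ?_
    -- The adjoint lies in the commutant, so its value on the cyclic vector again comes from `L²`;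
    -- inner products with all `V g` identify it with the conjugate function.
    obtain ⟨h', hh'⟩ := m.range _ hstar
    rw [hΦ1, hh']
    congr 1
    refine ext_inner_left ℂ fun g => ?_
    rw [← inner_mulL_left, ← V.inner_map_map, ← V.inner_map_map g, ← hh', ← m.apply_eq (hΦ f)
      (hΦ1 f), ContinuousLinearMap.star_eq_adjoint, ContinuousLinearMap.adjoint_inner_right]

end LInftyModel

end Model

/-! ### Absence of minimal projections -/

section NonAtomic

variable {G : Type*} [MeasurableSpace G] {μ : Measure G} {H : Type*}
  [NormedAddCommGroup H] [InnerProductSpace ℂ H] [CompleteSpace H]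

/-- Projections of `L^∞` are indicator functions, so a smaller projection is obtained by splitting a
set of positive measure. -/
theorem isNonAtomic_of_isoLInfty [IsFiniteMeasure μ] {M : StarSubalgebra ℂ (H →L[ℂ] H)}
    (hM : IsoLInfty M μ)
    (hμ : ∀ s, MeasurableSet s → μ s ≠ 0 →
      ∃ t, MeasurableSet t ∧ t ⊆ s ∧ μ t ≠ 0 ∧ μ (s \ t) ≠ 0) :
    IsNonAtomic M := by
  obtain ⟨Φ, hmul, hstar⟩ := hM
  intro E hE hEp hE0
  obtain ⟨f, hf⟩ := Φ.surjective ⟨E, hE⟩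
  have hff : (f • f : Lp ℂ ∞ μ) = f := by
    refine Φ.injective ?_
    rw [hmul, hf]
    exact Subtype.ext hEp.isIdempotentElem.eq
  have hff' : ∀ᵐ x ∂μ, f x = 0 ∨ f x = 1 := by
    filter_upwards [Lp.coeFn_lpSMul (r := ∞) f f] with x hx
    rw [hff, Pi.smul_apply', smul_eq_mul] at hx
    rcases eq_or_ne (f x) 0 with h0 | h0
    · exact Or.inl h0
    · right
      field_simp at hx
      exact hx.symm
  set s : Set G := {x | f x = 1}
  have hsm : MeasurableSet s :=
    (Lp.stronglyMeasurable f).measurable (measurableSet_singleton 1)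
  have hs0 : μ s ≠ 0 := by
    intro h0
    have : f = 0 := by
      refine Lp.ext ?_
      filter_upwards [hff', measure_eq_zero_iff_ae_notMem.mp h0, Lp.coeFn_zero ℂ ∞ μ]
        with x h1 h2 h3
      rw [h3]
      exact h1.resolve_right h2
    rw [this, map_zero] at hf
    exact hE0 (congrArg Subtype.val hf).symm
  obtain ⟨t, htm, hts, ht0, hst0⟩ := hμ s hsm hs0
  let g : Lp ℂ ∞ μ := indicatorConstLp ∞ htm (measure_ne_top μ t) (1 : ℂ)
  have hg : g =ᵐ[μ] t.indicator fun _ => 1 := indicatorConstLp_coeFn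
  have hgg : (g • g : Lp ℂ ∞ μ) = g := by
    refine Lp.ext ?_
    filter_upwards [Lp.coeFn_lpSMul (r := ∞) g g, hg] with x h1 h2
    rw [h1, Pi.smul_apply', h2]
    by_cases hx : x ∈ t <;> simp [hx]
  have hgs : star g = g := by
    refine Lp.ext ?_
    filter_upwards [Lp.coeFn_star g, hg] with x h1 h2
    rw [h1, Pi.star_apply, h2]
    by_cases hx : x ∈ t <;> simp [hx]
  have hgf : (g • f : Lp ℂ ∞ μ) = g := by
    refine Lp.ext ?_
    filter_upwards [Lp.coeFn_lpSMul (r := ∞) g f, hg] with x h1 h2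
    rw [h1, Pi.smul_apply', h2]
    by_cases hx : x ∈ t
    · have : f x = 1 := hts hx
      simp [hx, this]
    · simp [hx]
  refine ⟨Φ g, (Φ g).2, ⟨?_, ?_⟩, ?_, ?_, ?_⟩
  · have := hmul g g
    rw [hgg] at this
    exact (congrArg Subtype.val this).symm
  · have := hstar g
    rw [hgs] at this
    exact (congrArg Subtype.val this).symm
  · intro h0
    have h1 : Φ g = 0 := Subtype.ext h0
    rw [map_eq_zero_iff Φ Φ.injective] at h1
    rw [h1] at hg
    refine ht0 (measure_eq_zero_iff_ae_notMem.mpr ?_)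
    filter_upwards [hg, Lp.coeFn_zero ℂ ∞ μ] with x h2 h3 hx
    rw [h3, Set.indicator_of_mem hx] at h2
    exact zero_ne_one h2
  · intro h0
    have h1 : Φ g = Φ f := by rw [hf]; exact Subtype.ext h0
    rw [Φ.injective h1] at hg
    refine hst0 (measure_eq_zero_iff_ae_notMem.mpr ?_)
    filter_upwards [hg] with x h2 hx
    rw [Set.indicator_of_notMem hx.2, hx.1] at h2
    exact one_ne_zero h2
  · have := hmul g f
    rw [hgf, hf] at this
    exact (congrArg Subtype.val this).symm

end NonAtomic

/-! ### Tail projections make fixed elements asymptotically diagonal -/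

section Tails

variable {k : ℕ} [NeZero k] {A : Type*} [CStarAlgebra A] {T : UHF k A} {σ : A ≃⋆ₐ[ℂ] A}

/-- The projections `1 ⊗ e_{00} ⊗ ⋯ ⊗ e_{00}`. -/
def tailProj (T : UHF k A) (n : ℕ) : A :=
  T.tprod (n + 1) fun i => if i = 0 then 1 else Matrix.single 0 0 1

theorem isStarProjection_tailProj (T : UHF k A) (n : ℕ) : IsStarProjection (tailProj T n) := by
  constructor
  · rw [IsIdempotentElem, tailProj, T.tprod_mul]
    refine T.tprod_congr fun i _ => ?_
    rw [Pi.mul_apply]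
    split_ifs <;> simp
  · rw [isSelfAdjoint_iff, tailProj, T.star_tprod]
    refine T.tprod_congr fun i _ => ?_
    rw [Pi.star_apply]
    split_ifs
    · rw [star_one]
    · exact (isStarProjection_single 0).isSelfAdjoint.star_eq

theorem gauge_tailProj (h : IsGauge T σ) (n : ℕ) : σ (tailProj T n) = tailProj T n := by
  refine (T.map_tprod (σ : A →⋆ₐ[ℂ] A) _ _).trans ?_
  rw [tailProj, InfTensorPower.tprod]
  congr 1
  refine List.map_congr_left fun i _ => ?_
  split_ifs
  · rw [map_one, map_one]
  · exact gauge_single_self h.map_factor i 0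

theorem single_mul_tailProj (T : UHF k A) (n : ℕ) :
    T.factor 0 (Matrix.single 0 0 1) * tailProj T n = vacProj T (n + 1) := by
  rw [← T.tprod_mulSingle (Nat.succ_pos n), vacProj, tailProj, T.tprod_mul]
  refine T.tprod_congr fun i _ => ?_
  by_cases hi : i = 0
  · subst hi; simp
  · simp [hi]

theorem commute_tailProj (T : UHF k A) (n : ℕ) (x : Matrix (Fin k) (Fin k) ℂ) :
    Commute (T.factor 0 x) (tailProj T n) := by
  rw [Commute, SemiconjBy, ← T.tprod_mulSingle (Nat.succ_pos n), tailProj, T.tprod_mul,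
    T.tprod_mul]
  refine T.tprod_congr fun i _ => ?_
  by_cases hi : i = 0
  · subst hi; simp
  · simp [Pi.mulSingle_eq_of_ne hi]

theorem single_mul_tailProj_mul_single (T : UHF k A) (n : ℕ) (i j : Fin k) :
    T.factor 0 (Matrix.single i 0 1) * vacProj T (n + 1) * T.factor 0 (Matrix.single 0 j 1) =
      T.factor 0 (Matrix.single i j 1) * tailProj T n := by
  rw [← single_mul_tailProj, ← mul_assoc, ← map_mul, mul_assoc, ← (commute_tailProj T n _).eq,
    ← mul_assoc, ← map_mul]
  simp

variable [PartialOrder A] [StarOrderedRing A] {φ : A →ₚ[ℂ] ℂ}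

/-- The diagonal part of `b` with respect to the vacuum state. -/
def diagPart (T : UHF k A) (φ : A →ₚ[ℂ] ℂ) (b : A) : A :=
  ∑ j, φ (T.factor 0 (Matrix.single 0 j 1) * b * T.factor 0 (Matrix.single j 0 1)) •
    T.factor 0 (Matrix.single j j 1)

/-- Insert `1 = ∑ e_{ii}` on both sides. Excision makes each of the `k²` blocks asymptotically
scalar, and the off-diagonal scalars vanish because `b` has degree zero. -/
theorem IsVacuum.tendsto_tailProj (h : IsVacuum T σ φ) {b : A} (hb : σ b = b) :
    Tendsto (fun n => tailProj T n * b * tailProj T n - diagPart T φ b * tailProj T n) atTop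
      (𝓝 0) := by
  set x : Fin k → Fin k → A := fun i j =>
    T.factor 0 (Matrix.single 0 i 1) * b * T.factor 0 (Matrix.single j 0 1) with hx
  have key : ∀ n, tailProj T n * b * tailProj T n - diagPart T φ b * tailProj T n =
      ∑ i, ∑ j, T.factor 0 (Matrix.single i 0 1) * (vacProj T (n + 1) * x i j * vacProj T (n + 1) -
        φ (x i j) • vacProj T (n + 1)) * T.factor 0 (Matrix.single 0 j 1) := by
    intro n
    have h1 : ∀ i j, T.factor 0 (Matrix.single i 0 1) * (vacProj T (n + 1) * x i j *
        vacProj T (n + 1)) * T.factor 0 (Matrix.single 0 j 1) =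
        T.factor 0 (Matrix.single i i 1) * (tailProj T n * b * tailProj T n) *
          T.factor 0 (Matrix.single j j 1) := by
      intro i j
      calc _ = (T.factor 0 (Matrix.single i 0 1) * vacProj T (n + 1) *
            T.factor 0 (Matrix.single 0 i 1)) * b * (T.factor 0 (Matrix.single j 0 1) *
            vacProj T (n + 1) * T.factor 0 (Matrix.single 0 j 1)) := by
            simp only [hx, mul_assoc]
        _ = _ := by
            rw [single_mul_tailProj_mul_single, single_mul_tailProj_mul_single,
              (commute_tailProj T n (Matrix.single j j 1)).eq]
            simp only [mul_assoc]
    have h2 : ∀ i, ∑ j, T.factor 0 (Matrix.single i 0 1) * (φ (x i j) • vacProj T (n + 1)) *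
        T.factor 0 (Matrix.single 0 j 1) =
        φ (x i i) • (T.factor 0 (Matrix.single i i 1) * tailProj T n) := by
      intro i
      rw [Finset.sum_eq_single i]
      · rw [mul_smul_comm, smul_mul_assoc, single_mul_tailProj_mul_single]
      · intro j _ hj
        rw [hx, h.offDiag hb hj.symm, zero_smul, mul_zero, zero_mul]
      · simp
    have h3 : ∑ i : Fin k, T.factor 0 (Matrix.single i i 1) = 1 := sum_map_single _
    simp only [mul_sub, sub_mul, Finset.sum_sub_distrib, h1, h2]
    congr 1
    · simp only [← Finset.mul_sum, h3, mul_one, ← Finset.sum_mul, one_mul]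
    · rw [diagPart, Finset.sum_mul]
      simp only [smul_mul_assoc, hx]
  simp only [key]
  rw [show (0 : A) = ∑ i : Fin k, ∑ j : Fin k, T.factor 0 (Matrix.single i 0 1) * 0 *
    T.factor 0 (Matrix.single 0 j 1) by simp]
  exact tendsto_finsetSum _ fun i _ => tendsto_finsetSum _ fun j _ =>
    ((h.excised.succ.tendsto (x i j)).const_mul _).mul_const _

end Tails

/-! ### Diagonal projections in the infinite tensor power -/

section DiagTensor

variable {k : ℕ} {A : Type*} [CStarAlgebra A] {T : UHF k A} {σ : A ≃⋆ₐ[ℂ] A}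
  {γ γS : A →⋆ₐ[ℂ] A} {S : InfTensorPower A A}

theorem InfTensorPower.tprod_eq_zero {B : Type*} [Ring B] [StarRing B] [Algebra ℂ B]
    (S : InfTensorPower B A) {n i : ℕ} (hi : i < n) {x : ℕ → B} (hx : x i = 0) :
    S.tprod n x = 0 := by
  induction n with
  | zero => omega
  | succ n ih =>
    rw [S.tprod_succ]
    rcases Nat.lt_succ_iff_lt_or_eq.mp hi with h | rfl
    · rw [ih h, zero_mul]
    · rw [hx, map_zero, mul_zero]

theorem InfTensorPower.norm_tprod_le (S : InfTensorPower A A) (n : ℕ) (x : ℕ → A) :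
    ‖S.tprod n x‖ ≤ ‖(1 : A)‖ * ∏ i ∈ Finset.range n, ‖x i‖ := by
  induction n with
  | zero => simp
  | succ n ih =>
    rw [S.tprod_succ, Finset.prod_range_succ, ← mul_assoc]
    exact (norm_mul_le _ _).trans
      (mul_le_mul ih (NonUnitalStarAlgHom.norm_apply_le _ _) (norm_nonneg _) (by positivity))

/-- The projections `e_{s(0) s(0)} ⊗ ⋯ ⊗ e_{s(n-1) s(n-1)}` of the tensor power. -/
def diagTensor (T : UHF k A) (S : InfTensorPower A A) (n : ℕ) (s : ℕ → Fin k) : A :=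
  S.tprod n fun i => T.factor 0 (Matrix.single (s i) (s i) 1)

theorem diagTensor_mul_self (n : ℕ) (s : ℕ → Fin k) :
    diagTensor T S n s * diagTensor T S n s = diagTensor T S n s := by
  rw [diagTensor, S.tprod_mul]
  refine S.tprod_congr fun i _ => ?_
  rw [Pi.mul_apply, ← map_mul]
  simp

theorem diagTensor_mul_of_ne {n i : ℕ} (hi : i < n) {s t : ℕ → Fin k} (h : s i ≠ t i) :
    diagTensor T S n s * diagTensor T S n t = 0 := by
  rw [diagTensor, diagTensor, S.tprod_mul]
  refine S.tprod_eq_zero hi ?_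
  rw [Pi.mul_apply, ← map_mul, Matrix.single_mul_single_of_ne _ _ _ _ h, map_zero]

theorem star_diagTensor (n : ℕ) (s : ℕ → Fin k) :
    star (diagTensor T S n s) = diagTensor T S n s := by
  rw [diagTensor, S.star_tprod]
  refine S.tprod_congr fun i _ => ?_
  rw [Pi.star_apply, star_factor_single]

theorem IsTensorEndo.exists_diagTensor [NeZero k] (hγ : IsTensorEndo T σ γ S γS) (n : ℕ) (s : ℕ → Fin k) :
    ∃ x, γS x = diagTensor T S n s :=
  hγ.exists_tprod fun _ => gauge_single_self hγ.gauge.map_factor 0 _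

end DiagTensor

/-! ### The representation of `ψ^∞` -/

section FlatTensor

variable {k : ℕ} [NeZero k] {A : Type*} [CStarAlgebra A] [PartialOrder A] [StarOrderedRing A]
  {T : UHF k A} {σ : A ≃⋆ₐ[ℂ] A} {γ γS : A →⋆ₐ[ℂ] A} {S : InfTensorPower A A}
  {φ ψ ψS : A →ₚ[ℂ] ℂ}

/-- `ψS` is the infinite tensor power of the vector state `ψ` of `k^{-1/2} ∑_j e_{j0} Ω`. -/
structure IsFlatVectorTensor (T : UHF k A) (σ : A ≃⋆ₐ[ℂ] A) (φ ψ : A →ₚ[ℂ] ℂ)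
    (S : InfTensorPower A A) (ψS : A →ₚ[ℂ] ℂ) : Prop where
  vacuum : IsVacuum T σ φ
  map_eq : ∀ x, ψ x = φ (star (flatElt T) * x * flatElt T)
  isProduct : S.IsProduct ψS ψ

namespace IsFlatVectorTensor

theorem map_one (h : IsFlatVectorTensor T σ φ ψ S ψS) : ψ 1 = 1 := by
  rw [h.map_eq, mul_one, star_flatElt_mul, h.vacuum.isProduct.map_factor (by simp)]
  simp

theorem map_one_tensor (h : IsFlatVectorTensor T σ φ ψ S ψS) : ψS 1 = 1 := by
  simpa using h.isProduct.map_tprod 0 1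

theorem gns_factor (h : IsFlatVectorTensor T σ φ ψ S ψS) {q : A} (hq : IsStarProjection q)
    (hq1 : ψ q = 1) (n : ℕ) : ψS.gnsStarAlgHom (S.factor n q) (cyclicVector ψS) =
      cyclicVector ψS := by
  refine gns_fix h.map_one_tensor (IsStarProjection.norm_le _ (IsStarProjection.map hq _)) ?_
  rw [h.isProduct.map_factor h.map_one, hq1]

theorem gns_tprod (h : IsFlatVectorTensor T σ φ ψ S ψS) {q : A} (hq : IsStarProjection q)
    (hq1 : ψ q = 1) (n : ℕ) : ψS.gnsStarAlgHom (S.tprod n fun _ => q) (cyclicVector ψS) =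
      cyclicVector ψS := by
  induction n with
  | zero => rw [S.tprod_zero, gns_one_apply]
  | succ n ih => rw [S.tprod_succ, gns_mul_apply, h.gns_factor hq hq1, ih]

theorem gns_tprod_compress (h : IsFlatVectorTensor T σ φ ψ S ψS) {q : A} (hq : IsStarProjection q)
    (hq1 : ψ q = 1) {m n : ℕ} (hmn : m ≤ n) (b : ℕ → A) :
    ψS.gnsStarAlgHom (S.tprod n fun i => q * (if i < m then b i else 1) * q) (cyclicVector ψS) =
      ψS.gnsStarAlgHom (S.tprod m fun i => q * b i * q) (cyclicVector ψS) := by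
  induction n, hmn using Nat.le_induction with
  | base =>
    congr 2
    exact S.tprod_congr fun i hi => by rw [if_pos hi]
  | succ n hn ih =>
    rw [S.tprod_succ, if_neg (by omega), mul_one, hq.isIdempotentElem.eq, gns_mul_apply,
      h.gns_factor hq hq1, ih]

theorem map_single_mul_single (h : IsFlatVectorTensor T σ φ ψ S ψS) (b : A) (i j : Fin k) :
    ψ (T.factor 0 (Matrix.single i i 1) * b * T.factor 0 (Matrix.single j j 1)) =
      (k : ℂ)⁻¹ * φ (T.factor 0 (Matrix.single 0 i 1) * b * T.factor 0 (Matrix.single j 0 1)) := by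
  have h1 : ∀ j, T.factor 0 (Matrix.single j j 1) * flatElt T =
      ((Real.sqrt k : ℂ))⁻¹ • T.factor 0 (Matrix.single j 0 1) := fun j => by
    rw [flatElt, ← map_mul, single_mul_flatColumn, map_smul]
  have h2 : star (flatElt T) * T.factor 0 (Matrix.single i i 1) =
      ((Real.sqrt k : ℂ))⁻¹ • T.factor 0 (Matrix.single 0 i 1) := by
    have := congrArg star (h1 i)
    rwa [star_mul, star_smul, star_factor_single, star_factor_single, star_inv₀,
      RCLike.star_def, Complex.conj_ofReal] at this
  rw [h.map_eq]
  calc φ (star (flatElt T) * (T.factor 0 (Matrix.single i i 1) * b *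
        T.factor 0 (Matrix.single j j 1)) * flatElt T) =
      φ ((star (flatElt T) * T.factor 0 (Matrix.single i i 1)) * b *
        (T.factor 0 (Matrix.single j j 1) * flatElt T)) := by simp only [mul_assoc]
    _ = _ := by
      rw [h1, h2, smul_mul_assoc, smul_mul_smul_comm, sqrt_inv_mul_self, map_smul, smul_eq_mul]

theorem map_single (h : IsFlatVectorTensor T σ φ ψ S ψS) (j : Fin k) :
    ψ (T.factor 0 (Matrix.single j j 1)) = (k : ℂ)⁻¹ := by
  have := h.map_single_mul_single 1 j j
  rw [mul_one, mul_one, ← map_mul, ← map_mul, h.vacuum.isProduct.map_factor (by simp)] at this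
  simpa using this

/-- This is the normalized Haar measure of a cylinder on `n` coordinates, which is why the diagonal
vectors span a copy of `L²(G)`. -/
theorem map_diagTensor (h : IsFlatVectorTensor T σ φ ψ S ψS) (n : ℕ) (s : ℕ → Fin k) :
    ψS (diagTensor T S n s) = ((k : ℂ)⁻¹) ^ n := by
  rw [diagTensor, h.isProduct.map_tprod]
  simp [h.map_single]

theorem map_diagTensor_mul_mul (h : IsFlatVectorTensor T σ φ ψ S ψS)
    (hγ : IsTensorEndo T σ γ S γS) (x : A) {n i : ℕ} (hi : i < n) {s t : ℕ → Fin k}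
    (hst : s i ≠ t i) : ψS (diagTensor T S n s * γS x * diagTensor T S n t) = 0 := by
  refine S.tprod_induction (P := fun x => ψS (diagTensor T S n s * γS x * diagTensor T S n t) = 0)
    ?_ ?_ ?_ ?_ x
  · have h1 : Continuous fun x => ψS (diagTensor T S n s * γS x * diagTensor T S n t) :=
      (continuous_of_map_one h.map_one_tensor).comp
        ((continuous_const.mul (continuous_starAlgHom γS)).mul continuous_const)
    exact isClosed_singleton.preimage h1
  · intro m z
    rw [diagTensor, diagTensor, ← S.tprod_extend (le_max_left n m) fun i =>
      T.factor 0 (Matrix.single (s i) (s i) 1), ← S.tprod_extend (le_max_left n m) fun i =>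
      T.factor 0 (Matrix.single (t i) (t i) 1), ← S.tprod_extend (le_max_right n m) z,
      hγ.map_tprod, S.tprod_mul, S.tprod_mul, h.isProduct.map_tprod]
    refine Finset.prod_eq_zero (Finset.mem_range.mpr (hi.trans_le (le_max_left n m))) ?_
    simp only [Pi.mul_apply, if_pos hi]
    rw [h.map_single_mul_single, h.vacuum.offDiag (fixed_of_range hγ.range_eq _) hst, mul_zero]
  · intro x y hx hy
    rw [map_add, mul_add, add_mul, map_add, hx, hy, add_zero]
  · intro c x hx
    rw [map_smul, mul_smul_comm, smul_mul_assoc, map_smul, hx, smul_zero]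

/-- The cyclic vector stays cyclic for the range of `γS`. -/
theorem denseRange (h : IsFlatVectorTensor T σ φ ψ S ψS) (hγ : IsTensorEndo T σ γ S γS) :
    DenseRange fun x => ψS.gnsStarAlgHom (γS x) (cyclicVector ψS) := by
  let e : A →ₗ[ℂ] ψS.GNS := (ContinuousLinearMap.apply ℂ ψS.GNS (cyclicVector ψS)).toLinearMap ∘ₗ
    ψS.gnsStarAlgHom.toAlgHom.toLinearMap
  have he : ∀ x, e x = ψS.gnsStarAlgHom x (cyclicVector ψS) := fun _ => rfl
  let M : Submodule ℂ ψS.GNS := LinearMap.range (e ∘ₗ γS.toAlgHom.toLinearMap)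
  have hY : flatElt T * star (flatElt T) * flatElt T = flatElt T := by
    rw [mul_assoc, star_flatElt_mul, flatElt, ← map_mul, flatColumn, smul_mul_assoc,
      Finset.sum_mul]
    simp
  have hq : IsStarProjection (flatElt T * star (flatElt T)) := by
    refine ⟨?_, ?_⟩
    · rw [IsIdempotentElem, ← mul_assoc, hY]
    · rw [isSelfAdjoint_iff, star_mul, star_star]
  have hq1 : ψ (flatElt T * star (flatElt T)) = 1 := by
    rw [h.map_eq, mul_assoc, hY, ← h.map_one, h.map_eq, mul_one]
  have htp : ∀ n y, e (S.tprod n y) ∈ M := by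
    intro n y
    -- The projection onto the flat column fixes `Ω` in every factor and absorbs the shift, so each
    -- entry may be replaced by a fixed element.
    choose b hb hyb using fun i => exists_fixed_mul_eq hγ.gauge.pow_eq_one hγ.gauge.map_factor 0
      (q := flatElt T * star (flatElt T)) (by rw [← mul_assoc, shift_mul_flatElt]) (y i)
    obtain ⟨x, hx⟩ := hγ.exists_tprod (n := n) hb
    refine ⟨x, ?_⟩
    change ψS.gnsStarAlgHom (γS x) (cyclicVector ψS) = ψS.gnsStarAlgHom _ (cyclicVector ψS)
    nth_rw 1 [hx, ← h.gns_tprod hq hq1 n]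
    nth_rw 2 [← h.gns_tprod hq hq1 n]
    rw [← gns_mul_apply, ← gns_mul_apply, S.tprod_mul, S.tprod_mul]
    congr 2
    exact S.tprod_congr fun i _ => (hyb i).symm
  have hcl : ∀ y, e y ∈ closure (M : Set ψS.GNS) := fun y =>
    S.tprod_induction (P := fun y => e y ∈ M.topologicalClosure)
      (M.isClosed_topologicalClosure.preimage (continuous_gns_apply ψS _))
      (fun n y => M.le_topologicalClosure (htp n y))
      (fun x y hx hy => by rw [map_add]; exact add_mem hx hy)
      (fun c x hx => by rw [map_smul]; exact Submodule.smul_mem _ _ hx) y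
  have : Dense (M : Set ψS.GNS) := dense_closure.mp ((denseRange_gns ψS).mono (by
    rintro _ ⟨y, rfl⟩
    exact hcl y))
  refine this.mono ?_
  rintro _ ⟨x, rfl⟩
  exact ⟨x, rfl⟩

theorem map_tailProj (h : IsFlatVectorTensor T σ φ ψ S ψS) (n : ℕ) : ψ (tailProj T n) = 1 := by
  rw [h.map_eq, mul_assoc, flatElt, ← (commute_tailProj T n _).eq, ← mul_assoc, ← flatElt,
    star_flatElt_mul, single_mul_tailProj, h.vacuum.excised.map]

/-- One factor at a time: the deviation from the diagonal part tends to zero in norm, the other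
entries stay bounded, and the leftover tail projection fixes `Ω`. -/
theorem tendsto_gns_tprod_tailProj (h : IsFlatVectorTensor T σ φ ψ S ψS) {b : ℕ → A}
    (hb : ∀ i, σ (b i) = b i) (m : ℕ) :
    Tendsto (fun n => ψS.gnsStarAlgHom (S.tprod m fun i => tailProj T n * b i * tailProj T n)
      (cyclicVector ψS)) atTop
      (𝓝 (ψS.gnsStarAlgHom (S.tprod m fun i => diagPart T φ (b i)) (cyclicVector ψS))) := by
  induction m with
  | zero => simp only [S.tprod_zero]; exact tendsto_const_nhds
  | succ m ih =>
    set y : ℕ → A := fun n => S.tprod m fun i => tailProj T n * b i * tailProj T n with hy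
    have hyb : ∀ n, ‖y n‖ ≤ ‖(1 : A)‖ * ∏ i ∈ Finset.range m, ‖b i‖ := by
      intro n
      refine (S.norm_tprod_le m _).trans ?_
      gcongr with i _
      have hr := IsStarProjection.norm_le _ (isStarProjection_tailProj T n)
      calc ‖tailProj T n * b i * tailProj T n‖ ≤ ‖tailProj T n‖ * ‖b i‖ * ‖tailProj T n‖ :=
            (norm_mul_le _ _).trans (by gcongr; exact norm_mul_le _ _)
        _ ≤ 1 * ‖b i‖ * 1 := by gcongr
        _ = ‖b i‖ := by ring
    set δ : ℕ → A := fun n => tailProj T n * b m * tailProj T n -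
      diagPart T φ (b m) * tailProj T n with hδ
    have h1 : ∀ n, ψS.gnsStarAlgHom (S.tprod (m + 1) fun i => tailProj T n * b i * tailProj T n)
        (cyclicVector ψS) = ψS.gnsStarAlgHom (y n * S.factor m (δ n)) (cyclicVector ψS) +
          ψS.gnsStarAlgHom (S.factor m (diagPart T φ (b m)))
            (ψS.gnsStarAlgHom (y n) (cyclicVector ψS)) := by
      intro n
      have h2 : S.tprod (m + 1) (fun i => tailProj T n * b i * tailProj T n) =
          y n * S.factor m (δ n) + S.factor m (diagPart T φ (b m)) * y n *
            S.factor m (tailProj T n) := by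
        rw [S.tprod_succ, ← (S.tprod_commute_factor le_rfl _ _).eq, mul_assoc (S.tprod m _),
          ← map_mul, ← mul_add, ← map_add, hδ, sub_add_cancel]
      rw [h2, map_add, add_apply, gns_mul_apply ψS _ (S.factor m (tailProj T n)),
        h.gns_factor (isStarProjection_tailProj T n) (h.map_tailProj n), gns_mul_apply ψS _ (y n)]
    simp only [h1]
    rw [S.tprod_succ, (S.tprod_commute_factor le_rfl _ _).eq, gns_mul_apply,
      ← zero_add (ψS.gnsStarAlgHom (S.factor m (diagPart T φ (b m))) _)]
    refine Tendsto.add ?_ (((ψS.gnsStarAlgHom _).continuous.tendsto _).comp ih)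
    have h3 := (h.vacuum.tendsto_tailProj (hb m)).norm.const_mul
      (‖(1 : A)‖ * ∏ i ∈ Finset.range m, ‖b i‖)
    rw [norm_zero, mul_zero] at h3
    refine squeeze_zero_norm (fun n => ?_) h3
    refine (norm_gns_apply_le ψS _ _).trans ?_
    rw [norm_cyclicVector h.map_one_tensor, mul_one]
    exact (norm_mul_le _ _).trans (mul_le_mul (hyb n) (NonUnitalStarAlgHom.norm_apply_le _ _)
      (norm_nonneg _) (by positivity))

/-- Operators commuting with the range of `γS` map the cyclic vector into the closed span of the
vectors `(e_{s(0) s(0)} ⊗ ⋯ ⊗ e_{s(n-1) s(n-1)}) Ω`. -/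
theorem commutant_apply_mem (h : IsFlatVectorTensor T σ φ ψ S ψS) (hγ : IsTensorEndo T σ γ S γS)
    {M : Submodule ℂ ψS.GNS} (hM : IsClosed (M : Set ψS.GNS))
    (hd : ∀ n s, ψS.gnsStarAlgHom (diagTensor T S n s) (cyclicVector ψS) ∈ M)
    {R : ψS.GNS →L[ℂ] ψS.GNS} (hR : ∀ x, Commute R ((ψS.gnsStarAlgHom.comp γS) x)) :
    R (cyclicVector ψS) ∈ M := by
  have : CompleteSpace M := hM.completeSpace_coe
  -- Membership in `M` is tested by the projection `P` onto its complement. The tensors `Q n` of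
  -- tail projections push every vector into `M` in the limit.
  let P : ψS.GNS →L[ℂ] ψS.GNS := Mᗮ.starProjection
  have hP : ∀ ζ, P ζ = 0 ↔ ζ ∈ M := fun ζ => by
    rw [Submodule.starProjection_apply_eq_zero_iff, Submodule.orthogonal_orthogonal]
  have hP1 : ∀ ζ, ‖P ζ‖ ≤ ‖ζ‖ := fun ζ => Submodule.norm_starProjection_apply_le _ ζ
  let Q : ℕ → A := fun n => S.tprod n fun _ => tailProj T n
  have hQ : ∀ n, ψS.gnsStarAlgHom (Q n) (cyclicVector ψS) = cyclicVector ψS := fun n =>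
    h.gns_tprod (isStarProjection_tailProj T n) (h.map_tailProj n) n
  have hQn : ∀ n, ‖Q n‖ ≤ 1 := fun n => by
    refine IsStarProjection.norm_le _ ⟨?_, ?_⟩
    · rw [IsIdempotentElem, S.tprod_mul]
      exact S.tprod_congr fun i _ => (isStarProjection_tailProj T n).isIdempotentElem.eq
    · rw [isSelfAdjoint_iff, S.star_tprod]
      exact S.tprod_congr fun i _ => (isStarProjection_tailProj T n).isSelfAdjoint.star_eq
  have hdiag : ∀ m (b : ℕ → A),
      ψS.gnsStarAlgHom (S.tprod m fun i => diagPart T φ (b i)) (cyclicVector ψS) ∈ M := by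
    intro m b
    let e : A →ₗ[ℂ] ψS.GNS := (ContinuousLinearMap.apply ℂ ψS.GNS
      (cyclicVector ψS)).toLinearMap ∘ₗ ψS.gnsStarAlgHom.toAlgHom.toLinearMap
    have h1 := S.tprod_mem_span (n := m) (x := fun i => diagPart T φ (b i))
      (Y := Set.range fun j : Fin k => T.factor 0 (Matrix.single j j 1))
      (fun i _ => sum_mem fun j _ => Submodule.smul_mem _ _ (Submodule.subset_span ⟨j, rfl⟩))
      ⟨_, 0, rfl⟩
    have h2 := Submodule.mem_map_of_mem (f := e) h1
    rw [Submodule.map_span] at h2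
    refine Submodule.span_le.mpr ?_ h2
    rintro _ ⟨_, ⟨z, hz, rfl⟩, rfl⟩
    choose s hs using hz
    have : z = fun i => T.factor 0 (Matrix.single (s i) (s i) 1) := funext fun i => (hs i).symm
    rw [this]
    exact hd m s
  have htend : ∀ ζ, Tendsto (fun n => P (ψS.gnsStarAlgHom (Q n) ζ)) atTop (𝓝 0) := by
    have hcl : IsClosed {ζ : ψS.GNS | Tendsto (fun n => P (ψS.gnsStarAlgHom (Q n) ζ)) atTop (𝓝 0)} :=
      isClosed_setOf_tendsto_of_lipschitz (K := 1) (L := fun _ => 0) (fun n => by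
        refine LipschitzWith.of_dist_le_mul fun y z => ?_
        rw [dist_eq_norm, dist_eq_norm, ← map_sub, ← map_sub, NNReal.coe_one]
        refine (hP1 _).trans ((norm_gns_apply_le ψS _ _).trans ?_)
        exact mul_le_mul_of_nonneg_right (hQn n) (norm_nonneg _)) continuous_const
    have hx : ∀ x, Tendsto (fun n => P (ψS.gnsStarAlgHom (Q n)
        (ψS.gnsStarAlgHom (γS x) (cyclicVector ψS)))) atTop (𝓝 0) := by
      intro x
      refine S.tprod_induction (P := fun x => Tendsto (fun n => P (ψS.gnsStarAlgHom (Q n)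
        (ψS.gnsStarAlgHom (γS x) (cyclicVector ψS)))) atTop (𝓝 0)) ?_ ?_ ?_ ?_ x
      · exact hcl.preimage ((continuous_gns_apply ψS _).comp (continuous_starAlgHom γS))
      · intro m z
        have h1 := h.tendsto_gns_tprod_tailProj (b := fun i => γ (z i))
          (fun i => fixed_of_range hγ.range_eq _) m
        have h2 := (P.continuous.tendsto _).comp h1
        rw [(hP _).mpr (hdiag m fun i => γ (z i))] at h2
        refine h2.congr' ?_
        filter_upwards [eventually_ge_atTop m] with n hn
        change P (ψS.gnsStarAlgHom _ _) = _
        congr 1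
        nth_rw 2 [← hQ n]
        rw [← gns_mul_apply, ← gns_mul_apply, hγ.map_tprod, ← S.tprod_extend hn (fun i => γ (z i)),
          S.tprod_mul, S.tprod_mul]
        exact (h.gns_tprod_compress (isStarProjection_tailProj T n) (h.map_tailProj n) hn _).symm
      · intro x y hx hy
        have := hx.add hy
        rw [add_zero] at this
        refine this.congr fun n => ?_
        rw [map_add, map_add, add_apply, map_add, map_add]
      · intro c x hx
        have := hx.const_smul c
        rw [smul_zero] at this
        refine this.congr fun n => ?_
        rw [map_smul, map_smul, smul_apply, map_smul, map_smul]
    intro ζ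
    exact hcl.closure_subset_iff.mpr (by rintro _ ⟨x, rfl⟩; exact hx x) (h.denseRange hγ ζ)
  refine (hP _).mp (tendsto_nhds_unique (tendsto_const_nhds.congr fun n => ?_)
    (htend (R (cyclicVector ψS))))
  -- `Q n` lies in the range of `γS` and fixes `Ω`. It therefore fixes `RΩ`, so `P RΩ` is a constant
  -- sequence tending to zero.
  obtain ⟨x, hx⟩ := hγ.exists_tprod (n := n) (b := fun _ => tailProj T n)
    fun _ => gauge_tailProj hγ.gauge n
  have : ψS.gnsStarAlgHom (Q n) (R (cyclicVector ψS)) = R (cyclicVector ψS) := by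
    change ψS.gnsStarAlgHom (S.tprod n fun _ => tailProj T n) _ = _
    nth_rw 2 [← hQ n]
    change _ = R (ψS.gnsStarAlgHom (S.tprod n fun _ => tailProj T n) _)
    rw [← hx]
    exact (commutant_apply hR x _).symm
  rw [this]

end IsFlatVectorTensor

end FlatTensor

/-! ### Cylinder functions and Haar measure on `∏ ℤ/k` -/

section Cylinder

variable {k : ℕ}

/-- Replace the coordinates from `n` on by `0`. -/
def truncate (n : ℕ) (x : ℕ → ZMod k) : ℕ → ZMod k := fun i => if i < n then x i else 0

/-- Extend a finite sequence by `0`. -/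
def extendZero {n : ℕ} (a : Fin n → ZMod k) : ℕ → ZMod k := fun i => if h : i < n then a ⟨i, h⟩ else 0

theorem extendZero_of_lt {n i : ℕ} (a : Fin n → ZMod k) (h : i < n) :
    extendZero a i = a ⟨i, h⟩ := dif_pos h

theorem exists_extendZero_ne {n : ℕ} {a b : Fin n → ZMod k} (h : a ≠ b) :
    ∃ i < n, extendZero a i ≠ extendZero b i := by
  obtain ⟨i, hi⟩ := Function.ne_iff.mp h
  exact ⟨i, i.2, by rwa [extendZero_of_lt _ i.2, extendZero_of_lt _ i.2]⟩

theorem truncate_truncate {m n : ℕ} (h : m ≤ n) (x : ℕ → ZMod k) :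
    truncate m (truncate n x) = truncate m x := by
  ext i
  simp only [truncate]
  split_ifs <;> first | rfl | omega

theorem continuous_truncate (n : ℕ) : Continuous (truncate (k := k) n) :=
  continuous_pi fun i => by
    by_cases hi : i < n
    · simpa only [truncate, hi, if_true] using continuous_apply i
    · simpa only [truncate, hi, if_false] using continuous_const

/-- `F` depends only on the first `n` coordinates. -/
def IsCyl (n : ℕ) (F : C(ℕ → ZMod k, ℂ)) : Prop := ∀ x, F (truncate n x) = F x

theorem IsCyl.mono {m n : ℕ} {F : C(ℕ → ZMod k, ℂ)} (h : IsCyl m F) (hmn : m ≤ n) : IsCyl n F :=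
  fun x => by rw [← h, truncate_truncate hmn, h]

variable (k) in
/-- The functions that depend only on finitely many coordinates. -/
def cylFunctions : Submodule ℂ C(ℕ → ZMod k, ℂ) where
  carrier := {F | ∃ n, IsCyl n F}
  zero_mem' := ⟨0, fun _ => rfl⟩
  add_mem' := by
    rintro F F' ⟨m, hF⟩ ⟨n, hF'⟩
    exact ⟨max m n, fun x => congrArg₂ (· + ·) (hF.mono (le_max_left m n) x)
      (hF'.mono (le_max_right m n) x)⟩
  smul_mem' := by
    rintro c F ⟨n, hF⟩
    exact ⟨n, fun x => congrArg (c * ·) (hF x)⟩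

theorem tendsto_truncate (F : C(ℕ → ZMod k, ℂ)) :
    Tendsto (fun n => F.comp ⟨truncate n, continuous_truncate n⟩) atTop (𝓝 F) := by
  refine ContinuousMap.tendsto_of_tendstoLocallyUniformly ?_
  rw [tendstoLocallyUniformly_iff_forall_tendsto]
  intro x
  have h1 : Tendsto (fun p : ℕ × (ℕ → ZMod k) => truncate p.1 p.2) (atTop ×ˢ 𝓝 x) (𝓝 x) := by
    refine tendsto_pi_nhds.mpr fun i => ?_
    refine (((continuous_apply i).tendsto x).comp tendsto_snd).congr' ?_
    filter_upwards [(eventually_gt_atTop i).prod_inl (𝓝 x)] with p hp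
    exact (if_pos hp).symm
  exact (((F.continuous.tendsto x).comp tendsto_snd).prodMk_nhds
    ((F.continuous.tendsto x).comp h1)).mono_right (nhds_le_uniformity _)

theorem dense_cylFunctions [NeZero k] (μ : Measure (ℕ → ZMod k)) [IsFiniteMeasure μ]
    [μ.WeaklyRegular] : Dense (ContinuousMap.toLp 2 μ ℂ '' (cylFunctions k : Set C(ℕ → ZMod k, ℂ))) := by
  refine dense_closure.mp ((ContinuousMap.toLp_denseRange ℂ μ ℂ (p := 2) (by norm_num)).mono ?_)
  rintro _ ⟨F, rfl⟩
  refine mem_closure_of_tendsto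
    (((ContinuousMap.toLp 2 μ ℂ).continuous.tendsto _).comp (tendsto_truncate F))
    (Eventually.of_forall fun n => ⟨_, ⟨n, fun x => ?_⟩, rfl⟩)
  exact congrArg F (truncate_truncate le_rfl x)

/-- The integral of a function of `n` coordinates is the mean of its values. -/
theorem integral_of_isCyl [NeZero k] (μ : Measure (ℕ → ZMod k)) [IsFiniteMeasure μ]
    [μ.IsAddLeftInvariant] {n : ℕ} {F : C(ℕ → ZMod k, ℂ)} (hF : IsCyl n F) :
    ∫ x, F x ∂μ = μ.real Set.univ * ∑ a : Fin n → ZMod k, F (extendZero a) * (k : ℂ)⁻¹ ^ n := by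
  have hk : (k : ℂ) ≠ 0 := NeZero.ne _
  -- Averaging over translations in the first `n` coordinates makes a function of these coordinates
  -- constant; invariance of `μ` does the rest.
  have h1 : ∀ x, ∑ a : Fin n → ZMod k, F (extendZero a + x) =
      ∑ a : Fin n → ZMod k, F (extendZero a) := by
    intro x
    refine Fintype.sum_equiv (Equiv.addRight fun i : Fin n => x i) _ _ fun a => ?_
    rw [← hF]
    congr 1
    ext i
    by_cases hi : i < n <;> simp [truncate, extendZero, hi]
  have h2 : ∑ a : Fin n → ZMod k, ∫ x, F (extendZero a + x) ∂μ =
      μ.real Set.univ * ∑ a : Fin n → ZMod k, F (extendZero a) := by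
    rw [← integral_finsetSum]
    · simp only [h1, integral_const, Complex.real_smul]
    · intro a _
      exact (F.continuous.comp (continuous_const.add continuous_id)).integrable_of_hasCompactSupport
        (HasCompactSupport.of_compactSpace _)
  simp only [integral_add_left_eq_self fun x => F x, Finset.sum_const, Finset.card_univ,
    Fintype.card_fun, ZMod.card, Fintype.card_fin, nsmul_eq_mul, Nat.cast_pow] at h2
  rw [← Finset.sum_mul, ← mul_assoc, ← h2, mul_comm ((k : ℂ) ^ n), mul_assoc, ← mul_pow,
    mul_inv_cancel₀ hk, one_pow, mul_one]

theorem exists_cyl_indicator [NeZero k] (n : ℕ) (s : ℕ → ZMod k) :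
    ∃ F : C(ℕ → ZMod k, ℂ), IsCyl n F ∧
      ∀ x, F x = if ∀ i : Fin n, x i = s i then 1 else 0 := by
  refine ⟨⟨fun x => if ∀ i : Fin n, x i = s i then 1 else 0, ?_⟩, fun x => ?_, fun _ => rfl⟩
  · have h1 : Continuous fun a : Fin n → ZMod k => if ∀ i : Fin n, a i = s i then (1 : ℂ) else 0 :=
      continuous_of_discreteTopology
    exact h1.comp (continuous_pi fun i : Fin n => continuous_apply (i : ℕ))
  · have : ∀ i : Fin n, truncate n x i = x i := fun i => if_pos i.2
    simp only [ContinuousMap.coe_mk, this]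

/-- If `s` cannot be split, each coordinate is almost everywhere constant on it. Then `s` is
concentrated at a single point, which is null because the group is not discrete. -/
theorem exists_splitting [NeZero k] (hk : 1 < k) (μ : Measure (ℕ → ZMod k)) [μ.IsAddHaarMeasure]
    {s : Set (ℕ → ZMod k)} (hs : MeasurableSet s) (hs0 : μ s ≠ 0) :
    ∃ t, MeasurableSet t ∧ t ⊆ s ∧ μ t ≠ 0 ∧ μ (s \ t) ≠ 0 := by
  have : Fact (1 < k) := ⟨hk⟩
  have hne : (𝓝[≠] (0 : ℕ → ZMod k)).NeBot := by
    have h1 : Tendsto (fun n : ℕ => (Pi.single n 1 : ℕ → ZMod k)) atTop (𝓝[≠] 0) := by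
      refine tendsto_nhdsWithin_iff.mpr ⟨tendsto_pi_nhds.mpr fun i => ?_, ?_⟩
      · refine tendsto_const_nhds.congr' ?_
        filter_upwards [eventually_gt_atTop i] with n hn
        rw [Pi.single_eq_of_ne hn.ne, Pi.zero_apply]
      · exact Eventually.of_forall fun n h => one_ne_zero (α := ZMod k)
          (by simpa using congrFun h n)
    exact h1.neBot
  by_contra! hcon
  have hmeas : ∀ n c, MeasurableSet (s ∩ {x | x n = c}) := fun n c =>
    hs.inter ((measurable_pi_apply (X := fun _ => ZMod k) n) (measurableSet_singleton c))
  have hex : ∀ n, ∃ c : ZMod k, μ (s ∩ {x | x n = c}) ≠ 0 := by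
    intro n
    by_contra! h0
    refine hs0 (measure_mono_null (fun x hx => ?_) (measure_iUnion_null h0))
    exact Set.mem_iUnion.mpr ⟨x n, hx, rfl⟩
  choose c hc using hex
  have hnull := fun n => hcon _ (hmeas n (c n)) Set.inter_subset_left (hc n)
  refine hs0 (measure_mono_null (t := (⋃ n, s \ (s ∩ {x | x n = c n})) ∪ {c}) (fun x hx => ?_)
    (measure_union_null (measure_iUnion_null hnull) (measure_singleton c)))
  by_cases hxc : x = c
  · exact Or.inr hxc
  · obtain ⟨n, hn⟩ := Function.ne_iff.mp hxc
    exact Or.inl (Set.mem_iUnion.mpr ⟨n, hx, fun h => hn h.2⟩)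

end Cylinder

/-! ### Cylinder functions as diagonal elements -/

section DiagonalFunctions

variable {k : ℕ} [NeZero k] {A : Type*} [CStarAlgebra A] (T : UHF k A) (S : InfTensorPower A A)

/-- The diagonal projection of a point of `∏ ℤ/k`. -/
def pointProj (n : ℕ) (x : ℕ → ZMod k) : A :=
  diagTensor T S n fun i => (ZMod.finEquiv k).symm (x i)

/-- The diagonal element with the values of `F` at the first `n` coordinates. -/
def diagElt (n : ℕ) : C(ℕ → ZMod k, ℂ) →ₗ[ℂ] A where
  toFun F := ∑ a : Fin n → ZMod k, F (extendZero a) • pointProj T S n (extendZero a)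
  map_add' F F' := by
    simp only [ContinuousMap.add_apply, add_smul, Finset.sum_add_distrib]
  map_smul' c F := by
    simp only [ContinuousMap.smul_apply, smul_assoc, Finset.smul_sum, RingHom.id_apply]

theorem diagElt_apply (n : ℕ) (F : C(ℕ → ZMod k, ℂ)) : diagElt T S n F =
    ∑ a : Fin n → ZMod k, F (extendZero a) • pointProj T S n (extendZero a) := rfl

variable {T S}

theorem pointProj_mul {n : ℕ} (a b : Fin n → ZMod k) :
    pointProj T S n (extendZero a) * pointProj T S n (extendZero b) =
      if a = b then pointProj T S n (extendZero a) else 0 := by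
  split_ifs with h
  · rw [h]
    exact diagTensor_mul_self n _
  · obtain ⟨i, hi, hne⟩ := exists_extendZero_ne h
    exact diagTensor_mul_of_ne hi ((ZMod.finEquiv k).symm.injective.ne hne)

theorem diagElt_mul (n : ℕ) (F F' : C(ℕ → ZMod k, ℂ)) :
    diagElt T S n F * diagElt T S n F' = diagElt T S n (F * F') := by
  simp only [diagElt_apply, Finset.sum_mul, Finset.mul_sum, smul_mul_smul_comm, pointProj_mul,
    smul_ite, smul_zero, Finset.sum_ite_eq', Finset.mem_univ, if_true,
    ContinuousMap.mul_apply]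

theorem star_diagElt (n : ℕ) (F : C(ℕ → ZMod k, ℂ)) :
    star (diagElt T S n F) = diagElt T S n (star F) := by
  simp only [diagElt_apply, star_sum, star_smul, pointProj, star_diagTensor,
    ContinuousMap.star_apply]

/-- `F` does not see the last coordinate, and summing over it produces `∑_c e_{cc} = 1`. -/
theorem diagElt_succ {n : ℕ} {F : C(ℕ → ZMod k, ℂ)} (hF : IsCyl n F) :
    diagElt T S (n + 1) F = diagElt T S n F := by
  have h1 : ∀ (c : ZMod k) (b : Fin n → ZMod k) (a : Fin (n + 1) → ZMod k), a = Fin.snoc b c →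
      F (extendZero a) • pointProj T S (n + 1) (extendZero a) =
        F (extendZero b) • (pointProj T S n (extendZero b) *
          S.factor n (T.factor 0 (Matrix.single ((ZMod.finEquiv k).symm c)
            ((ZMod.finEquiv k).symm c) 1))) := by
    rintro c b _ rfl
    have h2 : ∀ i < n, extendZero (Fin.snoc b c : Fin (n + 1) → ZMod k) i = extendZero b i := by
      intro i hi
      rw [extendZero_of_lt _ (by omega), extendZero_of_lt _ hi]
      exact Fin.snoc_castSucc (α := fun _ => ZMod k) c b ⟨i, hi⟩
    have h3 : extendZero (Fin.snoc b c : Fin (n + 1) → ZMod k) n = c := by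
      rw [extendZero_of_lt _ (by omega)]
      exact Fin.snoc_last (α := fun _ => ZMod k) c b
    have h4 : F (extendZero (Fin.snoc b c : Fin (n + 1) → ZMod k)) = F (extendZero b) := by
      rw [← hF]
      congr 1
      ext i
      by_cases hi : i < n
      · simp only [truncate, hi, if_true, h2 i hi]
      · simp [truncate, extendZero, hi]
    rw [h4, pointProj, diagTensor, S.tprod_succ, h3, pointProj, diagTensor]
    congr 2
    exact S.tprod_congr fun i hi => by rw [h2 i hi]
  rw [diagElt_apply, diagElt_apply, ← (Fin.snocEquiv fun _ => ZMod k).sum_comp,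
    Fintype.sum_prod_type_right]
  refine Finset.sum_congr rfl fun b _ => ?_
  refine (Finset.sum_congr rfl fun c _ => h1 c b _ rfl).trans ?_
  rw [← Finset.smul_sum, ← Finset.mul_sum]
  have h5 : ∑ c : ZMod k, S.factor n (T.factor 0 (Matrix.single ((ZMod.finEquiv k).symm c)
      ((ZMod.finEquiv k).symm c) 1)) = 1 := by
    refine ((ZMod.finEquiv k).symm.toEquiv.sum_comp fun j =>
      S.factor n (T.factor 0 (Matrix.single j j 1))).trans ?_
    rw [← map_sum]
    have : ∑ i : Fin k, T.factor 0 (Matrix.single i i 1) = 1 := sum_map_single _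
    rw [this, map_one]
  rw [h5, mul_one]

theorem diagElt_of_le {m n : ℕ} (h : m ≤ n) {F : C(ℕ → ZMod k, ℂ)} (hF : IsCyl m F) :
    diagElt T S n F = diagElt T S m F := by
  induction n, h using Nat.le_induction with
  | base => rfl
  | succ n hn ih => rw [diagElt_succ (hF.mono hn), ih]

theorem diagElt_one (n : ℕ) : diagElt T S n 1 = 1 := by
  rw [diagElt_of_le (Nat.zero_le n) fun _ => rfl, diagElt_apply]
  simp [pointProj, diagTensor]

theorem diagElt_indicator {n : ℕ} {s : ℕ → ZMod k} {F : C(ℕ → ZMod k, ℂ)}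
    (hF : ∀ x, F x = if ∀ i : Fin n, x i = s i then 1 else 0) :
    diagElt T S n F = pointProj T S n s := by
  rw [diagElt_apply, Finset.sum_eq_single fun i : Fin n => s i]
  · rw [hF, if_pos fun i => extendZero_of_lt _ i.2, one_smul]
    exact S.tprod_congr fun i hi => by simp only [extendZero_of_lt _ hi]
  · intro a _ ha
    rw [hF, if_neg, zero_smul]
    intro h
    exact ha (funext fun i => by rw [← h i, extendZero_of_lt _ i.2])
  · simp

variable (T S) in
/-- The diagonal element of a function of finitely many coordinates. -/
def cylElt : cylFunctions k →ₗ[ℂ] A where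
  toFun F := diagElt T S F.2.choose F
  map_add' F F' := by
    -- The three chosen lengths are unrelated; `diagElt_of_le` moves everything to a common one.
    set m := max (F + F').2.choose (max F.2.choose F'.2.choose)
    rw [← diagElt_of_le (n := m) (by omega) (F + F').2.choose_spec,
      ← diagElt_of_le (n := m) (by omega) F.2.choose_spec,
      ← diagElt_of_le (n := m) (by omega) F'.2.choose_spec, ← map_add]
    rfl
  map_smul' c F := by
    set m := max (c • F).2.choose F.2.choose
    rw [← diagElt_of_le (n := m) (by omega) (c • F).2.choose_spec,
      ← diagElt_of_le (n := m) (by omega) F.2.choose_spec, RingHom.id_apply, ← map_smul]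
    rfl

theorem cylElt_eq {n : ℕ} (F : cylFunctions k) (hF : IsCyl n (F : C(ℕ → ZMod k, ℂ))) :
    cylElt T S F = diagElt T S n F := by
  change diagElt T S F.2.choose F = _
  rw [← diagElt_of_le (le_max_left F.2.choose n) F.2.choose_spec,
    diagElt_of_le (le_max_right _ n) hF]

theorem IsTensorEndo.exists_diagElt {σ : A ≃⋆ₐ[ℂ] A} {γ γS : A →⋆ₐ[ℂ] A}
    (hγ : IsTensorEndo T σ γ S γS) (n : ℕ) (F : C(ℕ → ZMod k, ℂ)) :
    ∃ x, γS x = diagElt T S n F := by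
  choose x hx using fun s => hγ.exists_diagTensor n s
  refine ⟨∑ a : Fin n → ZMod k, F (extendZero a) •
    x fun i => (ZMod.finEquiv k).symm (extendZero a i), ?_⟩
  simp only [map_sum, map_smul, hx]
  rfl

end DiagonalFunctions

/-! ### The commutant for `ψ^∞` as `L^∞(G)` -/

section FlatModel

variable {k : ℕ} [NeZero k] {A : Type*} [CStarAlgebra A] [PartialOrder A] [StarOrderedRing A]
  {T : UHF k A} {σ : A ≃⋆ₐ[ℂ] A} {γ γS : A →⋆ₐ[ℂ] A} {S : InfTensorPower A A}
  {φ ψ ψS : A →ₚ[ℂ] ℂ} {μ : Measure (ℕ → ZMod k)} [IsFiniteMeasure μ]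

namespace IsFlatVectorTensor

/-- The total mass appears because `μ` is not assumed to be normalized; its square root rescales the
embedding of `L²` below. -/
theorem map_diagElt (h : IsFlatVectorTensor T σ φ ψ S ψS) [μ.IsAddLeftInvariant] {n : ℕ}
    {F : C(ℕ → ZMod k, ℂ)} (hF : IsCyl n F) :
    (μ.real Set.univ : ℂ) * ψS (diagElt T S n F) = ∫ x, F x ∂μ := by
  rw [integral_of_isCyl μ hF, diagElt_apply, map_sum]
  congr 1
  refine Finset.sum_congr rfl fun a _ => ?_
  rw [map_smul, pointProj, h.map_diagTensor, smul_eq_mul]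

theorem norm_diagElt (h : IsFlatVectorTensor T σ φ ψ S ψS) [μ.IsAddLeftInvariant] {n : ℕ}
    {F : C(ℕ → ZMod k, ℂ)} (hF : IsCyl n F) :
    √(μ.real Set.univ) * ‖ψS.gnsStarAlgHom (diagElt T S n F) (cyclicVector ψS)‖ =
      ‖ContinuousMap.toLp 2 μ ℂ F‖ := by
  have h1 : ((μ.real Set.univ : ℝ) : ℂ) *
      (‖ψS.gnsStarAlgHom (diagElt T S n F) (cyclicVector ψS)‖ : ℂ) ^ 2 =
        (‖ContinuousMap.toLp 2 μ ℂ F‖ : ℂ) ^ 2 := by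
    have h2 := inner_self_eq_norm_sq_to_K (𝕜 := ℂ) (ContinuousMap.toLp 2 μ ℂ F)
    have h3 := inner_self_eq_norm_sq_to_K (𝕜 := ℂ)
      (ψS.gnsStarAlgHom (diagElt T S n F) (cyclicVector ψS))
    rw [ContinuousMap.inner_toLp] at h2
    rw [inner_gns_gns, star_diagElt, diagElt_mul] at h3
    refine (congrArg _ h3.symm).trans (Eq.trans ?_ h2)
    rw [h.map_diagElt (F := star F * F) fun x => by
      simp only [ContinuousMap.mul_apply, ContinuousMap.star_apply, hF x]]
    refine integral_congr_ae (Eventually.of_forall fun x => ?_)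
    exact mul_comm _ _
  have h4 : μ.real Set.univ * ‖ψS.gnsStarAlgHom (diagElt T S n F) (cyclicVector ψS)‖ ^ 2 =
      ‖ContinuousMap.toLp 2 μ ℂ F‖ ^ 2 := by exact_mod_cast h1
  rw [← Real.sqrt_sq (norm_nonneg (ContinuousMap.toLp 2 μ ℂ F)), ← h4,
    Real.sqrt_mul measureReal_nonneg, Real.sqrt_sq (norm_nonneg _)]

theorem exists_embedding (h : IsFlatVectorTensor T σ φ ψ S ψS) [μ.IsAddLeftInvariant]
    [μ.WeaklyRegular] : ∃ V : Lp ℂ 2 μ →ₗᵢ[ℂ] ψS.GNS, ∀ n F, IsCyl n F →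
      V (ContinuousMap.toLp 2 μ ℂ F) = (√(μ.real Set.univ) : ℂ) •
        ψS.gnsStarAlgHom (diagElt T S n F) (cyclicVector ψS) := by
  let e : A →ₗ[ℂ] ψS.GNS := (ContinuousLinearMap.apply ℂ ψS.GNS (cyclicVector ψS)).toLinearMap ∘ₗ
    ψS.gnsStarAlgHom.toAlgHom.toLinearMap
  let f : cylFunctions k →ₗ[ℂ] ψS.GNS := (√(μ.real Set.univ) : ℂ) • (e ∘ₗ cylElt T S)
  let g : cylFunctions k →ₗ[ℂ] Lp ℂ 2 μ :=
    (ContinuousMap.toLp 2 μ ℂ).toLinearMap ∘ₗ (cylFunctions k).subtype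
  have hf : ∀ F : cylFunctions k, f F = (√(μ.real Set.univ) : ℂ) •
      ψS.gnsStarAlgHom (cylElt T S F) (cyclicVector ψS) := fun _ => rfl
  have hg : DenseRange g := by
    refine (dense_cylFunctions μ).mono ?_
    rintro _ ⟨F, hF, rfl⟩
    exact ⟨⟨F, hF⟩, rfl⟩
  have hfg : ∀ F, ‖f F‖ = ‖g F‖ := by
    intro F
    obtain ⟨n, hn⟩ := F.2
    rw [hf, norm_smul, cylElt_eq F hn, Complex.norm_real, Real.norm_of_nonneg (Real.sqrt_nonneg _),
      h.norm_diagElt hn]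
    rfl
  let V := f.extendOfNorm g
  have hV : ∀ F, V (g F) = f F := fun F =>
    LinearMap.extendOfNorm_eq hg ⟨1, fun F => by rw [hfg, one_mul]⟩ F
  have hnorm : ∀ ζ, ‖V ζ‖ = ‖ζ‖ := fun ζ =>
    congrFun (hg.equalizer V.continuous.norm continuous_norm (funext fun F => by
      change ‖V (g F)‖ = ‖g F‖
      rw [hV, hfg])) ζ
  refine ⟨⟨V.toLinearMap, hnorm⟩, fun n F hF => ?_⟩
  have h1 := hV ⟨F, n, hF⟩
  rw [hf, cylElt_eq _ hF] at h1
  exact h1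

/-- The vectors `γS x` times point projections applied to `Ω` are orthogonal for different points,
by `map_diagTensor_mul_mul`. Scaling them by the values of `F` increases the norm by at most `‖F‖`.
-/
theorem norm_gns_diagElt_le (h : IsFlatVectorTensor T σ φ ψ S ψS) (hγ : IsTensorEndo T σ γ S γS)
    (n : ℕ) (F : C(ℕ → ZMod k, ℂ)) (x : A) :
    ‖ψS.gnsStarAlgHom (γS x) (ψS.gnsStarAlgHom (diagElt T S n F) (cyclicVector ψS))‖ ≤
      ‖F‖ * ‖ψS.gnsStarAlgHom (γS x) (cyclicVector ψS)‖ := by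
  let v : (Fin n → ZMod k) → ψS.GNS := fun a =>
    ψS.gnsStarAlgHom (γS x) (ψS.gnsStarAlgHom (pointProj T S n (extendZero a)) (cyclicVector ψS))
  have horth : ∀ a b, a ≠ b → inner ℂ (v a) (v b) = (0 : ℂ) := by
    intro a b hab
    obtain ⟨i, hi, hne⟩ := exists_extendZero_ne hab
    simp only [v]
    rw [← gns_mul_apply, ← gns_mul_apply, inner_gns_gns, star_mul, pointProj, pointProj,
      star_diagTensor, mul_assoc, ← mul_assoc (star (γS x)), ← map_star, ← map_mul, ← mul_assoc]
    exact h.map_diagTensor_mul_mul hγ _ hi ((ZMod.finEquiv k).symm.injective.ne hne)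
  have hsum : ∀ F : C(ℕ → ZMod k, ℂ), ψS.gnsStarAlgHom (γS x)
      (ψS.gnsStarAlgHom (diagElt T S n F) (cyclicVector ψS)) =
        ∑ a, F (extendZero a) • v a := by
    intro F
    simp only [diagElt_apply, map_sum, map_smul, sum_apply, smul_apply, v]
  have h1 := hsum 1
  rw [diagElt_one, gns_one_apply] at h1
  simp only [ContinuousMap.one_apply, one_smul] at h1
  refine (pow_le_pow_iff_left₀ (norm_nonneg _) (by positivity) two_ne_zero).mp ?_
  rw [hsum, h1, mul_pow, norm_sum_sq_of_orthogonal _ _ fun a _ b _ hab => horth a b hab,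
    norm_sum_sq_of_orthogonal, Finset.mul_sum]
  · refine Finset.sum_le_sum fun a _ => ?_
    rw [norm_smul, mul_pow]
    gcongr
    exact F.norm_coe_le_norm _
  · intro a _ b _ hab
    rw [inner_smul_left, inner_smul_right, horth a b hab, mul_zero, mul_zero]

theorem exists_model (h : IsFlatVectorTensor T σ φ ψ S ψS) (hγ : IsTensorEndo T σ γ S γS)
    [μ.IsAddLeftInvariant] [μ.WeaklyRegular] (hμ : μ Set.univ ≠ 0) :
    ∃ V : Lp ℂ 2 μ →ₗᵢ[ℂ] ψS.GNS,
      LInftyModel (ψS.gnsStarAlgHom.comp γS) V (cylFunctions k : Set C(ℕ → ZMod k, ℂ)) := by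
  obtain ⟨V, hV⟩ := h.exists_embedding (μ := μ)
  have hc : (√(μ.real Set.univ) : ℂ) ≠ 0 := by
    rw [Ne, Complex.ofReal_eq_zero, Real.sqrt_eq_zero measureReal_nonneg,
      measureReal_eq_zero_iff]
    exact hμ
  have hV1 : V (oneL μ) = (√(μ.real Set.univ) : ℂ) • cyclicVector ψS := by
    rw [oneL, hV 0 1 fun _ => rfl, diagElt_one, gns_one_apply]
  have hmul : ∀ {n F}, IsCyl n F → ∀ g, ψS.gnsStarAlgHom (diagElt T S n F) (V g) =
      V (mulL (ContinuousMap.toLp ∞ μ ℂ F) g) := by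
    intro n F hF g
    refine congrFun (Continuous.ext_on (dense_cylFunctions μ)
      ((ψS.gnsStarAlgHom _).continuous.comp V.continuous)
      (V.continuous.comp (mulL (ContinuousMap.toLp ∞ μ ℂ F)).continuous) ?_) g
    rintro _ ⟨F', ⟨m, hF'⟩, rfl⟩
    change ψS.gnsStarAlgHom _ (V _) = V (mulL _ _)
    have h1 := hF.mono (le_max_left n m)
    have h2 := hF'.mono (le_max_right n m)
    rw [mulL_toLp_toLp, hV _ _ h2, hV (max n m) (F * F') fun x => by
      rw [ContinuousMap.mul_apply, ContinuousMap.mul_apply, h1, h2],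
      ← diagElt_of_le (le_max_left n m) hF, map_smul, ← gns_mul_apply, diagElt_mul]
  refine ⟨V, dense_cylFunctions μ, ?_, ?_, ?_, ?_, ?_⟩
  · rintro F ⟨n, hF⟩ c
    exact ⟨n, fun x => congrArg c (hF x)⟩
  · rintro F ⟨n, hF⟩
    obtain ⟨x, hx⟩ := hγ.exists_diagElt n F
    refine ⟨x, fun g => ?_⟩
    change ψS.gnsStarAlgHom (γS x) (V g) = _
    rw [hx, hmul hF]
  · rintro F ⟨n, hF⟩ x
    change ‖ψS.gnsStarAlgHom (γS x) _‖ ≤ ‖F‖ * ‖ψS.gnsStarAlgHom (γS x) _‖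
    rw [hV1, hV n F hF, map_smul, map_smul, norm_smul, norm_smul, mul_left_comm]
    exact mul_le_mul_of_nonneg_left (h.norm_gns_diagElt_le hγ n F x) (norm_nonneg _)
  · have h1 := (Homeomorph.smulOfNeZero (√(μ.real Set.univ) : ℂ) hc).surjective.denseRange.comp
      (h.denseRange hγ) (Homeomorph.smulOfNeZero (α := ψS.GNS) _ hc).continuous
    convert h1 using 2 with x
    change ψS.gnsStarAlgHom (γS x) _ =
      (√(μ.real Set.univ) : ℂ) • ψS.gnsStarAlgHom (γS x) _
    rw [hV1, map_smul]
  · intro R hR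
    -- The range of the isometry is closed and contains the diagonal vectors, as images of cylinder
    -- indicators.
    obtain ⟨g, hg⟩ := h.commutant_apply_mem hγ (M := LinearMap.range V.toLinearMap) (R := R)
      (V.isometry.isClosedEmbedding.isClosed_range) (fun n s => by
        obtain ⟨F, hF, hFs⟩ := exists_cyl_indicator n fun i => ZMod.finEquiv k (s i)
        refine ⟨(√(μ.real Set.univ) : ℂ)⁻¹ • ContinuousMap.toLp 2 μ ℂ F, ?_⟩
        change V _ = _
        rw [map_smul, hV n F hF, inv_smul_smul₀ hc, diagElt_indicator (s := fun i => ZMod.finEquiv k (s i)) hFs, pointProj]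
        simp only [RingEquiv.symm_apply_apply]) hR
    refine ⟨(√(μ.real Set.univ) : ℂ) • g, ?_⟩
    rw [hV1, map_smul, map_smul, ← hg]
    rfl

theorem isoLInfty (h : IsFlatVectorTensor T σ φ ψ S ψS) (hγ : IsTensorEndo T σ γ S γS)
    [μ.IsAddLeftInvariant] [μ.WeaklyRegular] (hμ : μ Set.univ ≠ 0) :
    IsoLInfty (gnsCommutant ψS γS) μ := by
  obtain ⟨V, hV⟩ := h.exists_model hγ hμ
  exact hV.isoLInfty

end IsFlatVectorTensor

end FlatModel

end UHFEndo

end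

/-! ### Assembly of the main theorem -/

open UHFEndo in
theorem mainTheorem3 {k : ℕ} [NeZero k] (hk : 1 < k)
    {A : Type*} [CStarAlgebra A] [PartialOrder A] [StarOrderedRing A] [Nontrivial A]
    (T : UHF k A) :
    ∃ (σ : A ≃⋆ₐ[ℂ] A) (φ ψ χ : A →ₚ[ℂ] ℂ),
      -- the automorphism `σ = ⊗ Ad v`
      (∀ n x, σ (T.factor n x) = T.factor n (clock k * x * star (clock k))) ∧ σ ^ k = 1 ∧
      -- the pure product states `φ`, `χ` and the pure vector state `ψ`
      T.IsProduct φ (fun x => x 0 0) ∧ IsPureState φ.toLinearMap ∧ (∀ x, φ (σ x) = φ x) ∧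
      T.IsProduct χ (fun x => (k : ℂ)⁻¹ * ∑ i, ∑ j, x i j) ∧ IsPureState χ.toLinearMap ∧
      (∀ x, ψ x = inner ℂ (flatVector T φ) (φ.gnsStarAlgHom x (flatVector T φ))) ∧
      IsPureState ψ.toLinearMap ∧ (∃ x, ψ (σ x) ≠ ψ x) ∧ (∃ W, Implements ψ W σ) ∧
      (∀ i < k, ∀ j < k, i ≠ j →
        DisjointGNS (pullback χ ((σ ^ i : A ≃⋆ₐ[ℂ] A) : A →⋆ₐ[ℂ] A))
          (pullback χ ((σ ^ j : A ≃⋆ₐ[ℂ] A) : A →⋆ₐ[ℂ] A))) ∧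
      -- an asymptotically inner endomorphism with range `A^σ`, implemented in `π_χ`
      (∃ γ : A →⋆ₐ[ℂ] A, IsAsymptoticallyInner γ ∧ Set.range γ = {x | σ x = x} ∧
        (∀ n, ∀ x ∈ T.level n, γ x ∈ T.level (n + 1)) ∧
        (∀ x, χ (γ x) = χ x) ∧ ∃ W, Implements χ W γ) ∧
      Nonempty (InfTensorPower A A) ∧
      -- properties of all endomorphisms with range `A^σ`
      ∀ γ : A →⋆ₐ[ℂ] A, Set.range γ = {x | σ x = x} →
        (∃ U : unitary (φ.GNS →L[ℂ] φ.GNS),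
          (∀ x, (U : φ.GNS →L[ℂ] φ.GNS) (φ.gnsStarAlgHom x (cyclicVector φ)) =
            φ.gnsStarAlgHom (σ x) (cyclicVector φ)) ∧
          Implements φ U σ ∧ U ^ k = 1 ∧
          gnsCommutant φ γ = doubleCommutant (U : φ.GNS →L[ℂ] φ.GNS)) ∧
        Nonempty (gnsCommutant φ γ ≃⋆ₐ[ℂ] (Fin k → ℂ)) ∧
        IsPureState (φ.toLinearMap ∘ₗ γ.range.subtype.toAlgHom.toLinearMap) ∧
        gnsCommutant χ γ = ⊥ ∧
        StarSubalgebra.centralizer ℂ (Set.range γ) = ⊥ ∧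
        -- the infinite tensor power of `γ`, for every identification of `A` with `A ⊗ A ⊗ ⋯`
        ∀ S : InfTensorPower A A, ∃ (γS : A →⋆ₐ[ℂ] A) (φS ψS : A →ₚ[ℂ] ℂ),
          (∀ n x, γS (S.factor n x) = S.factor n (γ x)) ∧
          (IsAsymptoticallyInner γ → IsAsymptoticallyInner γS) ∧
          S.IsProduct φS φ ∧ IsPureState φS.toLinearMap ∧
          IsPureState (φS.toLinearMap ∘ₗ γS.range.subtype.toAlgHom.toLinearMap) ∧
          Nonempty (gnsCommutant φS γS ≃⋆ₐ[ℂ] lp (fun _ : ℕ => ℂ) ∞) ∧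
          S.IsProduct ψS ψ ∧ IsPureState ψS.toLinearMap ∧
          IsoLInfty (gnsCommutant ψS γS) (Measure.addHaar : Measure (ℕ → ZMod k)) ∧
          IsNonAtomic (gnsCommutant ψS γS) := by
  obtain ⟨σ, hσT, hσk⟩ := exists_gauge T
  have hσ : IsGauge T σ := ⟨hσT, hσk⟩
  obtain ⟨φ, hφ⟩ := exists_isVacuum hσ
  obtain ⟨ψ, hψ, hψe⟩ := exists_flatVectorState hφ.excised
  obtain ⟨χ, hχp, hχe⟩ := exists_flatState T
  have hχ : IsFlat T σ χ := ⟨hσ, hχp, hχe⟩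
  obtain ⟨γ₀, hγ₀T⟩ := exists_ctrlEndo T
  have hγ₀ : IsCtrlEndo T γ₀ := ⟨hγ₀T⟩
  obtain ⟨p, hp⟩ := hχe
  refine ⟨σ, φ, ψ, χ, hσT, hσk, hφ.isProduct, hφ.excised.isPureState, hφ.invariant, hχp,
    hp.isPureState, flatVectorState_eq_inner hψ, hψe.isPureState,
    hφ.exists_flatVectorState_ne hk hψ, hφ.exists_flatVectorState_implements hψ,
    fun i hi j hj hij => hχ.disjointGNS hi hj hij,
    ⟨γ₀, hγ₀.isAsymptoticallyInner, hγ₀.range_eq hσ, hγ₀.map_mem_level, hγ₀.flatState_map hχ,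
      hγ₀.exists_implements hχ⟩, InfTensorPower.nonempty_self T, fun γ hγ => ?_⟩
  refine ⟨hφ.exists_unitary hγ, hφ.commutant_equiv hγ, hφ.isPureState_restrict hγ,
    hχ.gnsCommutant_eq_bot hγ, hχ.centralizer_eq_bot hγ, fun S => ?_⟩
  obtain ⟨γS, hγS⟩ := InfTensorPower.exists_tensorHom T S γ
  have hγS' : IsTensorEndo T σ γ S γS := ⟨hσ, hγ, hγS⟩
  obtain ⟨φS, hφS⟩ := exists_isVacuumTensor hφ S
  obtain ⟨ψS, hψS, hψSe⟩ := S.exists_product_of_excised (isProjSeq_flatVacProj T) hψe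
  have hψS' : IsFlatVectorTensor T σ φ ψ S ψS := ⟨hφ, hψ, hψS⟩
  have hiso : IsoLInfty (gnsCommutant ψS γS) (Measure.addHaar : Measure (ℕ → ZMod k)) :=
    hψS'.isoLInfty hγS' (isOpen_univ.measure_ne_zero _ Set.univ_nonempty)
  exact ⟨γS, φS, ψS, hγS, fun h => isAsymptoticallyInner_tensor S h hγS, hφS.isProduct,
    hφS.excised.isPureState, hφS.isPureState_restrict hγS', hφS.commutant_equiv hγS' hk, hψS,
    hψSe.isPureState, hiso,
    isNonAtomic_of_isoLInfty hiso fun _ hs hs0 => exists_splitting hk _ hs hs0⟩
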